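/- **Setting.** Let $p(z)=a_0+a_1z+\dots+a_nz^n$ ($n\ge 1$, $a_0\neq 0$, $a_n\ne 0$) be a complex polynomial with coefficient vector $a=(a_0,\dots,a_n)$, and let $v,w\in\mathbb C^n$ satisfy $v_1=a_0$, $v_{i+1}+w_i=a_i$ for $1\le i\le n-1$, and $w_n=a_n$. The companion pencil is $V-\lambda W$, where $V$ is the $n\times n$ matrix with ones on the subdiagonal, last column $(-v_1,\dots,-v_n)^T$ and zeros elsewhere, and $W$ is the identity matrix with its last column replaced by $w$. Norms are the Euclidean norm for vectors and the spectral norm for matrices. The splitting is assumed reasonable and the polynomial not scaled too small: for some $\kappa$ we have $\|v\|\le\kappa\|a\|$, $\|w\|\le\kappa\|a\|$ and $1\le\kappa\|a\|$. **Algorithm.** A core transformation in position $i$ is the identity matrix with the diagonal block in rows and columns $i,i+1$ replaced by a unitary block $\begin{bmatrix}c&-\epsilon\bar s\\ s&\epsilon\bar c\end{bmatrix}$, $\epsilon=\pm1$. The single-shift companion QZ algorithm stores $V=QR$ with $Q=Q_1\cdots Q_{n-1}$, and stores each of the upper triangular matrices $R$ and $W$ in the form $P^TC^*(B+\alpha e_1y^T)P$,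 where $P$ is the $(n+1)\times(n+1)$ identity without its last column, $C=C_1\cdots C_n$ and $B=B_1\cdots B_n$ are products of core transformations, and $\alpha y^T=-(e_{n+1}^TC^*e_1)^{-1}e_{n+1}^TC^*B$ is not stored; initially $C$ is computed so that it maps $(t,-1)^T$ to a multiple of $e_1$, where $t$ is the last column of $R$ (respectively $W$), and $B$ is $C$ with its last two columns exchanged. A step is one of the following. * A QZ iteration with an arbitrary shift $\mu$ on a decoupled diagonal block: a rotator $U_l$ whose first column is proportional to the (computed) first column of $V-\mu W$ in the block is formed and $U_l^*$ is fused with $Q_l$. Then, for $i$ running from the first to the last position of the block, $U_i^*$ is passed through $W$ ($U_i^*W=\hat WZ_i^*$, two turnovers) and $Z_i$ through $R$ ($RZ_i=X_i\hat R$, two turnovers); a turnover $Q_iQ_{i+1}X_i=U_{i+1}\hat Q_i\hat Q_{i+1}$ gives $U_{i+1}$, and the last $X_i$ is fused with $Q_i$. * A deflation: the sine of some $Q_i$, of modulus at most $u$, is set to zero. In a turnover the required entries of the product of the three core transformations are formed and refactored by a QR decomposition, but the sine of the second new core of the descending sequence (the first one when passing from left to right) is computed as $s_js_{j+1}$ divided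 by the sine of the other new core (if that sine is zero, from the corresponding entry of the matrix). Every new core transformation is rescaled so that $|c|^2+|s|^2=1$ up to roundoff. All operations are carried out in floating-point arithmetic with unit roundoff $u$ in the standard model: each real operation $+,-,\times,/,\sqrt{\cdot}$ returns its exact result with a relative error at most $u$, and there is no overflow or underflow. After $K$ steps let $\hat V,\hat W$ be the matrices represented by the stored core transformations, and let $U$ and $Z$ be the exact products of all the transformations $U_i$ and $Z_i$ computed so far, each taken as the exactly unitary core transformation obtained by normalizing its computed pair $(c,s)$. **Theorem.** There is an absolute constant $\gamma>0$ such that the following holds for all $n$, $a$, $v$, $w$, $\kappa$ as above, every floating-point arithmetic with unit roundoff $u$, every $K$ with $\gamma\,n\,(K+1)\,u\le 1$, and every run of the algorithm with $K$ steps (arbitrary shifts, blocks and deflations as described). The matrices $U$ and $Z$ are unitary, and there are matrices $\delta V$, $\delta W$ with (a) $\hat V=U^*(V+\delta V)Z$, where $\|\delta V\|\le \gamma\kappa\,n\,(K+1)\,u\,\|a\|$, (b) $\hat W=U^*(W+\delta W)Z$, where $\|\delta W\|\le \gamma\kappa\,n\,(K+1)\,u\,\|a\|$. In particular, if the number of steps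 is $O(n)$, then $\|\delta V\|$ and $\|\delta W\|$ are at most a constant times $n^2\,u\,\|a\|$. -/

import Mathlib

open scoped Matrix ComplexConjugate Matrix.Norms.L2Operator

noncomputable section

namespace CompanionQZ

/-! ### Floating-point arithmetic -/

/-- Real floating-point arithmetic with unit roundoff `u`, in the standard model (no overflow or
underflow): each basic operation returns the exact result up to a relative error of at most `u`.
Theorems are stated for every such arithmetic; correctly rounded arithmetic is an instance. -/
structure FloatArith (u : ℝ) where
  add : ℝ → ℝ → ℝ
  sub : ℝ → ℝ → ℝ
  mul : ℝ → ℝ → ℝ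
  div : ℝ → ℝ → ℝ
  sqrt : ℝ → ℝ
  add_err : ∀ x y, |add x y - (x + y)| ≤ u * |x + y|
  sub_err : ∀ x y, |sub x y - (x - y)| ≤ u * |x - y|
  mul_err : ∀ x y, |mul x y - x * y| ≤ u * |x * y|
  div_err : ∀ x y, y ≠ 0 → |div x y - x / y| ≤ u * |x / y|
  sqrt_err : ∀ x, 0 ≤ x → |sqrt x - Real.sqrt x| ≤ u * Real.sqrt x

namespace FloatArith

variable {u : ℝ} (fl : FloatArith u)

/-- Complex operations, carried out in real floating-point arithmetic in the usual way.
(Negation and conjugation are exact and need no rounded version.) -/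
def cadd (x y : ℂ) : ℂ := ⟨fl.add x.re y.re, fl.add x.im y.im⟩

def csub (x y : ℂ) : ℂ := ⟨fl.sub x.re y.re, fl.sub x.im y.im⟩

def cmul (x y : ℂ) : ℂ :=
  ⟨fl.sub (fl.mul x.re y.re) (fl.mul x.im y.im), fl.add (fl.mul x.re y.im) (fl.mul x.im y.re)⟩

/-- Complex number divided by a real number. -/
def cdivR (x : ℂ) (r : ℝ) : ℂ := ⟨fl.div x.re r, fl.div x.im r⟩

/-- Computed value of `√(|x|² + |y|²)`. -/
def hypot (x y : ℂ) : ℝ :=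
  fl.sqrt (fl.add (fl.add (fl.mul x.re x.re) (fl.mul x.im x.im))
    (fl.add (fl.mul y.re y.re) (fl.mul y.im y.im)))

/-- Rescaling of a pair `(x, y)` to unit length; the pair `(0, 0)` is replaced by `(1, 0)`. -/
def normalize (x y : ℂ) : ℂ × ℂ :=
  if fl.hypot x y = 0 then (1, 0)
  else (fl.cdivR x (fl.hypot x y), fl.cdivR y (fl.hypot x y))

end FloatArith

/-! ### Core transformations -/

/-- A stored core transformation with active part `[[c, -ε s̄], [s, ε c̄]]`, where `ε = ±1`:
a rotator for `ε = 1`, a reflector for `ε = -1`. It is unitary iff `|c|² + |s|² = 1`;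
in floating-point arithmetic this holds only up to roundoff. -/
structure Core where
  c : ℂ
  s : ℂ
  ε : ℤˣ

namespace Core

/-- The `m × m` identity matrix with the active part of `g` put into rows and columns
`i, i + 1` (counted from `0`). -/
def toMat (m i : ℕ) (g : Core) : Matrix (Fin m) (Fin m) ℂ :=
  Matrix.of fun r k =>
    if r.1 = i ∧ k.1 = i then g.c
    else if r.1 = i ∧ k.1 = i + 1 then -(g.ε : ℂ) * conj g.s
    else if r.1 = i + 1 ∧ k.1 = i then g.s
    else if r.1 = i + 1 ∧ k.1 = i + 1 then (g.ε : ℂ) * conj g.c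
    else if r = k then 1 else 0

/-- The exactly unitary core transformation that a stored core stands for: `(c, s)` rescaled, in
exact arithmetic, to `|c|² + |s|² = 1`. -/
def exactUnit (g : Core) : Core where
  c := g.c / (Real.sqrt (‖g.c‖ ^ 2 + ‖g.s‖ ^ 2) : ℂ)
  s := g.s / (Real.sqrt (‖g.c‖ ^ 2 + ‖g.s‖ ^ 2) : ℂ)
  ε := g.ε

/-- Conjugate transpose of the active part. -/
def adj (g : Core) : Core := ⟨conj g.c, -(g.ε : ℂ) * g.s, g.ε⟩

/-- Transpose of the active part about its antidiagonal. -/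
def flip (g : Core) : Core := ⟨(g.ε : ℂ) * conj g.c, g.s, g.ε⟩

/-- The product `G 0 * G 1 * ⋯ * G (k - 1)` of a descending sequence, as an `m × m` matrix. -/
def prodMat (m k : ℕ) (G : ℕ → Core) : Matrix (Fin m) (Fin m) ℂ :=
  ((List.range k).map fun i => toMat m i (G i)).prod

end Core

section Operations

variable {u : ℝ} (fl : FloatArith u)

/-- Fusion: the computed product `G * M` of two core transformations in the same position,
rescaled to unit length. -/
def fuse (G M : Core) : Core :=
  let p := fl.normalize
    (fl.csub (fl.cmul G.c M.c) ((G.ε : ℂ) * fl.cmul (conj G.s) M.s))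
    (fl.cadd (fl.cmul G.s M.c) ((G.ε : ℂ) * fl.cmul (conj G.c) M.s))
  ⟨p.1, p.2, G.ε * M.ε⟩

/-- Turnover, right to left. Given `G₁, M` in position `1` and `G₂` in position `2`, compute
`(M', H₁, H₂)` with `M', H₂` in position `2` and `H₁` in position `1` such that, up to roundoff,
`G₁ * G₂ * M = M' * H₁ * H₂`. The entries of the `3 × 3` product `T` that are needed are formed
and `T` is refactored by a QR decomposition: `M'` annihilates `T₃₁`, then `H₁` annihilates the
`(2,1)` entry, which leaves `H₂`. The sine of `H₂` is computed as `s₁ s₂ / ŝ₁`.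
Only if `ŝ₁ = 0` this quotient is not available and the `(3,2)` entry is used.
Every new core is rescaled to unit length. -/
def turnover (G₁ G₂ M : Core) : Core × Core × Core :=
  let p := fl.cmul G₂.c M.s
  let q := (M.ε : ℂ) * fl.cmul G₂.c (conj M.c)
  let T₁₁ := fl.csub (fl.cmul G₁.c M.c) ((G₁.ε : ℂ) * fl.cmul (conj G₁.s) p)
  let T₂₁ := fl.cadd (fl.cmul G₁.s M.c) ((G₁.ε : ℂ) * fl.cmul (conj G₁.c) p)
  let T₃₁ := fl.cmul G₂.s M.s
  let T₁₂ := -fl.cadd ((M.ε : ℂ) * fl.cmul G₁.c (conj M.s)) ((G₁.ε : ℂ) * fl.cmul (conj G₁.s) q)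
  let T₂₂ := fl.csub ((G₁.ε : ℂ) * fl.cmul (conj G₁.c) q) ((M.ε : ℂ) * fl.cmul G₁.s (conj M.s))
  let T₃₂ := (M.ε : ℂ) * fl.cmul G₂.s (conj M.c)
  let m := fl.normalize T₂₁ T₃₁
  let r := fl.hypot T₂₁ T₃₁
  let h := fl.normalize T₁₁ (r : ℂ)
  let s₁ : ℝ := h.2.re
  let N₂₂ := fl.cadd (fl.cmul (conj m.1) T₂₂) (fl.cmul (conj m.2) T₃₂)
  let c₂ := (G₁.ε : ℂ) * fl.csub (fl.cmul h.1 N₂₂) (fl.cmul (s₁ : ℂ) T₁₂)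
  let s₂ := if r = 0 then (M.ε : ℂ) * T₃₂ else fl.cdivR (fl.cmul G₁.s G₂.s) s₁
  let k := fl.normalize c₂ s₂
  (⟨m.1, m.2, M.ε⟩, ⟨h.1, (s₁ : ℂ), G₁.ε⟩, ⟨k.1, k.2, G₂.ε⟩)

/-- Turnover, left to right. Given `M, G₂` in position `2` and `G₁` in position `1`, compute
`(H₁, H₂, M')` with `H₁, M'` in position `1` and `H₂` in position `2` such that, up to roundoff,
`M * G₁ * G₂ = H₁ * H₂ * M'`. This is the previous turnover seen through the antidiagonal
transpose, which reverses products and exchanges the two positions. -/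
def turnoverLR (M G₁ G₂ : Core) : Core × Core × Core :=
  let t := turnover fl G₂.flip G₁.flip M.flip
  (t.2.2.flip, t.2.1.flip, t.1.flip)

/-! ### Factored form of an upper triangular unitary-plus-rank-one matrix -/

/-- Computed norms of the trailing parts of the vector `z = (t 0, …, t (n-1), -1)`:
`tailNorm k` is the last entry of `z` for `k = 0`, and the computed norm of its last `k + 1`
entries for `k > 0`. -/
def tailNorm (n : ℕ) (t : ℕ → ℂ) : ℕ → ℂ
  | 0 => -1
  | k + 1 => (fl.hypot (t (n - 1 - k)) (tailNorm n t k) : ℂ)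

/-- The computed core transformations `C 0, …, C (n-1)` with `C 0 ⋯ C (n-1) z = α e₁`,
for `z = (t 0, …, t (n-1), -1)`. -/
def initC (n : ℕ) (t : ℕ → ℂ) (i : ℕ) : Core :=
  let p := fl.normalize (t i) (tailNorm fl n t (n - 1 - i))
  ⟨conj p.1, -p.2, 1⟩

/-- `B i = C i` for `i < n - 1`, and `B (n-1) = C (n-1) * Y`, where `Y` exchanges the last two
coordinates. -/
def initB (n : ℕ) (t : ℕ → ℂ) (i : ℕ) : Core :=
  let g := initC fl n t i
  if i + 1 = n then ⟨-conj g.s, conj g.c, -1⟩ else g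

end Operations

/-- The `n × n` matrix `Pᵀ C* (B + α e₁ yᵀ) P` represented by the core sequences `C` and `B`, where
`α yᵀ = -(eₙ₊₁ᵀ C* e₁)⁻¹ eₙ₊₁ᵀ C* B` is recovered from the cores and `P` is the
`(n+1) × (n+1)` identity matrix without its last column. -/
def triMat (n : ℕ) (C B : ℕ → Core) : Matrix (Fin n) (Fin n) ℂ :=
  let Cs := (Core.prodMat (n + 1) n C)ᴴ
  let Bm := Core.prodMat (n + 1) n B
  let αy : Fin (n + 1) → ℂ := fun j => -(Cs (Fin.last n) 0)⁻¹ * (Cs * Bm) (Fin.last n) j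
  (Cs * (Bm + Matrix.vecMulVec (Pi.single 0 1) αy)).submatrix Fin.castSucc Fin.castSucc

/-! ### The companion pencil -/

/-- The matrix `V`: ones on the subdiagonal and last column `-v`. -/
def pencilV {n : ℕ} (v : EuclideanSpace ℂ (Fin n)) : Matrix (Fin n) (Fin n) ℂ :=
  Matrix.of fun i j => if j.1 + 1 = n then -v i else if i.1 = j.1 + 1 then 1 else 0

/-- The matrix `W`: the identity matrix with its last column replaced by `w`. -/
def pencilW {n : ℕ} (w : EuclideanSpace ℂ (Fin n)) : Matrix (Fin n) (Fin n) ℂ :=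
  Matrix.of fun i j => if j.1 + 1 = n then w i else if i = j then 1 else 0

/-- `v` and `w` split the coefficient vector `a = (a₀, …, aₙ)` of a polynomial:
`v₁ = a₀`, `vᵢ₊₁ + wᵢ = aᵢ` for `1 ≤ i ≤ n - 1`, `wₙ = aₙ`. (Here `v`, `w` are indexed from `0`.) -/
def IsSplitting {n : ℕ} [NeZero n] (a : EuclideanSpace ℂ (Fin (n + 1)))
    (v w : EuclideanSpace ℂ (Fin n)) : Prop :=
  v 0 = a 0 ∧
  (∀ i j : Fin n, j.1 = i.1 + 1 → v j + w i = a j.castSucc) ∧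
  ∀ i : Fin n, i.1 + 1 = n → w i = a (Fin.last n)

/-! ### The companion QZ algorithm -/

/-- The data on which the algorithm works: the five core sequences, with
`V = Q 0 ⋯ Q (n-2) * triMat CV BV` and `W = triMat CW BW`, together with the exact accumulated
product `U` of the core transformations applied (as adjoints) on the left of the pencil and the
exact accumulated product `Z` of those applied on the right. `U` and `Z` only record the
transformations; no computed quantity depends on them. -/
structure QZState (n : ℕ) where
  Q : ℕ → Core
  CV : ℕ → Core
  BV : ℕ → Core
  CW : ℕ → Core
  BW : ℕ → Core
  U : Matrix (Fin n) (Fin n) ℂ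
  Z : Matrix (Fin n) (Fin n) ℂ

namespace QZState

variable {n : ℕ}

/-- The current matrix `V̂` represented by the stored cores. -/
def matV (S : QZState n) : Matrix (Fin n) (Fin n) ℂ :=
  Core.prodMat n (n - 1) S.Q * triMat n S.CV S.BV

/-- The current matrix `Ŵ` represented by the stored cores. -/
def matW (S : QZState n) : Matrix (Fin n) (Fin n) ℂ := triMat n S.CW S.BW

end QZState

section Algorithm

variable {u : ℝ} (fl : FloatArith u) {n : ℕ}

/-- The initial factorization: `V = QR`, where `Q` is a product of `n - 1` exchanges of
neighbouring coordinates and `R` has last column `(-v₂, …, -vₙ, -v₁)`; `R` and `W` are stored in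
factored form. -/
def initState [NeZero n] (v w : EuclideanSpace ℂ (Fin n)) : QZState n where
  Q := fun _ => ⟨0, 1, -1⟩
  CV := initC fl n fun i => -v (Fin.ofNat n (i + 1))
  BV := initB fl n fun i => -v (Fin.ofNat n (i + 1))
  CW := initC fl n fun i => w (Fin.ofNat n i)
  BW := initB fl n fun i => w (Fin.ofNat n i)
  U := 1
  Z := 1

/-- One similarity step with the core transformation `g = Uᵢ` in position `i`.
`Uᵢ*` is passed through `W` from left to right by two turnovers, `Uᵢ* W = Ŵ Zᵢ*`, and `Zᵢ` is then
passed through `R` from right to left by two turnovers, `R Zᵢ = Xᵢ R̂`.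
Returns the new state and `Xᵢ`. -/
def passThrough (i : ℕ) (g : Core) (S : QZState n) : QZState n × Core :=
  let tCW := turnover fl (S.CW i) (S.CW (i + 1)) g
  let tBW := turnoverLR fl tCW.1.adj (S.BW i) (S.BW (i + 1))
  let z := tBW.2.2.adj
  let tBV := turnover fl (S.BV i) (S.BV (i + 1)) z
  let tCV := turnoverLR fl tBV.1.adj (S.CV i) (S.CV (i + 1))
  ({ Q := S.Q
     CW := Function.update (Function.update S.CW i tCW.2.1) (i + 1) tCW.2.2
     BW := Function.update (Function.update S.BW i tBW.1) (i + 1) tBW.2.1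
     BV := Function.update (Function.update S.BV i tBV.2.1) (i + 1) tBV.2.2
     CV := Function.update (Function.update S.CV i tCV.1) (i + 1) tCV.2.1
     U := S.U * Core.toMat n i g.exactUnit
     Z := S.Z * Core.toMat n i z.exactUnit },
   tCV.2.2.adj)

/-- Chasing the misfit. `chaseLoop p k i g S` performs the similarity with `g` in position `i`
and gets a misfit `X` in position `i`. While further positions remain (`k > 0`) the turnover
`Qᵢ Qᵢ₊₁ X = g' Q̂ᵢ Q̂ᵢ₊₁` gives the next similarity transformation `g'`, in position `i + 1`. In the
last position (`k = 0`) the misfit is fused with `Qᵢ`. There `p` is the unimodular entry of the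
deflated (diagonal) core `Qᵢ₊₁` through which the misfit has to pass first, which multiplies
its sine by `p`; `p = 1` if there is no such core. -/
def chaseLoop (p : ℂ) : ℕ → ℕ → Core → QZState n → QZState n
  | 0, i, g, S =>
    let r := passThrough fl i g S
    { r.1 with
      Q := Function.update r.1.Q i (fuse fl (r.1.Q i) ⟨r.2.c, fl.cmul r.2.s p, r.2.ε⟩) }
  | k + 1, i, g, S =>
    let r := passThrough fl i g S
    let t := turnover fl (r.1.Q i) (r.1.Q (i + 1)) r.2
    chaseLoop p k (i + 1) t.1
      { r.1 with Q := Function.update (Function.update r.1.Q i t.2.1) (i + 1) t.2.2 }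

/-- One single-shift QZ iteration with shift `μ` on the diagonal block with rows `l, …, m`.
Since `rⱼⱼ = s_j(B) / s_j(C)` in the factored form, the two nonzero entries of the first column of
`V - μ W` (within the block) are, up to a common factor, `d c r - μ ω` and `s r` with `c, s` from
`Q l`; `d` is the unimodular diagonal entry of the deflated core `Q (l-1)`, `d = 1` if `l = 0`.
The rotator `g` with first column proportional to this vector starts the iteration: `g*` is fused
with `Q l` (after passing the deflated core `Q (l-1)`, which multiplies its sine by the phase
`d`), and the misfit is chased to the bottom of the block. -/
def qzIteration (l m : ℕ) (μ : ℂ) (S : QZState n) : QZState n :=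
  let d : ℂ := if l = 0 then 1 else ((S.Q (l - 1)).ε : ℂ) * conj (S.Q (l - 1)).c
  let p : ℂ := if m + 1 = n then 1 else (S.Q m).c
  let q₁ := fl.csub
    (fl.cmul (fl.cmul (fl.cmul d (S.Q l).c) (S.BV l).s) (S.CW l).s)
    (fl.cmul (fl.cmul μ (S.BW l).s) (S.CV l).s)
  let q₂ := fl.cmul (fl.cmul (S.Q l).s (S.BV l).s) (S.CW l).s
  let x := fl.normalize q₁ q₂
  let g : Core := ⟨x.1, x.2, 1⟩
  let g' : Core := ⟨g.c, fl.cmul g.s d, 1⟩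
  chaseLoop fl p (m - l - 1) l g
    { S with Q := Function.update S.Q l (fuse fl g'.adj (S.Q l)) }

/-- Deflation at position `i`: the negligible sine of `Q i` is set to zero. -/
def deflate (i : ℕ) (S : QZState n) : QZState n :=
  let g : Core := ⟨(fl.normalize (S.Q i).c 0).1, 0, (S.Q i).ε⟩
  { S with Q := Function.update S.Q i g }

/-- `QZRun fl v w K S`: the companion QZ algorithm, executed in the floating-point arithmetic `fl`
on the pencil given by `v` and `w`, can be in the state `S` after `K` steps. A step is either a QZ
iteration with an arbitrary shift on a diagonal block `l, …, m` that is decoupled from the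
rest of the matrix, or a deflation of a core of `Q` whose sine is at most `u`
in modulus. -/
inductive QZRun [NeZero n] (v w : EuclideanSpace ℂ (Fin n)) : ℕ → QZState n → Prop
  | start : QZRun v w 0 (initState fl v w)
  | iterate {K : ℕ} {S : QZState n} (l m : ℕ) (μ : ℂ) :
      QZRun v w K S → l < m → m < n →
      (l = 0 ∨ (S.Q (l - 1)).s = 0) → (m + 1 = n ∨ (S.Q m).s = 0) →
      QZRun v w (K + 1) (qzIteration fl l m μ S)
  | deflation {K : ℕ} {S : QZState n} (i : ℕ) :
      QZRun v w K S → i + 1 < n → ‖(S.Q i).s‖ ≤ u →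
      QZRun v w (K + 1) (deflate fl i S)

end Algorithm

end CompanionQZ

end

/-!
The computed matrices are exact unitary transformations of slightly perturbed initial ones because
every single operation is backward stable on the cores, and because the one quantity that is not
stored, the rank-one part of the triangular factors, is recovered from the cores with high
*relative* accuracy.

*Turnovers and fusions.* Every stored core is unitary up to roundoff. A computed turnover or fusion
is close to an exact one between nearby unitary cores (`turnover_stable`, `turnoverLR_stable`,
`fuse_stable`). Cancellation in the entry `T₂₁` of the `3 × 3` product is harmless: the computed
entry is relatively accurate for a product in which the first core is slightly perturbed, entry by
entry (`exists_perturbation`). In addition, the product of the two sines of the descending sequence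
is preserved with a small relative error, because the last sine is computed as the quotient
`s₁ s₂ / ŝ₁`.

*The invariant.* Passing `Uᵢ` through the sequences `C` and `B` of a triangular factor multiplies
`C = C 0 ⋯ C (n-1)` and `B = B 0 ⋯ B (n-1)` from the right by the transformations that the factor
undergoes, and from the left by the same unitary matrix, which fixes `e₁` since all cores involved
act in positions greater than one. So `C ≈ Xᴴ C₀ (L ⊕ 1)` and `B ≈ Xᴴ B₀ (R ⊕ 1)` with an error that
grows by a multiple of `u` in each operation (`PairTracks`), and the product of the sines of `C`
accumulates only relative errors (`SineTracks`). Together with the analogous statement for `Q` this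
is `Invariant`; a run of `K` steps consists of at most `2 n K` operations (`invariant_of_run`).

*The rank-one part.* The number `eₙ₊₁ᵀ C* e₁` is up to sign the product of the sines of `C`. It can
be tiny, but by the invariant it agrees relatively with its initial value, for which the product of
the quotients of consecutive tail norms of `z = (t, -1)` telescopes to `± 1 / ‖z‖`
(`inv_corner_relErr`). Hence the factor `-(eₙ₊₁ᵀ C* e₁)⁻¹` is at most a multiple of `‖z‖` and has an
error of the order of `u ‖z‖`, and in `C* (B + α e₁ yᵀ)` the matrix `X` cancels because it fixes
`e₁`. Since the initial `C₀` maps `z` to a multiple of `e₁`, the represented matrix is close to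
`Lᴴ T R`, where `T` is the initial triangular matrix (`triMat_backward_error`). Multiplication with `Q`
gives the bound for `V`.
-/

namespace CompanionQZ

/-! ### Relative errors -/

/-- `x` approximates `y` with relative error at most `η`. -/
def RelErr {F : Type*} [NormedField F] (η : ℝ) (x y : F) : Prop := ‖x - y‖ ≤ η * ‖y‖

namespace RelErr

variable {F : Type*} [NormedField F] {u k l : ℝ} {x y z x' y' : F}

lemma refl (hk : 0 ≤ k) (x : F) : RelErr k x x := by
  simp only [RelErr, sub_self, norm_zero]; positivity

lemma mono {η η' : ℝ} (h : RelErr η x y) (hη : η ≤ η') : RelErr η' x y :=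
  le_trans h (mul_le_mul_of_nonneg_right hη (norm_nonneg _))

lemma norm_le {η : ℝ} (h : RelErr η x y) : ‖x‖ ≤ (1 + η) * ‖y‖ := by
  have h1 : ‖x‖ ≤ ‖x - y‖ + ‖y‖ := by simpa using norm_add_le (x - y) y
  have h2 : ‖x - y‖ ≤ η * ‖y‖ := h
  linarith

lemma le_norm {η : ℝ} (h : RelErr η x y) : (1 - η) * ‖y‖ ≤ ‖x‖ := by
  have h1 : ‖y‖ ≤ ‖x - y‖ + ‖x‖ := by
    have := norm_sub_le x (x - y)
    simp only [sub_sub_cancel] at this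
    linarith
  have h2 : ‖x - y‖ ≤ η * ‖y‖ := h
  linarith

lemma eq_zero_iff {η : ℝ} (h : RelErr η x y) (hη : η < 1) : x = 0 ↔ y = 0 := by
  constructor
  · rintro rfl
    have := h.le_norm
    rw [norm_zero] at this
    have h3 := norm_nonneg y
    have : ‖y‖ = 0 := by nlinarith
    simpa using this
  · rintro rfl
    have := h.norm_le
    rw [norm_zero, mul_zero] at this
    simpa using le_antisymm this (norm_nonneg _)

lemma mul (hx : RelErr (k * u) x y) (hy : RelErr (l * u) x' y') (hk : 0 ≤ k) (hu : 0 ≤ u)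
    (hs : k * l * u ≤ 1) : RelErr ((k + l + 1) * u) (x * x') (y * y') := by
  have h1 : ‖x - y‖ ≤ k * u * ‖y‖ := hx
  have h2 : ‖x' - y'‖ ≤ l * u * ‖y'‖ := hy
  have e : x * x' - y * y' = (x - y) * (x' - y') + (x - y) * y' + y * (x' - y') := by ring
  have h3 : ‖x * x' - y * y'‖ ≤ ‖x - y‖ * ‖x' - y'‖ + ‖x - y‖ * ‖y'‖ + ‖y‖ * ‖x' - y'‖ := by
    rw [e]
    refine (norm_add_le _ _).trans (add_le_add ((norm_add_le _ _).trans ?_) ?_) <;> simp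
  have h4 : ‖x - y‖ * ‖x' - y'‖ ≤ (k * u * ‖y‖) * (l * u * ‖y'‖) :=
    mul_le_mul h1 h2 (norm_nonneg _) (by positivity)
  have h5 : ‖x - y‖ * ‖y'‖ ≤ (k * u * ‖y‖) * ‖y'‖ :=
    mul_le_mul_of_nonneg_right h1 (norm_nonneg _)
  have h6 : ‖y‖ * ‖x' - y'‖ ≤ ‖y‖ * (l * u * ‖y'‖) :=
    mul_le_mul_of_nonneg_left h2 (norm_nonneg _)
  have h7 : (k * l * u) * (u * (‖y‖ * ‖y'‖)) ≤ 1 * (u * (‖y‖ * ‖y'‖)) :=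
    mul_le_mul_of_nonneg_right hs (by positivity)
  unfold RelErr
  rw [norm_mul y y']
  nlinarith

lemma trans (hx : RelErr (k * u) x y) (hy : RelErr (l * u) y z) (hk : 0 ≤ k) (hu : 0 ≤ u)
    (hs : k * l * u ≤ 1) : RelErr ((k + l + 1) * u) x z := by
  have h1 : ‖x - y‖ ≤ k * u * ‖y‖ := hx
  have h2 : ‖y - z‖ ≤ l * u * ‖z‖ := hy
  have h3 := hy.norm_le
  have h4 : ‖x - z‖ ≤ ‖x - y‖ + ‖y - z‖ := norm_sub_le_norm_sub_add_norm_sub x y z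
  have h5 : k * u * ‖y‖ ≤ k * u * ((1 + l * u) * ‖z‖) :=
    mul_le_mul_of_nonneg_left h3 (by positivity)
  have h7 : (k * l * u) * (u * ‖z‖) ≤ 1 * (u * ‖z‖) :=
    mul_le_mul_of_nonneg_right hs (by positivity)
  unfold RelErr
  nlinarith

lemma symm (hx : RelErr (k * u) x y) (hk : 0 ≤ k) (hu : 0 ≤ u)
    (hs : 2 * k * k * u ≤ 1) (hs' : 2 * k * u ≤ 1) : RelErr ((k + 1) * u) y x := by
  have h1 : ‖x - y‖ ≤ k * u * ‖y‖ := hx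
  have h2 := hx.le_norm
  have hy : ‖y‖ ≤ 2 * ‖x‖ := by nlinarith [norm_nonneg y]
  have hy' : ‖y‖ ≤ ‖x‖ + k * u * (2 * ‖x‖) := by
    have := mul_le_mul_of_nonneg_left hy (show 0 ≤ k * u by positivity)
    nlinarith
  have h7 : (2 * k * k * u) * (u * ‖x‖) ≤ 1 * (u * ‖x‖) :=
    mul_le_mul_of_nonneg_right hs (by positivity)
  have := mul_le_mul_of_nonneg_left hy' (show 0 ≤ k * u by positivity)
  unfold RelErr
  rw [norm_sub_rev]
  nlinarith

lemma inv (hx : RelErr (k * u) x y) (hk : 0 ≤ k) (hu : 0 ≤ u)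
    (hs : 2 * k * k * u ≤ 1) (hs' : 2 * k * u ≤ 1) : RelErr ((k + 1) * u) x⁻¹ y⁻¹ := by
  have h := hx.symm hk hu hs hs'
  by_cases hx0 : x = 0
  · have : y = 0 := (hx.eq_zero_iff (by linarith)).1 hx0
    subst hx0 this
    exact refl (by positivity) _
  have hy0 : y ≠ 0 := fun hy => hx0 ((hx.eq_zero_iff (by linarith)).2 hy)
  have e : x⁻¹ - y⁻¹ = (y - x) * (x⁻¹ * y⁻¹) := by field_simp
  unfold RelErr at h ⊢
  rw [e, norm_mul, norm_mul, norm_inv, norm_inv]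
  have : ‖x‖ ≠ 0 := by simpa using hx0
  calc ‖y - x‖ * (‖x‖⁻¹ * ‖y‖⁻¹) ≤ ((k + 1) * u * ‖x‖) * (‖x‖⁻¹ * ‖y‖⁻¹) :=
        mul_le_mul_of_nonneg_right h (by positivity)
    _ = (k + 1) * u * ‖y‖⁻¹ := by field_simp

lemma div (hx : RelErr (k * u) x y) (hy : RelErr (l * u) x' y') (hk : 0 ≤ k) (hl : 0 ≤ l)
    (hu : 0 ≤ u) (hs : 2 * l * l * u ≤ 1) (hs' : 2 * l * u ≤ 1) (hs3 : k * (l + 1) * u ≤ 1) :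
    RelErr ((k + l + 2) * u) (x / x') (y / y') := by
  rw [div_eq_mul_inv, div_eq_mul_inv]
  exact (hx.mul (hy.inv hl hu hs hs') hk hu hs3).mono
    (mul_le_mul_of_nonneg_right (by linarith) hu)

lemma star {η : ℝ} {x y : ℂ} (h : RelErr η x y) : RelErr η (conj x) (conj y) := by
  unfold RelErr at *
  rwa [← map_sub, RCLike.norm_conj, RCLike.norm_conj]

lemma ofReal {η : ℝ} {x y : ℝ} (h : RelErr η x y) : RelErr η (x : ℂ) (y : ℂ) := by
  unfold RelErr at *
  rwa [← Complex.ofReal_sub, Complex.norm_real, Complex.norm_real]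

lemma const_mul {η : ℝ} (h : RelErr η x y) (c : F) : RelErr η (c * x) (c * y) := by
  unfold RelErr at *
  rw [← mul_sub, norm_mul, norm_mul]
  nlinarith [norm_nonneg c]

lemma abs_le (h : RelErr (k * u) x y) (hk : 0 ≤ k) (hu : 0 ≤ u) (hy : ‖y‖ ≤ 1) :
    ‖x - y‖ ≤ k * u :=
  le_trans h (mul_le_of_le_one_right (by positivity) hy)

end RelErr

/-- Real numbers `a, b ≥ 0` that are computed to a certain relative accuracy can be added without
loss of relative accuracy. -/
lemma RelErr.add_nonneg {η x x' y y' : ℝ} (hx : RelErr η x y) (hx' : RelErr η x' y') (hy : 0 ≤ y)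
    (hy' : 0 ≤ y') : RelErr η (x + x') (y + y') := by
  unfold RelErr at *
  simp only [Real.norm_eq_abs] at *
  rw [abs_of_nonneg hy] at hx
  rw [abs_of_nonneg hy'] at hx'
  rw [abs_of_nonneg (by positivity : 0 ≤ y + y')]
  have : x + x' - (y + y') = (x - y) + (x' - y') := by ring
  rw [this]
  exact (abs_add_le _ _).trans (by linarith)

lemma RelErr.sqrt {η x y : ℝ} (h : RelErr η x y) (hx : 0 ≤ x) (hy : 0 ≤ y) :
    RelErr η (√x) (√y) := by
  unfold RelErr at *
  simp only [Real.norm_eq_abs] at *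
  rw [abs_of_nonneg hy] at h
  rw [abs_of_nonneg (Real.sqrt_nonneg y)]
  rcases hy.eq_or_lt with rfl | hy
  · have : x = 0 := by simpa using h
    simp [this]
  have hs : 0 < √y := Real.sqrt_pos.2 hy
  have e : |√x - √y| * (√x + √y) = |x - y| := by
    rw [← abs_of_nonneg (by positivity : 0 ≤ √x + √y), ← abs_mul]
    congr 1
    nlinarith [Real.sq_sqrt hx, Real.sq_sqrt hy.le]
  have h1 : |√x - √y| * √y ≤ |x - y| := by
    rw [← e]
    exact mul_le_mul_of_nonneg_left (by linarith [Real.sqrt_nonneg x]) (abs_nonneg _)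
  have h2 : |√x - √y| * √y ≤ (η * √y) * √y := by
    rw [mul_assoc, Real.mul_self_sqrt hy.le]; linarith
  exact le_of_mul_le_mul_right h2 hs

/-- A vector of length two with relatively accurate entries has a relatively accurate norm. -/
lemma RelErr.hypot {η : ℝ} {x x' y y' : ℂ} (hη : 0 ≤ η) (hx : RelErr η x y)
    (hx' : RelErr η x' y') : RelErr η (√(‖x‖ ^ 2 + ‖x'‖ ^ 2)) (√(‖y‖ ^ 2 + ‖y'‖ ^ 2)) := by
  have key (p q : ℂ) : √(‖p‖ ^ 2 + ‖q‖ ^ 2) = ‖(!₂[p, q] : EuclideanSpace ℂ (Fin 2))‖ := by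
    simp [EuclideanSpace.norm_eq, Fin.sum_univ_two]
  have e : (!₂[x, x'] : EuclideanSpace ℂ (Fin 2)) - !₂[y, y'] = !₂[x - y, x' - y'] := by
    ext i; fin_cases i <;> simp
  unfold RelErr at *
  rw [key, key, norm_norm, Real.norm_eq_abs]
  refine (abs_norm_sub_norm_le _ _).trans ?_
  rw [e, ← key, ← key]
  refine Real.sqrt_le_iff.2 ⟨by positivity, ?_⟩
  rw [mul_pow, Real.sq_sqrt (by positivity)]
  nlinarith [norm_nonneg (x - y), norm_nonneg (x' - y'),
    pow_le_pow_left₀ (norm_nonneg _) hx 2, pow_le_pow_left₀ (norm_nonneg _) hx' 2]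

/-! ### Absolute errors -/

section AbsErr

variable {u k l A B : ℝ} {x y x' y' : ℂ}

lemma abs_mul_err (hx : ‖x - y‖ ≤ k * u) (hx' : ‖x' - y'‖ ≤ l * u) (hy : ‖y‖ ≤ A) (hy' : ‖y'‖ ≤ B)
    (hk : 0 ≤ k) (hu : 0 ≤ u) (hs : k * l * u ≤ 1) :
    ‖x * x' - y * y'‖ ≤ (B * k + A * l + 1) * u := by
  have e : x * x' - y * y' = (x - y) * (x' - y') + (x - y) * y' + y * (x' - y') := by ring
  have h3 : ‖x * x' - y * y'‖ ≤ ‖x - y‖ * ‖x' - y'‖ + ‖x - y‖ * ‖y'‖ + ‖y‖ * ‖x' - y'‖ := by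
    rw [e]
    refine (norm_add_le _ _).trans (add_le_add ((norm_add_le _ _).trans ?_) ?_) <;> simp
  have h4 : ‖x - y‖ * ‖x' - y'‖ ≤ (k * u) * (l * u) :=
    mul_le_mul hx hx' (norm_nonneg _) (by positivity)
  have h5 : ‖x - y‖ * ‖y'‖ ≤ (k * u) * B := mul_le_mul hx hy' (norm_nonneg _) (by positivity)
  have h6 : ‖y‖ * ‖x' - y'‖ ≤ A * (l * u) :=
    mul_le_mul hy hx' (norm_nonneg _) ((norm_nonneg _).trans hy)
  nlinarith [mul_le_mul_of_nonneg_right hs hu]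

lemma abs_add_err (hx : ‖x - y‖ ≤ k * u) (hx' : ‖x' - y'‖ ≤ l * u) :
    ‖x + x' - (y + y')‖ ≤ (k + l) * u := by
  rw [add_sub_add_comm]
  exact (norm_add_le _ _).trans (by linarith)

lemma abs_sub_err (hx : ‖x - y‖ ≤ k * u) (hx' : ‖x' - y'‖ ≤ l * u) :
    ‖x - x' - (y - y')‖ ≤ (k + l) * u := by
  rw [sub_sub_sub_comm]
  exact (norm_sub_le _ _).trans (by linarith)

lemma abs_conj_err (hx : ‖x - y‖ ≤ A) : ‖conj x - conj y‖ ≤ A := by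
  rwa [← map_sub, RCLike.norm_conj]

lemma abs_sign_err (e : ℤˣ) (hx : ‖x - y‖ ≤ A) : ‖(e : ℂ) * x - e * y‖ ≤ A := by
  rw [← mul_sub, norm_mul]
  rcases Int.units_eq_one_or e with rfl | rfl <;> simpa using hx

end AbsErr

/-! ### Complex floating-point operations -/

namespace FloatArith

variable {u : ℝ} (fl : FloatArith u)

lemma u_nonneg {u : ℝ} (fl : FloatArith u) : 0 ≤ u := by
  have := (abs_nonneg _).trans (fl.add_err 1 0)
  simpa using this

lemma norm_mk_le {a b A B : ℝ} (ha : |a| ≤ A) (hb : |b| ≤ B) : ‖(⟨a, b⟩ : ℂ)‖ ≤ √(A ^ 2 + B ^ 2) := by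
  rw [Complex.norm_eq_sqrt_sq_add_sq]
  apply Real.sqrt_le_sqrt
  have := pow_le_pow_left₀ (abs_nonneg _) ha 2
  have := pow_le_pow_left₀ (abs_nonneg _) hb 2
  simp only [sq_abs] at *
  linarith

lemma relErr_of_components {η : ℝ} (hη : 0 ≤ η) {x y : ℂ} (h1 : |x.re - y.re| ≤ η * |y.re|)
    (h2 : |x.im - y.im| ≤ η * |y.im|) : RelErr η x y := by
  unfold RelErr
  have := norm_mk_le h1 h2
  have e : (⟨x.re - y.re, x.im - y.im⟩ : ℂ) = x - y := rfl
  rw [e] at this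
  refine this.trans (Real.sqrt_le_iff.2 ⟨by positivity, ?_⟩)
  rw [mul_pow, mul_pow, mul_pow, Complex.norm_eq_sqrt_sq_add_sq, Real.sq_sqrt (by positivity)]
  simp only [sq_abs]
  linarith

lemma cadd_relErr (x y : ℂ) : RelErr u (fl.cadd x y) (x + y) :=
  relErr_of_components fl.u_nonneg (fl.add_err _ _) (fl.add_err _ _)

lemma csub_relErr (x y : ℂ) : RelErr u (fl.csub x y) (x - y) :=
  relErr_of_components fl.u_nonneg (fl.sub_err _ _) (fl.sub_err _ _)

lemma cdivR_relErr (x : ℂ) {r : ℝ} (hr : r ≠ 0) : RelErr u (fl.cdivR x r) (x / r) := by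
  apply relErr_of_components fl.u_nonneg
  · simpa [cdivR, Complex.div_ofReal_re] using fl.div_err x.re r hr
  · simpa [cdivR, Complex.div_ofReal_im] using fl.div_err x.im r hr

lemma cmul_relErr (hu1 : u ≤ 1 / 2) (x y : ℂ) : RelErr (5 * u) (fl.cmul x y) (x * y) := by
  have hu := fl.u_nonneg
  have key : ∀ p q P Q s : ℝ, |p - P| ≤ u * |P| → |q - Q| ≤ u * |Q| →
      |s - (p + q)| ≤ u * |p + q| → |s - (P + Q)| ≤ (5 / 2 * u) * (|P| + |Q|) := by
    intro p q P Q s h1 h2 h3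
    have h4 : |p + q - (P + Q)| ≤ u * (|P| + |Q|) := by
      have : p + q - (P + Q) = (p - P) + (q - Q) := by ring
      rw [this]
      exact (abs_add_le _ _).trans (by linarith)
    have h5 : |p + q| ≤ (1 + u) * (|P| + |Q|) := by
      have := abs_add_le (p + q - (P + Q)) (P + Q)
      have h6 := abs_add_le P Q
      simp only [sub_add_cancel] at this
      linarith
    have h6 : |s - (P + Q)| ≤ |s - (p + q)| + |p + q - (P + Q)| := abs_sub_le _ _ _
    have h7 : u * |p + q| ≤ u * ((1 + u) * (|P| + |Q|)) := mul_le_mul_of_nonneg_left h5 hu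
    have h8 : u * (u * (|P| + |Q|)) ≤ u * (1 / 2 * (|P| + |Q|)) :=
      mul_le_mul_of_nonneg_left (mul_le_mul_of_nonneg_right hu1 (by positivity)) hu
    nlinarith
  have hre : |(fl.cmul x y).re - (x * y).re| ≤ (5 / 2 * u) * (|x.re * y.re| + |x.im * y.im|) := by
    have := key (fl.mul x.re y.re) (-fl.mul x.im y.im) (x.re * y.re) (-(x.im * y.im))
      (fl.cmul x y).re (fl.mul_err _ _) (by
        rw [abs_neg, neg_sub_neg, abs_sub_comm]; exact fl.mul_err _ _)
      (by rw [← sub_eq_add_neg]; exact fl.sub_err _ _)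
    simpa only [abs_neg, ← sub_eq_add_neg, Complex.mul_re] using this
  have him : |(fl.cmul x y).im - (x * y).im| ≤ (5 / 2 * u) * (|x.re * y.im| + |x.im * y.re|) := by
    have := key (fl.mul x.re y.im) (fl.mul x.im y.re) (x.re * y.im) (x.im * y.re)
      (fl.cmul x y).im (fl.mul_err _ _) (fl.mul_err _ _) (fl.add_err _ _)
    simpa only [Complex.mul_im] using this
  have h := norm_mk_le hre him
  have e : (⟨(fl.cmul x y).re - (x * y).re, (fl.cmul x y).im - (x * y).im⟩ : ℂ)
    = fl.cmul x y - x * y := rfl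
  rw [e] at h
  refine h.trans (Real.sqrt_le_iff.2 ⟨by positivity, ?_⟩)
  simp only [mul_pow, norm_mul, Complex.norm_eq_sqrt_sq_add_sq, abs_mul]
  rw [Real.sq_sqrt (by positivity), Real.sq_sqrt (by positivity)]
  rw [← sq_abs x.re, ← sq_abs x.im, ← sq_abs y.re, ← sq_abs y.im]
  generalize |x.re| = a
  generalize |x.im| = b
  generalize |y.re| = c
  generalize |y.im| = d
  have h4 : (a * c + b * d) ^ 2 + (a * d + b * c) ^ 2 ≤ 4 * ((a ^ 2 + b ^ 2) * (c ^ 2 + d ^ 2)) := by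
    nlinarith [sq_nonneg (a * c - b * d), sq_nonneg (a * d - b * c), sq_nonneg (a * c),
      sq_nonneg (b * d), sq_nonneg (a * d), sq_nonneg (b * c)]
  nlinarith [mul_le_mul_of_nonneg_left h4 (sq_nonneg u)]

lemma hypot_relErr (hu1 : u ≤ 1 / 100) (x y : ℂ) :
    RelErr (7 * u) (fl.hypot x y) (√(‖x‖ ^ 2 + ‖y‖ ^ 2)) := by
  have hu := fl.u_nonneg
  have hm : ∀ a : ℝ, RelErr (1 * u) (fl.mul a a) (a ^ 2) := fun a => by
    have := fl.mul_err a a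
    rw [one_mul, sq]; exact this
  have ha : ∀ a b : ℝ, RelErr (1 * u) (fl.add a b) (a + b) := fun a b => by
    rw [one_mul]; exact fl.add_err a b
  have h1 : ∀ z : ℂ, RelErr (3 * u) (fl.add (fl.mul z.re z.re) (fl.mul z.im z.im)) (‖z‖ ^ 2) := by
    intro z
    have e : ‖z‖ ^ 2 = z.re ^ 2 + z.im ^ 2 := by
      rw [Complex.norm_eq_sqrt_sq_add_sq, Real.sq_sqrt (by positivity)]
    rw [e]
    refine ((ha _ _).trans ((hm z.re).add_nonneg (hm z.im) (sq_nonneg _) (sq_nonneg _))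
      (by norm_num) hu (by linarith)).mono ?_
    linarith
  have h2 := (ha (fl.add (fl.mul x.re x.re) (fl.mul x.im x.im))
    (fl.add (fl.mul y.re y.re) (fl.mul y.im y.im))).trans
    ((h1 x).add_nonneg (h1 y) (by positivity) (by positivity)) (by norm_num) hu (by linarith)
  set t := fl.add (fl.add (fl.mul x.re x.re) (fl.mul x.im x.im))
    (fl.add (fl.mul y.re y.re) (fl.mul y.im y.im)) with ht
  have ht0 : 0 ≤ t := by
    unfold RelErr at h2
    rw [Real.norm_eq_abs, Real.norm_eq_abs, abs_of_nonneg (by positivity : 0 ≤ ‖x‖ ^ 2 + ‖y‖ ^ 2)]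
      at h2
    have := (abs_le.1 h2).1
    nlinarith [sq_nonneg ‖x‖, sq_nonneg ‖y‖]
  have h3 : RelErr (1 * u) (fl.sqrt t) (√t) := by
    have := fl.sqrt_err t ht0
    unfold RelErr
    rwa [one_mul, Real.norm_eq_abs, Real.norm_eq_abs, abs_of_nonneg (Real.sqrt_nonneg t)]
  exact (h3.trans (h2.sqrt ht0 (by positivity)) (by norm_num) hu (by linarith)).mono
    (mul_le_mul_of_nonneg_right (by norm_num) hu)

lemma hypot_eq_zero_iff (hu1 : u ≤ 1 / 100) (x y : ℂ) : fl.hypot x y = 0 ↔ x = 0 ∧ y = 0 := by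
  rw [(fl.hypot_relErr hu1 x y).eq_zero_iff (by linarith), Real.sqrt_eq_zero (by positivity)]
  constructor
  · intro h
    have h1 : ‖x‖ ^ 2 = 0 := by nlinarith [sq_nonneg ‖x‖, sq_nonneg ‖y‖]
    have h2 : ‖y‖ ^ 2 = 0 := by nlinarith [sq_nonneg ‖x‖, sq_nonneg ‖y‖]
    simpa using And.intro h1 h2
  · rintro ⟨rfl, rfl⟩; simp

lemma cdivR_hypot_relErr (hu1 : u ≤ 1 / 1000) (x y z : ℂ) (h : ¬(x = 0 ∧ y = 0)) :
    RelErr (11 * u) (fl.cdivR z (fl.hypot x y)) (z / (√(‖x‖ ^ 2 + ‖y‖ ^ 2) : ℝ)) := by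
  have hu := fl.u_nonneg
  have h0 : fl.hypot x y ≠ 0 := fun h' => h ((fl.hypot_eq_zero_iff (by linarith) x y).1 h')
  have h1 : RelErr (1 * u) (fl.cdivR z (fl.hypot x y)) (z / (fl.hypot x y : ℂ)) :=
    (fl.cdivR_relErr z h0).mono (by rw [one_mul])
  have h2 : RelErr ((0 + 7 + 2) * u) (z / (fl.hypot x y : ℂ)) (z / (√(‖x‖ ^ 2 + ‖y‖ ^ 2) : ℝ)) :=
    (RelErr.refl (by simp) z).div (fl.hypot_relErr (by linarith) x y).ofReal le_rfl (by norm_num)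
      hu (by linarith) (by linarith) (by linarith)
  exact (h1.trans h2 (by norm_num) hu (by linarith)).mono
    (mul_le_mul_of_nonneg_right (by norm_num) hu)

lemma normalize_fst_relErr (hu1 : u ≤ 1 / 1000) (x y : ℂ) (h : ¬(x = 0 ∧ y = 0)) :
    RelErr (11 * u) (fl.normalize x y).1 (x / (√(‖x‖ ^ 2 + ‖y‖ ^ 2) : ℝ)) := by
  have h0 : fl.hypot x y ≠ 0 := fun h' => h ((fl.hypot_eq_zero_iff (by linarith) x y).1 h')
  rw [normalize, if_neg h0]
  exact fl.cdivR_hypot_relErr hu1 x y x h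

lemma normalize_snd_relErr (hu1 : u ≤ 1 / 1000) (x y : ℂ) (h : ¬(x = 0 ∧ y = 0)) :
    RelErr (11 * u) (fl.normalize x y).2 (y / (√(‖x‖ ^ 2 + ‖y‖ ^ 2) : ℝ)) := by
  have h0 : fl.hypot x y ≠ 0 := fun h' => h ((fl.hypot_eq_zero_iff (by linarith) x y).1 h')
  rw [normalize, if_neg h0]
  exact fl.cdivR_hypot_relErr hu1 x y y h

lemma normalize_zero (hu1 : u ≤ 1 / 1000) : fl.normalize 0 0 = (1, 0) := by
  rw [normalize, if_pos]
  exact (fl.hypot_eq_zero_iff (by linarith) 0 0).2 ⟨rfl, rfl⟩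

lemma sqrt_div_hypot (x y : ℂ) (h : ¬(x = 0 ∧ y = 0)) :
    √(‖x / (√(‖x‖ ^ 2 + ‖y‖ ^ 2) : ℝ)‖ ^ 2 + ‖y / (√(‖x‖ ^ 2 + ‖y‖ ^ 2) : ℝ)‖ ^ 2) = 1 := by
  have hp : 0 < ‖x‖ ^ 2 + ‖y‖ ^ 2 := by
    by_contra h'
    have h1 : ‖x‖ ^ 2 = 0 := by nlinarith [sq_nonneg ‖x‖, sq_nonneg ‖y‖]
    have h2 : ‖y‖ ^ 2 = 0 := by nlinarith [sq_nonneg ‖x‖, sq_nonneg ‖y‖]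
    exact h (by simpa using And.intro h1 h2)
  rw [Real.sqrt_eq_one]
  simp only [norm_div, Complex.norm_real, Real.norm_eq_abs, div_pow, sq_abs]
  rw [Real.sq_sqrt hp.le]
  field_simp

/-- A normalized pair has norm one up to roundoff. -/
lemma normalize_norm (hu1 : u ≤ 1 / 1000) (x y : ℂ) :
    |√(‖(fl.normalize x y).1‖ ^ 2 + ‖(fl.normalize x y).2‖ ^ 2) - 1| ≤ 11 * u := by
  have hu := fl.u_nonneg
  by_cases h : x = 0 ∧ y = 0
  · rw [h.1, h.2, fl.normalize_zero hu1]; simpa using hu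
  have := (fl.normalize_fst_relErr hu1 x y h).hypot (by positivity)
    (fl.normalize_snd_relErr hu1 x y h)
  rw [sqrt_div_hypot x y h] at this
  simpa [RelErr] using this

end FloatArith

/-! ### Embedding small matrices into large ones -/

section Embedding

variable {m d d' : ℕ}

/-- The `m × d` matrix whose columns are the unit vectors `eᵢ, …, eᵢ₊₍d₋₁₎`. -/
def incl (m d i : ℕ) : Matrix (Fin m) (Fin d) ℂ :=
  Matrix.of fun r k => if r.1 = i + k.1 then 1 else 0

lemma incl_isometry {m d i : ℕ} (h : i + d ≤ m) : (incl m d i)ᴴ * incl m d i = 1 := by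
  ext p q
  simp only [Matrix.mul_apply, Matrix.conjTranspose_apply, incl, Matrix.of_apply,
    Matrix.one_apply, apply_ite star, star_one, star_zero, ite_mul, one_mul, zero_mul]
  rw [Finset.sum_eq_single ⟨i + p.1, by omega⟩]
  · simp [Fin.ext_iff]
  · intro b _ hb
    rw [if_neg]
    intro h'
    exact hb (Fin.ext h')
  · simp

lemma incl_mul_incl {m d i : ℕ} (j e : ℕ) (h : j + e ≤ d) :
    incl m d i * incl d e j = incl m e (i + j) := by
  ext r k
  simp only [Matrix.mul_apply, incl, Matrix.of_apply, ite_mul, one_mul, zero_mul]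
  rw [Finset.sum_eq_single ⟨j + k.1, by omega⟩]
  · simp [add_assoc]
  · intro b _ hb
    split_ifs with h1 h2
    · exact absurd (Fin.ext h2) hb
    · rfl
    · rfl
  · simp

lemma incl_disjoint {m d e i j : ℕ} (h : i + d ≤ j ∨ j + e ≤ i) :
    (incl m d i)ᴴ * incl m e j = 0 := by
  ext p q
  simp only [Matrix.mul_apply, Matrix.conjTranspose_apply, incl, Matrix.of_apply, Matrix.zero_apply]
  refine Finset.sum_eq_zero fun r _ => ?_
  by_cases h1 : r.1 = i + p.1
  · rw [if_neg (show ¬ r.1 = j + q.1 by omega), mul_zero]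
  · rw [if_neg h1, star_zero, zero_mul]

/-- For `J` with orthonormal columns: the matrix that acts as `A` on the range of `J` and as the
identity on its orthogonal complement. -/
def emb (J : Matrix (Fin m) (Fin d) ℂ) (A : Matrix (Fin d) (Fin d) ℂ) : Matrix (Fin m) (Fin m) ℂ :=
  1 + J * (A - 1) * Jᴴ

lemma emb_one (J : Matrix (Fin m) (Fin d) ℂ) : emb J 1 = 1 := by simp [emb]

lemma emb_mul {J : Matrix (Fin m) (Fin d) ℂ} (hJ : Jᴴ * J = 1) (A B : Matrix (Fin d) (Fin d) ℂ) :
    emb J (A * B) = emb J A * emb J B := by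
  have e : J * (A - 1) * Jᴴ * (J * (B - 1) * Jᴴ) = J * ((A - 1) * (B - 1)) * Jᴴ := by
    calc J * (A - 1) * Jᴴ * (J * (B - 1) * Jᴴ)
        = J * (A - 1) * (Jᴴ * J) * (B - 1) * Jᴴ := by simp only [Matrix.mul_assoc]
      _ = _ := by rw [hJ, Matrix.mul_one]; simp only [Matrix.mul_assoc]
  simp only [emb, add_mul, mul_add, e, one_mul, mul_one]
  rw [show A * B - 1 = (B - 1) + ((A - 1) + (A - 1) * (B - 1)) by noncomm_ring]
  simp only [Matrix.mul_add, Matrix.add_mul]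
  abel

lemma emb_conjTranspose (J : Matrix (Fin m) (Fin d) ℂ) (A : Matrix (Fin d) (Fin d) ℂ) :
    emb J Aᴴ = (emb J A)ᴴ := by
  simp [emb, Matrix.conjTranspose_mul, Matrix.mul_assoc]

lemma emb_unitary {J : Matrix (Fin m) (Fin d) ℂ} (hJ : Jᴴ * J = 1) {A : Matrix (Fin d) (Fin d) ℂ}
    (hA : A ∈ Matrix.unitaryGroup (Fin d) ℂ) : emb J A ∈ Matrix.unitaryGroup (Fin m) ℂ := by
  rw [Matrix.mem_unitaryGroup_iff'] at *
  rw [Matrix.star_eq_conjTranspose] at *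
  rw [← emb_conjTranspose, ← emb_mul hJ, hA, emb_one]

lemma emb_emb {m d e : ℕ} (J : Matrix (Fin m) (Fin d) ℂ) (J' : Matrix (Fin d) (Fin e) ℂ)
    (A : Matrix (Fin e) (Fin e) ℂ) : emb J (emb J' A) = emb (J * J') A := by
  simp [emb, Matrix.conjTranspose_mul, Matrix.mul_assoc]

lemma emb_commute {J : Matrix (Fin m) (Fin d) ℂ} {J' : Matrix (Fin m) (Fin d') ℂ}
    (h : Jᴴ * J' = 0) (A : Matrix (Fin d) (Fin d) ℂ) (B : Matrix (Fin d') (Fin d') ℂ) :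
    emb J A * emb J' B = emb J' B * emb J A := by
  have h' : J'ᴴ * J = 0 := by
    have := congrArg Matrix.conjTranspose h
    simpa [Matrix.conjTranspose_mul] using this
  have e1 : J * (A - 1) * Jᴴ * (J' * (B - 1) * J'ᴴ) = 0 := by
    calc _ = J * (A - 1) * (Jᴴ * J') * (B - 1) * J'ᴴ := by simp only [Matrix.mul_assoc]
      _ = 0 := by simp [h]
  have e2 : J' * (B - 1) * J'ᴴ * (J * (A - 1) * Jᴴ) = 0 := by
    calc _ = J' * (B - 1) * (J'ᴴ * J) * (A - 1) * Jᴴ := by simp only [Matrix.mul_assoc]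
      _ = 0 := by simp [h']
  simp only [emb, add_mul, mul_add, e1, e2, one_mul, mul_one]
  abel

lemma conjTranspose_mul_emb {J : Matrix (Fin m) (Fin d) ℂ} (hJ : Jᴴ * J = 1)
    (A : Matrix (Fin d) (Fin d) ℂ) : Jᴴ * emb J A = A * Jᴴ := by
  have : Jᴴ * (J * (A - 1) * Jᴴ) = (Jᴴ * J) * ((A - 1) * Jᴴ) := by simp only [Matrix.mul_assoc]
  rw [emb, Matrix.mul_add, Matrix.mul_one, this, hJ, Matrix.one_mul, Matrix.sub_mul, Matrix.one_mul]
  abel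

lemma emb_mul_self {J : Matrix (Fin m) (Fin d) ℂ} (hJ : Jᴴ * J = 1)
    (A : Matrix (Fin d) (Fin d) ℂ) : emb J A * J = J * A := by
  rw [emb, Matrix.add_mul, Matrix.one_mul, Matrix.mul_assoc _ Jᴴ J, hJ, Matrix.mul_one,
    Matrix.mul_sub, Matrix.mul_one]
  abel

end Embedding

/-! ### Norms -/

section Norms

variable {m d : ℕ}

lemma norm_one_le : ‖(1 : Matrix (Fin m) (Fin m) ℂ)‖ ≤ 1 := by
  have h := Matrix.l2_opNorm_conjTranspose_mul_self (1 : Matrix (Fin m) (Fin m) ℂ)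
  rw [Matrix.conjTranspose_one, Matrix.mul_one] at h
  nlinarith [norm_nonneg (1 : Matrix (Fin m) (Fin m) ℂ)]

lemma norm_le_one_of_isometry {J : Matrix (Fin m) (Fin d) ℂ} (hJ : Jᴴ * J = 1) : ‖J‖ ≤ 1 := by
  have h := Matrix.l2_opNorm_conjTranspose_mul_self J
  rw [hJ] at h
  have := norm_one_le (m := d)
  nlinarith [norm_nonneg J]

lemma norm_unitary_le {A : Matrix (Fin m) (Fin m) ℂ} (hA : A ∈ Matrix.unitaryGroup (Fin m) ℂ) :
    ‖A‖ ≤ 1 :=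
  norm_le_one_of_isometry (Matrix.mem_unitaryGroup_iff'.1 hA)

lemma norm_mul_le_of_le_one_left {l m n : ℕ} {A : Matrix (Fin l) (Fin m) ℂ} (hA : ‖A‖ ≤ 1)
    (B : Matrix (Fin m) (Fin n) ℂ) : ‖A * B‖ ≤ ‖B‖ :=
  (Matrix.l2_opNorm_mul A B).trans (mul_le_of_le_one_left (norm_nonneg _) hA)

lemma norm_mul_le_of_le_one_right {l m n : ℕ} (A : Matrix (Fin l) (Fin m) ℂ)
    {B : Matrix (Fin m) (Fin n) ℂ} (hB : ‖B‖ ≤ 1) : ‖A * B‖ ≤ ‖A‖ :=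
  (Matrix.l2_opNorm_mul A B).trans (mul_le_of_le_one_right (norm_nonneg _) hB)

lemma norm_emb_sub_emb_le {J : Matrix (Fin m) (Fin d) ℂ} (hJ : Jᴴ * J = 1)
    (A B : Matrix (Fin d) (Fin d) ℂ) : ‖emb J A - emb J B‖ ≤ ‖A - B‖ := by
  have e : emb J A - emb J B = J * (A - B) * Jᴴ := by
    simp only [emb]
    rw [add_sub_add_left_eq_sub, ← Matrix.sub_mul, ← Matrix.mul_sub, sub_sub_sub_cancel_right]
  have h1 := norm_le_one_of_isometry hJ
  rw [e]
  refine (norm_mul_le_of_le_one_right _ ?_).trans (norm_mul_le_of_le_one_left h1 _)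
  rwa [Matrix.l2_opNorm_conjTranspose]

end Norms

/-! ### Core transformations as matrices -/

namespace Core

/-- A core with `|c|² + |s|² = 1`, that is, with a unitary active part. -/
def IsUnitary (g : Core) : Prop := ‖g.c‖ ^ 2 + ‖g.s‖ ^ 2 = 1

/-- The norm of the pair `(c, s)`. -/
noncomputable def size (g : Core) : ℝ := √(‖g.c‖ ^ 2 + ‖g.s‖ ^ 2)

/-- The active part. -/
noncomputable def block (g : Core) : Matrix (Fin 2) (Fin 2) ℂ :=
  !![g.c, -(g.ε : ℂ) * conj g.s; g.s, (g.ε : ℂ) * conj g.c]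

lemma sign_mul_self (e : ℤˣ) : (e : ℂ) * e = 1 := by
  rcases Int.units_eq_one_or e with rfl | rfl <;> simp

lemma norm_sign (e : ℤˣ) : ‖(e : ℂ)‖ = 1 := by
  rcases Int.units_eq_one_or e with rfl | rfl <;> simp

lemma conj_sign (e : ℤˣ) : conj (e : ℂ) = e := by
  rcases Int.units_eq_one_or e with rfl | rfl <;> simp

lemma toMat_eq_emb (m i : ℕ) (g : Core) :
    toMat m i g = emb (incl m 2 i) g.block := by
  ext r k
  simp only [toMat, emb, Matrix.of_apply, Matrix.add_apply, Matrix.one_apply, Matrix.mul_apply,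
    Fin.sum_univ_two, incl, Matrix.conjTranspose_apply, Matrix.sub_apply, block, Fin.ext_iff]
  have h1 : (i = i + 1) = False := by simp
  have h2 : (i + 1 = i) = False := by simp
  by_cases a : r.1 = i
  · by_cases b : k.1 = i
    · simp [a, b]
    · by_cases c : k.1 = i + 1
      · simp [a, c]
      · simp [a, b, c, Ne.symm b]
  · by_cases a' : r.1 = i + 1
    · by_cases b : k.1 = i
      · simp [a', b]
      · by_cases c : k.1 = i + 1
        · simp [a', c]
        · simp [a', b, c, Ne.symm c]
    · simp [a, a']

lemma toMat_add_eq_emb {m d i j : ℕ} (h' : j + 2 ≤ d) (g : Core) :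
    toMat m (i + j) g = emb (incl m d i) (toMat d j g) := by
  rw [toMat_eq_emb, toMat_eq_emb, emb_emb, incl_mul_incl j 2 h']

lemma block_conjTranspose_mul_block (g : Core) :
    g.blockᴴ * g.block = ((‖g.c‖ ^ 2 + ‖g.s‖ ^ 2 : ℝ) : ℂ) • (1 : Matrix (Fin 2) (Fin 2) ℂ) := by
  have h1 := Complex.conj_mul' g.c
  have h2 := Complex.conj_mul' g.s
  have h3 := sign_mul_self g.ε
  have h4 := conj_sign g.ε
  ext p q
  fin_cases p <;> fin_cases q <;>
    simp [block, Matrix.mul_apply, Fin.sum_univ_two]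
  · linear_combination h1 + h2
  · ring
  · ring
  · linear_combination h1 + h2 + (g.s * conj g.s + g.c * conj g.c) * h3

lemma block_unitary {g : Core} (hg : g.IsUnitary) : g.block ∈ Matrix.unitaryGroup (Fin 2) ℂ := by
  rw [Matrix.mem_unitaryGroup_iff', Matrix.star_eq_conjTranspose, block_conjTranspose_mul_block]
  rw [IsUnitary] at hg
  rw [hg]; simp

lemma toMat_unitary {m i : ℕ} (h : i + 2 ≤ m) {g : Core} (hg : g.IsUnitary) :
    toMat m i g ∈ Matrix.unitaryGroup (Fin m) ℂ := by
  rw [toMat_eq_emb]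
  exact emb_unitary (incl_isometry h) (block_unitary hg)

lemma norm_block (g : Core) : ‖g.block‖ = √(‖g.c‖ ^ 2 + ‖g.s‖ ^ 2) := by
  have h := Matrix.l2_opNorm_conjTranspose_mul_self g.block
  rw [block_conjTranspose_mul_block, norm_smul, Complex.norm_real, Real.norm_eq_abs,
    abs_of_nonneg (by positivity), CStarRing.norm_one, mul_one] at h
  rw [h, Real.sqrt_mul_self (norm_nonneg _)]

lemma norm_toMat_sub_le {m i : ℕ} (h : i + 2 ≤ m) {g g' : Core} (hε : g.ε = g'.ε) :
    ‖toMat m i g - toMat m i g'‖ ≤ √(‖g.c - g'.c‖ ^ 2 + ‖g.s - g'.s‖ ^ 2) := by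
  rw [toMat_eq_emb, toMat_eq_emb]
  refine (norm_emb_sub_emb_le (incl_isometry h) _ _).trans (le_of_eq ?_)
  have e : g.block - g'.block = block ⟨g.c - g'.c, g.s - g'.s, g.ε⟩ := by
    ext p q
    fin_cases p <;> fin_cases q <;> simp [block, hε] <;> ring
  rw [e, norm_block]

lemma toMat_commute {m i j : ℕ} (h : i + 2 ≤ j ∨ j + 2 ≤ i)
    (g g' : Core) : toMat m i g * toMat m j g' = toMat m j g' * toMat m i g := by
  rw [toMat_eq_emb, toMat_eq_emb]
  exact emb_commute (incl_disjoint h) _ _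

lemma block_adj (g : Core) : g.adj.block = g.blockᴴ := by
  have h3 := sign_mul_self g.ε
  ext p q
  fin_cases p <;> fin_cases q <;> simp [block, adj]
  · linear_combination (conj g.s) * h3

lemma toMat_adj (m i : ℕ) (g : Core) : toMat m i g.adj = (toMat m i g)ᴴ := by
  rw [toMat_eq_emb, toMat_eq_emb, block_adj, emb_conjTranspose]

lemma norm_c_adj (g : Core) : ‖g.adj.c‖ = ‖g.c‖ := RCLike.norm_conj _

lemma norm_s_adj (g : Core) : ‖g.adj.s‖ = ‖g.s‖ := by
  simp only [adj, norm_mul, norm_neg, norm_sign, one_mul]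

lemma norm_c_flip (g : Core) : ‖g.flip.c‖ = ‖g.c‖ := by
  simp only [flip, norm_mul, RCLike.norm_conj, norm_sign, one_mul]

lemma norm_s_flip (g : Core) : ‖g.flip.s‖ = ‖g.s‖ := rfl

lemma size_adj (g : Core) : g.adj.size = g.size := by
  simp only [size, norm_c_adj, norm_s_adj]

lemma size_flip (g : Core) : g.flip.size = g.size := by
  simp only [size, norm_c_flip, norm_s_flip]

lemma exactUnit_adj (g : Core) : g.adj.exactUnit = g.exactUnit.adj := by
  simp only [exactUnit, norm_c_adj, norm_s_adj]
  simp [adj]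
  ring

lemma IsUnitary.adj {g : Core} (hg : g.IsUnitary) : g.adj.IsUnitary := by
  rwa [IsUnitary, norm_c_adj, norm_s_adj]

lemma IsUnitary.flip {g : Core} (hg : g.IsUnitary) : g.flip.IsUnitary := by
  rwa [IsUnitary, norm_c_flip, norm_s_flip]

lemma flip_flip (g : Core) : g.flip.flip = g := by
  have h3 := sign_mul_self g.ε
  rcases g with ⟨c, s, e⟩
  simp only [flip, Core.mk.injEq, map_mul, conj_sign, Complex.conj_conj, and_true]
  linear_combination c * h3

lemma exactUnit_isUnitary {g : Core} (hg : g.size ≠ 0) : g.exactUnit.IsUnitary := by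
  unfold size at hg
  have h1 : 0 < ‖g.c‖ ^ 2 + ‖g.s‖ ^ 2 := Real.sqrt_ne_zero'.1 hg
  have h2 := Real.sq_sqrt h1.le
  simp only [IsUnitary, exactUnit, norm_div, Complex.norm_real, Real.norm_eq_abs, div_pow, sq_abs,
    h2]
  field_simp

lemma exactUnit_eq_self {g : Core} (hg : g.IsUnitary) : g.exactUnit = g := by
  rcases g with ⟨c, s, e⟩
  simp only [IsUnitary] at hg
  simp [exactUnit, hg]

lemma IsUnitary.norm_c_le {g : Core} (hg : g.IsUnitary) : ‖g.c‖ ≤ 1 := by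
  unfold IsUnitary at hg
  nlinarith [norm_nonneg g.c, sq_nonneg ‖g.s‖]

lemma IsUnitary.norm_s_le {g : Core} (hg : g.IsUnitary) : ‖g.s‖ ≤ 1 := by
  unfold IsUnitary at hg
  nlinarith [norm_nonneg g.s, sq_nonneg ‖g.c‖]

end Core

/-! ### The turnover in exact arithmetic -/

namespace Core

lemma toMat_three_zero (g : Core) : toMat 3 0 g =
    !![g.c, -(g.ε : ℂ) * conj g.s, 0; g.s, (g.ε : ℂ) * conj g.c, 0; 0, 0, 1] := by
  ext i j
  fin_cases i <;> fin_cases j <;> simp [toMat]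

lemma toMat_three_one (g : Core) : toMat 3 1 g =
    !![1, 0, 0; 0, g.c, -(g.ε : ℂ) * conj g.s; 0, g.s, (g.ε : ℂ) * conj g.c] := by
  ext i j
  fin_cases i <;> fin_cases j <;> simp [toMat]

lemma IsUnitary.mul_conj {g : Core} (hg : g.IsUnitary) :
    g.c * conj g.c + g.s * conj g.s = 1 := by
  rw [Complex.mul_conj', Complex.mul_conj']
  unfold IsUnitary at hg
  exact_mod_cast hg

lemma isUnitary_of_mul_conj {g : Core} (hg : g.c * conj g.c + g.s * conj g.s = 1) :
    g.IsUnitary := by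
  rw [Complex.mul_conj', Complex.mul_conj'] at hg
  unfold IsUnitary
  exact_mod_cast hg

lemma det_toMat_three {g : Core} (hg : g.IsUnitary) :
    (toMat 3 0 g).det = g.ε ∧ (toMat 3 1 g).det = g.ε := by
  have h := hg.mul_conj
  rw [toMat_three_zero, toMat_three_one, Matrix.det_fin_three, Matrix.det_fin_three]
  constructor
  · simp
    linear_combination (g.ε : ℂ) * h
  · simp
    linear_combination (g.ε : ℂ) * h

/-- A unitary `3 × 3` matrix with determinant `±1` whose first column is `e₁` is a core
transformation in the second position. -/
lemma eq_toMat_of_unitary {B : Matrix (Fin 3) (Fin 3) ℂ} {e : ℤˣ}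
    (hB : B ∈ Matrix.unitaryGroup (Fin 3) ℂ) (hdet : B.det = e)
    (h0 : B 0 0 = 1) (h1 : B 1 0 = 0) (h2 : B 2 0 = 0) :
    IsUnitary ⟨B 1 1, B 2 1, e⟩ ∧ B = toMat 3 1 ⟨B 1 1, B 2 1, e⟩ := by
  have a1 := Matrix.mem_unitaryGroup_iff.1 hB
  have a2 := Matrix.mem_unitaryGroup_iff'.1 hB
  have r00 := congrFun (congrFun a1 0) 0
  have c11 := congrFun (congrFun a2 1) 1
  have c12 := congrFun (congrFun a2 1) 2
  simp only [Matrix.mul_apply, Fin.sum_univ_three, Matrix.star_apply, h0,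
    RCLike.star_def, Matrix.one_apply_eq, Complex.mul_conj', norm_one, Complex.ofReal_one] at r00
  have r00' : ‖B 0 1‖ ^ 2 + ‖B 0 2‖ ^ 2 = 0 := by
    have : (1 : ℝ) + ‖B 0 1‖ ^ 2 + ‖B 0 2‖ ^ 2 = 1 := by
      rw [one_pow] at r00
      exact_mod_cast r00
    linarith
  have h01 : B 0 1 = 0 := by
    have : ‖B 0 1‖ ^ 2 = 0 := by nlinarith [sq_nonneg ‖B 0 1‖, sq_nonneg ‖B 0 2‖]
    simpa using this
  have h02 : B 0 2 = 0 := by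
    have : ‖B 0 2‖ ^ 2 = 0 := by nlinarith [sq_nonneg ‖B 0 1‖, sq_nonneg ‖B 0 2‖]
    simpa using this
  simp only [Matrix.mul_apply, Fin.sum_univ_three, Matrix.star_apply, h01, h02,
    RCLike.star_def, Matrix.one_apply_eq,
    Matrix.one_apply_ne (show (1 : Fin 3) ≠ 2 by decide)] at c11 c12
  have d : B 1 1 * B 2 2 - B 1 2 * B 2 1 = e := by
    rw [Matrix.det_fin_three, h0, h1, h2, h01, h02] at hdet
    simpa using hdet
  refine ⟨isUnitary_of_mul_conj (by linear_combination c11), ?_⟩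
  rw [toMat_three_one]
  ext i j
  fin_cases i <;> fin_cases j <;> simp [h0, h1, h2, h01, h02]
  · linear_combination -(B 1 2) * c11 + B 1 1 * c12 - conj (B 2 1) * d
  · linear_combination -(B 2 2) * c11 + B 2 1 * c12 + conj (B 1 1) * d

/-- The matrix to be refactored in a turnover. -/
noncomputable def tripleMat (G₁ G₂ M : Core) : Matrix (Fin 3) (Fin 3) ℂ :=
  toMat 3 0 G₁ * toMat 3 1 G₂ * toMat 3 0 M

lemma tripleMat_eq (G₁ G₂ M : Core) : tripleMat G₁ G₂ M =
    !![G₁.c * M.c - G₁.ε * (conj G₁.s * (G₂.c * M.s)),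
        -(M.ε * (G₁.c * conj M.s) + G₁.ε * (conj G₁.s * (M.ε * (G₂.c * conj M.c)))),
        G₁.ε * G₂.ε * (conj G₁.s * conj G₂.s);
      G₁.s * M.c + G₁.ε * (conj G₁.c * (G₂.c * M.s)),
        G₁.ε * (conj G₁.c * (M.ε * (G₂.c * conj M.c))) - M.ε * (G₁.s * conj M.s),
        -(G₁.ε * G₂.ε * (conj G₁.c * conj G₂.s));
      G₂.s * M.s, M.ε * (G₂.s * conj M.c), G₂.ε * conj G₂.c] := by
  rw [tripleMat, toMat_three_zero, toMat_three_one, toMat_three_zero]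
  ext i j
  fin_cases i <;> fin_cases j <;> simp [Matrix.mul_apply, Fin.sum_univ_three] <;> ring

/-- The turnover in exact arithmetic. The numbers `m₁, m₂, r` are such that `(m₁, m₂, 0)`
annihilates the last entry of the first column of the product; for `r = 0` they are not unique. -/
theorem exact_turnover {G₁ G₂ M : Core} (h₁ : G₁.IsUnitary) (h₂ : G₂.IsUnitary) (h₃ : M.IsUnitary)
    {m₁ m₂ : ℂ} {r : ℝ} (hm : IsUnitary ⟨m₁, m₂, M.ε⟩) {T : Matrix (Fin 3) (Fin 3) ℂ}
    (hT : T = tripleMat G₁ G₂ M) (hr₁ : T 1 0 = m₁ * r) (hr₂ : T 2 0 = m₂ * r) {c₂ s₂ : ℂ}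
    (hc : c₂ = G₁.ε * (T 0 0 * (conj m₁ * T 1 1 + conj m₂ * T 2 1) - r * T 0 1))
    (hs : s₂ = M.ε * (m₁ * T 2 1 - m₂ * T 1 1)) :
    IsUnitary ⟨T 0 0, r, G₁.ε⟩ ∧ IsUnitary ⟨c₂, s₂, G₂.ε⟩ ∧
    T = toMat 3 1 ⟨m₁, m₂, M.ε⟩ * toMat 3 0 ⟨T 0 0, r, G₁.ε⟩ * toMat 3 1 ⟨c₂, s₂, G₂.ε⟩ ∧
    r * s₂ = G₁.s * G₂.s := by
  have u1 : toMat 3 0 G₁ ∈ Matrix.unitaryGroup (Fin 3) ℂ := toMat_unitary (by norm_num) h₁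
  have u2 : toMat 3 1 G₂ ∈ Matrix.unitaryGroup (Fin 3) ℂ := toMat_unitary (by norm_num) h₂
  have u3 : toMat 3 0 M ∈ Matrix.unitaryGroup (Fin 3) ℂ := toMat_unitary (by norm_num) h₃
  have u4 : toMat 3 1 ⟨m₁, m₂, M.ε⟩ ∈ Matrix.unitaryGroup (Fin 3) ℂ :=
    toMat_unitary (by norm_num) hm
  have uT : T ∈ Matrix.unitaryGroup (Fin 3) ℂ := by
    rw [hT]; exact mul_mem (mul_mem u1 u2) u3
  have hm' := hm.mul_conj
  simp only at hm'
  have hh : IsUnitary ⟨T 0 0, r, G₁.ε⟩ := by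
    have a2 := congrFun (congrFun (Matrix.mem_unitaryGroup_iff'.1 uT) 0) 0
    simp only [Matrix.mul_apply, Fin.sum_univ_three, Matrix.star_apply, hr₁, hr₂,
      RCLike.star_def, Matrix.one_apply_eq, map_mul, Complex.conj_ofReal] at a2
    refine isUnitary_of_mul_conj ?_
    simp only [Complex.conj_ofReal]
    linear_combination a2 - (r : ℂ) * r * hm'
  have u5 : toMat 3 0 ⟨T 0 0, r, G₁.ε⟩ ∈ Matrix.unitaryGroup (Fin 3) ℂ :=
    toMat_unitary (by norm_num) hh
  set A₁ := toMat 3 1 ⟨m₁, m₂, M.ε⟩ with hA₁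
  set A₂ := toMat 3 0 ⟨T 0 0, r, G₁.ε⟩ with hA₂
  -- what is left of `T` when the first two cores are removed: its first column is `e₁`
  set B := star A₂ * (star A₁ * T) with hB
  have uB : B ∈ Matrix.unitaryGroup (Fin 3) ℂ :=
    mul_mem (Unitary.star_mem u5) (mul_mem (Unitary.star_mem u4) uT)
  have eT : T = A₁ * A₂ * B := by
    rw [hB, Matrix.mul_assoc, ← Matrix.mul_assoc A₂, Matrix.mem_unitaryGroup_iff.1 u5,
      Matrix.one_mul, ← Matrix.mul_assoc, Matrix.mem_unitaryGroup_iff.1 u4, Matrix.one_mul]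
  have hdet : B.det = G₂.ε := by
    have e := congrArg Matrix.det eT
    rw [Matrix.det_mul, Matrix.det_mul, hA₁, hA₂, (det_toMat_three hm).2, (det_toMat_three hh).1,
      hT, tripleMat, Matrix.det_mul, Matrix.det_mul, (det_toMat_three h₁).1,
      (det_toMat_three h₂).2, (det_toMat_three h₃).1] at e
    simp only at e
    have e1 := sign_mul_self M.ε
    have e2 := sign_mul_self G₁.ε
    linear_combination (-(M.ε : ℂ) * G₁.ε) * e +
      (G₂.ε - B.det) * ((G₁.ε : ℂ) * G₁.ε) * e1 + (G₂.ε - B.det) * e2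
  have e1 := sign_mul_self M.ε
  have e2 := sign_mul_self G₁.ε
  have hh' := hh.mul_conj
  simp only [Complex.conj_ofReal] at hh'
  have b00 : B 0 0 = 1 := by
    simp only [hB, hA₁, hA₂, toMat_three_one, toMat_three_zero, Matrix.mul_apply,
      Fin.sum_univ_three, Matrix.star_apply, hr₁, hr₂]
    simp
    linear_combination hh' + (r : ℂ) * r * hm'
  have b10 : B 1 0 = 0 := by
    simp only [hB, hA₁, hA₂, toMat_three_one, toMat_three_zero, Matrix.mul_apply,
      Fin.sum_univ_three, Matrix.star_apply, hr₁, hr₂]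
    simp
    linear_combination (G₁.ε : ℂ) * (r : ℂ) * T 0 0 * hm'
  have b20 : B 2 0 = 0 := by
    simp only [hB, hA₁, hA₂, toMat_three_one, toMat_three_zero, Matrix.mul_apply,
      Fin.sum_univ_three, Matrix.star_apply, hr₁, hr₂]
    simp
    ring
  have b11 : B 1 1 = c₂ := by
    simp only [hB, hA₁, hA₂, toMat_three_one, toMat_three_zero, Matrix.mul_apply,
      Fin.sum_univ_three, Matrix.star_apply, hc]
    simp
    ring
  have b21 : B 2 1 = s₂ := by
    simp only [hB, hA₁, hA₂, toMat_three_one, toMat_three_zero, Matrix.mul_apply,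
      Fin.sum_univ_three, Matrix.star_apply, hs]
    simp
    ring
  obtain ⟨hk, eB⟩ := eq_toMat_of_unitary uB hdet b00 b10 b20
  rw [b11, b21] at hk eB
  refine ⟨hh, hk, by rw [← eB]; exact eT, ?_⟩
  -- the relation for the sines is the upper right entry of `T`, computed in two ways
  have t := congrFun (congrFun eT 0) 2
  rw [eB, hA₁, hA₂, toMat_three_zero, toMat_three_one, toMat_three_one, hT, tripleMat_eq] at t
  simp [Matrix.mul_apply, Fin.sum_univ_three] at t
  have t' := congrArg conj t
  simp only [map_mul, conj_sign, Complex.conj_conj, Complex.conj_ofReal] at t'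
  have e3 := sign_mul_self G₂.ε
  linear_combination (-(G₁.ε : ℂ) * G₂.ε) * t' +
    (G₁.s * G₂.s - r * s₂) * ((G₁.ε : ℂ) * G₁.ε) * e3 + (G₁.s * G₂.s - r * s₂) * e2

end Core

/-! ### Propagation of errors through the complex operations -/

lemma RelErr.weaken {F : Type*} [NormedField F] {u k l : ℝ} {x y : F} (h : RelErr (k * u) x y)
    (hkl : k ≤ l) (hu : 0 ≤ u) : RelErr (l * u) x y :=
  h.mono (mul_le_mul_of_nonneg_right hkl hu)

/-- A relative error as a factor close to one. -/
lemma RelErr.exists_factor {F : Type*} [NormedField F] {η : ℝ} {x y : F} (h : RelErr η x y)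
    (hη : 0 ≤ η) : ∃ f : F, RelErr η f 1 ∧ x = y * f := by
  by_cases hy : y = 0
  · refine ⟨1, RelErr.refl hη 1, ?_⟩
    subst hy
    have : ‖x‖ ≤ 0 := by simpa [RelErr] using h
    simpa using this
  · refine ⟨x / y, ?_, by field_simp⟩
    unfold RelErr at *
    rw [div_sub_one hy, norm_div, norm_one, mul_one]
    exact (div_le_iff₀ (by positivity)).2 h

lemma RelErr.mul_one_one {F : Type*} [NormedField F] {u k l : ℝ} {x y : F}
    (hx : RelErr (k * u) x 1) (hy : RelErr (l * u) y 1) (hk : 0 ≤ k) (hu : 0 ≤ u)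
    (hs : k * l * u ≤ 1) : RelErr ((k + l + 1) * u) (x * y) 1 := by
  simpa using hx.mul hy hk hu hs

lemma RelErr.div_one_one {F : Type*} [NormedField F] {u k l : ℝ} {x y : F}
    (hx : RelErr (k * u) x 1) (hy : RelErr (l * u) y 1) (hk : 0 ≤ k) (hl : 0 ≤ l)
    (hu : 0 ≤ u) (hs : 2 * l * l * u ≤ 1) (hs' : 2 * l * u ≤ 1) (hs3 : k * (l + 1) * u ≤ 1) :
    RelErr ((k + l + 2) * u) (x / y) 1 := by
  simpa using hx.div hy hk hl hu hs hs' hs3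

lemma RelErr.ne_zero {F : Type*} [NormedField F] {η : ℝ} {x : F} (h : RelErr η x 1)
    (hη : η < 1) : x ≠ 0 := fun h0 => one_ne_zero ((h.eq_zero_iff hη).1 h0)

lemma RelErr.of_eq_mul {F : Type*} [NormedField F] {η : ℝ} {x y f : F} (h : RelErr η f 1)
    (e : x = y * f) : RelErr η x y := by
  have := h.const_mul y
  rwa [mul_one, ← e] at this

namespace FloatArith

variable {u k l : ℝ} (fl : FloatArith u) {x y x' y' : ℂ}

lemma cmul_rel (hx : RelErr (k * u) x y) (hx' : RelErr (l * u) x' y') (hk : 0 ≤ k) (hl : 0 ≤ l)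
    (hk1 : k ≤ 100000) (hl1 : l ≤ 100000) (hu1 : u ≤ 1 / 1000000000000) :
    RelErr ((k + l + 7) * u) (fl.cmul x x') (y * y') := by
  have hu := fl.u_nonneg
  have hkl : k * l * u ≤ 1 := by
    have : k * l ≤ 100000 * 100000 := mul_le_mul hk1 hl1 hl (by norm_num)
    nlinarith
  have h := (fl.cmul_relErr (by linarith) x x').trans (hx.mul hx' hk hu hkl) (by norm_num) hu
    (by nlinarith)
  exact h.weaken (by linarith) hu

lemma cmul_abs (hx : ‖x - y‖ ≤ k * u) (hx' : ‖x' - y'‖ ≤ l * u) (hy : ‖y‖ ≤ 2) (hy' : ‖y'‖ ≤ 2)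
    (hk : 0 ≤ k) (hl : 0 ≤ l) (hk1 : k ≤ 100000) (hl1 : l ≤ 100000)
    (hu1 : u ≤ 1 / 1000000000000) :
    ‖fl.cmul x x' - y * y'‖ ≤ (2 * k + 2 * l + 26) * u := by
  have hu := fl.u_nonneg
  have hkl : k * l * u ≤ 1 := by
    have : k * l ≤ 100000 * 100000 := mul_le_mul hk1 hl1 hl (by norm_num)
    nlinarith
  have h1 := abs_mul_err hx hx' hy hy' hk hu hkl
  have h2 : ‖fl.cmul x x' - x * x'‖ ≤ 5 * u * ‖x * x'‖ := fl.cmul_relErr (by linarith) x x'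
  have h3 : ‖x * x'‖ ≤ 5 := by
    have a1 : ‖x * x'‖ ≤ ‖x * x' - y * y'‖ + ‖y * y'‖ := by
      simpa using norm_add_le (x * x' - y * y') (y * y')
    have a2 : ‖y * y'‖ ≤ 2 * 2 := by
      rw [norm_mul]; exact mul_le_mul hy hy' (norm_nonneg _) (by norm_num)
    have a3 : (2 * k + 2 * l + 1) * u ≤ 1 := by nlinarith
    linarith
  have h4 : ‖fl.cmul x x' - y * y'‖ ≤ ‖fl.cmul x x' - x * x'‖ + ‖x * x' - y * y'‖ :=
    norm_sub_le_norm_sub_add_norm_sub _ _ _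
  nlinarith

lemma cadd_abs (hx : ‖x - y‖ ≤ k * u) (hx' : ‖x' - y'‖ ≤ l * u) (hy : ‖y‖ ≤ 4) (hy' : ‖y'‖ ≤ 4)
    (hk1 : k ≤ 100000) (hl1 : l ≤ 100000) (hu1 : u ≤ 1 / 1000000000000) :
    ‖fl.cadd x x' - (y + y')‖ ≤ (k + l + 9) * u := by
  have hu := fl.u_nonneg
  have h1 := abs_add_err hx hx'
  have h2 : ‖fl.cadd x x' - (x + x')‖ ≤ u * ‖x + x'‖ := fl.cadd_relErr x x'
  have h3 : ‖x + x'‖ ≤ 9 := by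
    have a1 : ‖x + x'‖ ≤ ‖x + x' - (y + y')‖ + ‖y + y'‖ := by
      simpa using norm_add_le (x + x' - (y + y')) (y + y')
    have a2 := norm_add_le y y'
    have a3 : (k + l) * u ≤ 1 := by nlinarith
    linarith
  have h4 : ‖fl.cadd x x' - (y + y')‖ ≤ ‖fl.cadd x x' - (x + x')‖ + ‖x + x' - (y + y')‖ :=
    norm_sub_le_norm_sub_add_norm_sub _ _ _
  nlinarith

lemma csub_abs (hx : ‖x - y‖ ≤ k * u) (hx' : ‖x' - y'‖ ≤ l * u) (hy : ‖y‖ ≤ 4) (hy' : ‖y'‖ ≤ 4)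
    (hk1 : k ≤ 100000) (hl1 : l ≤ 100000) (hu1 : u ≤ 1 / 1000000000000) :
    ‖fl.csub x x' - (y - y')‖ ≤ (k + l + 9) * u := by
  have hu := fl.u_nonneg
  have h1 := abs_sub_err hx hx'
  have h2 : ‖fl.csub x x' - (x - x')‖ ≤ u * ‖x - x'‖ := fl.csub_relErr x x'
  have h3 : ‖x - x'‖ ≤ 9 := by
    have a1 : ‖x - x'‖ ≤ ‖x - x' - (y - y')‖ + ‖y - y'‖ := by
      simpa using norm_add_le (x - x' - (y - y')) (y - y')
    have a2 := norm_sub_le y y'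
    have a3 : (k + l) * u ≤ 1 := by nlinarith
    linarith
  have h4 : ‖fl.csub x x' - (y - y')‖ ≤ ‖fl.csub x x' - (x - x')‖ + ‖x - x' - (y - y')‖ :=
    norm_sub_le_norm_sub_add_norm_sub _ _ _
  nlinarith

/-- Relatively accurate data are normalized with relative accuracy. -/
lemma normalize_rel (hx : RelErr (k * u) x y) (hx' : RelErr (k * u) x' y') (hk : 0 ≤ k)
    (hk1 : k ≤ 100000) (hu1 : u ≤ 1 / 1000000000000) (h0 : ¬(x = 0 ∧ x' = 0)) :
    RelErr ((2 * k + 14) * u) (fl.normalize x x').1 (y / (√(‖y‖ ^ 2 + ‖y'‖ ^ 2) : ℝ)) ∧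
    RelErr ((2 * k + 14) * u) (fl.normalize x x').2 (y' / (√(‖y‖ ^ 2 + ‖y'‖ ^ 2) : ℝ)) := by
  have hu := fl.u_nonneg
  have h1 := (hx.hypot (by positivity) hx').ofReal
  have hkk : 2 * k * k * u ≤ 1 := by
    have : k * k ≤ 100000 * 100000 := mul_le_mul hk1 hk1 hk (by norm_num)
    nlinarith
  have hku : k * u ≤ 1 / 1000000 := by nlinarith
  have d1 := hx.div h1 hk hk hu hkk (by linarith) (by nlinarith)
  have d2 := hx'.div h1 hk hk hu hkk (by linarith) (by nlinarith)
  constructor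
  · exact ((fl.normalize_fst_relErr (by linarith) x x' h0).trans d1 (by norm_num) hu
      (by nlinarith)).weaken (by linarith) hu
  · exact ((fl.normalize_snd_relErr (by linarith) x x' h0).trans d2 (by norm_num) hu
      (by nlinarith)).weaken (by linarith) hu

lemma norm_pair_rel (hu : 0 ≤ u) (hx : ‖x - y‖ ≤ k * u) (hx' : ‖x' - y'‖ ≤ k * u) (hk : 0 ≤ k)
    (hy : √(‖y‖ ^ 2 + ‖y'‖ ^ 2) = 1) :
    RelErr ((2 * k) * u) (√(‖x‖ ^ 2 + ‖x'‖ ^ 2)) 1 := by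
  have key (p q : ℂ) : √(‖p‖ ^ 2 + ‖q‖ ^ 2) = ‖(!₂[p, q] : EuclideanSpace ℂ (Fin 2))‖ := by
    simp [EuclideanSpace.norm_eq, Fin.sum_univ_two]
  have e : (!₂[x, x'] : EuclideanSpace ℂ (Fin 2)) - !₂[y, y'] = !₂[x - y, x' - y'] := by
    ext i; fin_cases i <;> simp
  unfold RelErr
  rw [norm_one, mul_one, Real.norm_eq_abs, ← hy, key, key]
  refine (abs_norm_sub_norm_le _ _).trans ?_
  rw [e, ← key]
  refine Real.sqrt_le_iff.2 ⟨by positivity, ?_⟩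
  have := pow_le_pow_left₀ (norm_nonneg _) hx 2
  have := pow_le_pow_left₀ (norm_nonneg _) hx' 2
  nlinarith [sq_nonneg (k * u)]

lemma normalize_abs (hx : ‖x - y‖ ≤ k * u) (hx' : ‖x' - y'‖ ≤ k * u) (hk : 0 ≤ k)
    (hk1 : k ≤ 100000) (hu1 : u ≤ 1 / 1000000000000) (hy : √(‖y‖ ^ 2 + ‖y'‖ ^ 2) = 1) :
    ‖(fl.normalize x x').1 - y‖ ≤ (4 * k + 20) * u ∧
    ‖(fl.normalize x x').2 - y'‖ ≤ (4 * k + 20) * u ∧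
    ∀ l, 0 ≤ l → l ≤ 100000 → RelErr (l * u) x' y' →
      RelErr ((2 * k + l + 15) * u) (fl.normalize x x').2 y' := by
  have hu := fl.u_nonneg
  have hku : k * u ≤ 1 / 1000000 := by nlinarith
  have hkk : 2 * (2 * k) * (2 * k) * u ≤ 1 := by
    have : k * k ≤ 100000 * 100000 := mul_le_mul hk1 hk1 hk (by norm_num)
    nlinarith
  have hN := norm_pair_rel hu hx hx' hk hy
  have hN0 : √(‖x‖ ^ 2 + ‖x'‖ ^ 2) ≠ 0 := hN.ne_zero (by nlinarith)
  have h0 : ¬(x = 0 ∧ x' = 0) := by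
    rintro ⟨rfl, rfl⟩
    simp at hN0
  have hy1 : ‖y‖ ^ 2 + ‖y'‖ ^ 2 = 1 := by rwa [Real.sqrt_eq_one] at hy
  have hyn : ‖y‖ ≤ 1 := by nlinarith [norm_nonneg y, sq_nonneg ‖y'‖]
  have hyn' : ‖y'‖ ≤ 1 := by nlinarith [norm_nonneg y', sq_nonneg ‖y‖]
  have hNc := hN.ofReal
  rw [Complex.ofReal_one] at hNc
  have gen : ∀ p q z : ℂ, RelErr (11 * u) q (p / (√(‖x‖ ^ 2 + ‖x'‖ ^ 2) : ℝ)) → ‖p - z‖ ≤ k * u →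
      ‖z‖ ≤ 1 → ‖q - z‖ ≤ (4 * k + 20) * u := by
    intro p q z hq hp hz
    have a1 : RelErr ((0 + 2 * k + 2) * u) (p / (√(‖x‖ ^ 2 + ‖x'‖ ^ 2) : ℝ)) (p / 1) :=
      (RelErr.refl (by simp) p).div hNc le_rfl (by linarith) hu hkk (by linarith) (by linarith)
    rw [div_one] at a1
    have a2 := hq.trans a1 (by norm_num) hu (by nlinarith)
    have a3 : ‖q - p‖ ≤ (11 + (0 + 2 * k + 2) + 1) * u * ‖p‖ := a2
    have a4 : ‖p‖ ≤ 1 + 1 / 1000000 := by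
      have : ‖p‖ ≤ ‖p - z‖ + ‖z‖ := by simpa using norm_add_le (p - z) z
      linarith
    have a5 : (11 + (0 + 2 * k + 2) + 1) * u * ‖p‖ ≤
      (11 + (0 + 2 * k + 2) + 1) * u * (1 + 1 / 1000000) :=
      mul_le_mul_of_nonneg_left a4 (by positivity)
    have a6 : ‖q - z‖ ≤ ‖q - p‖ + ‖p - z‖ := norm_sub_le_norm_sub_add_norm_sub _ _ _
    nlinarith
  refine ⟨gen x _ y (fl.normalize_fst_relErr (by linarith) x x' h0) hx hyn,
    gen x' _ y' (fl.normalize_snd_relErr (by linarith) x x' h0) hx' hyn', ?_⟩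
  intro l hl hl1 hl2
  have a1 := hl2.div hNc hl (by linarith) hu hkk (by linarith) (by nlinarith)
  rw [div_one] at a1
  exact ((fl.normalize_snd_relErr (by linarith) x x' h0).trans a1 (by norm_num) hu
    (by nlinarith)).weaken (by linarith) hu

/-- A real second component is normalized to a real number. -/
lemma normalize_snd_ofReal (x : ℂ) (r : ℝ) :
    (((fl.normalize x r).2.re : ℝ) : ℂ) = (fl.normalize x r).2 := by
  unfold normalize
  split_ifs with h
  · simp
  · apply Complex.ext
    · simp
    · have := fl.div_err 0 (fl.hypot x r) h
      simp at this
      simp [cdivR, this]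

end FloatArith

/-! ### Perturbations of cores -/

namespace Core

/-- The entries of `g` and `h` agree up to relative errors `η`. -/
def RelClose (η : ℝ) (g h : Core) : Prop := g.ε = h.ε ∧ RelErr η g.c h.c ∧ RelErr η g.s h.s

/-- The entries of `g` and `h` agree up to absolute errors `η`. -/
def Close (η : ℝ) (g h : Core) : Prop := g.ε = h.ε ∧ ‖g.c - h.c‖ ≤ η ∧ ‖g.s - h.s‖ ≤ η

/-- The pair `(c, s)` has norm one up to an error of size `η`. -/
def NearUnit (η : ℝ) (g : Core) : Prop := |g.size - 1| ≤ η

lemma RelClose.close {η : ℝ} {g h : Core} (H : RelClose η g h) (hh : h.IsUnitary) (hη : 0 ≤ η) :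
    Close η g h :=
  ⟨H.1, le_trans H.2.1 (mul_le_of_le_one_right hη hh.norm_c_le),
    le_trans H.2.2 (mul_le_of_le_one_right hη hh.norm_s_le)⟩

lemma Close.mono {η η' : ℝ} {g h : Core} (H : Close η g h) (hη : η ≤ η') : Close η' g h :=
  ⟨H.1, H.2.1.trans hη, H.2.2.trans hη⟩

lemma Close.adj {η : ℝ} {g h : Core} (H : Close η g h) : Close η g.adj h.adj := by
  refine ⟨H.1, abs_conj_err H.2.1, ?_⟩
  simp only [Core.adj, neg_mul, neg_sub_neg, H.1]
  rw [norm_sub_rev]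
  exact abs_sign_err _ H.2.2

lemma Close.flip {η : ℝ} {g h : Core} (H : Close η g h) : Close η g.flip h.flip := by
  refine ⟨H.1, ?_, H.2.2⟩
  simp only [Core.flip, H.1]
  exact abs_sign_err _ (abs_conj_err H.2.1)

lemma Close.symm {η : ℝ} {g h : Core} (H : Close η g h) : Close η h g :=
  ⟨H.1.symm, by rw [norm_sub_rev]; exact H.2.1, by rw [norm_sub_rev]; exact H.2.2⟩

lemma Close.trans {η η' : ℝ} {g h k : Core} (H : Close η g h) (H' : Close η' h k) :
    Close (η + η') g k :=
  ⟨H.1.trans H'.1, (norm_sub_le_norm_sub_add_norm_sub _ _ _).trans (add_le_add H.2.1 H'.2.1),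
    (norm_sub_le_norm_sub_add_norm_sub _ _ _).trans (add_le_add H.2.2 H'.2.2)⟩

lemma NearUnit.adj {η : ℝ} {g : Core} (h : NearUnit η g) : NearUnit η g.adj := by
  rwa [NearUnit, size_adj]

lemma NearUnit.flip {η : ℝ} {g : Core} (h : NearUnit η g) : NearUnit η g.flip := by
  rwa [NearUnit, size_flip]

lemma NearUnit.size_pos {η : ℝ} {g : Core} (h : NearUnit η g) (hη : η < 1) : 0 < g.size := by
  have := (abs_le.1 h).1
  linarith

lemma NearUnit.exactUnit_isUnitary {η : ℝ} {g : Core} (h : NearUnit η g) (hη : η < 1) :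
    g.exactUnit.IsUnitary := Core.exactUnit_isUnitary (h.size_pos hη).ne'

lemma c_eq {g : Core} (h : g.size ≠ 0) : g.c = g.exactUnit.c * (g.size : ℝ) := by
  have : ((g.size : ℝ) : ℂ) ≠ 0 := by exact_mod_cast h
  unfold exactUnit
  unfold size at *
  field_simp

lemma s_eq {g : Core} (h : g.size ≠ 0) : g.s = g.exactUnit.s * (g.size : ℝ) := by
  have : ((g.size : ℝ) : ℂ) ≠ 0 := by exact_mod_cast h
  unfold exactUnit
  unfold size at *
  field_simp

lemma NearUnit.relErr_size {η : ℝ} {g : Core} (h : NearUnit η g) :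
    RelErr η ((g.size : ℝ) : ℂ) 1 := by
  unfold RelErr
  rw [← Complex.ofReal_one, ← Complex.ofReal_sub, Complex.norm_real, Real.norm_eq_abs]
  simpa [NearUnit] using h

lemma NearUnit.relClose {η : ℝ} {g : Core} (h : NearUnit η g) (hη : η < 1) :
    RelClose η g g.exactUnit :=
  ⟨rfl, h.relErr_size.of_eq_mul (c_eq (h.size_pos hη).ne'),
    h.relErr_size.of_eq_mul (s_eq (h.size_pos hη).ne')⟩

lemma Close.norm_toMat_sub_le {η : ℝ} {g h : Core} (H : Close η g h) {m i : ℕ} (hi : i + 2 ≤ m) :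
    ‖toMat m i g - toMat m i h‖ ≤ 2 * η := by
  have hη : 0 ≤ η := (norm_nonneg _).trans H.2.1
  refine (Core.norm_toMat_sub_le hi H.1).trans (Real.sqrt_le_iff.2 ⟨by positivity, ?_⟩)
  have := pow_le_pow_left₀ (norm_nonneg _) H.2.1 2
  have := pow_le_pow_left₀ (norm_nonneg _) H.2.2 2
  nlinarith

end Core

/-! ### Stability of turnover and fusion -/

namespace FloatArith

variable {u : ℝ} (fl : FloatArith u)

open CompanionQZ.Core

lemma normalize_nearUnit (hu1 : u ≤ 1 / 1000) (x y : ℂ) (e : ℤˣ) :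
    NearUnit (11 * u) ⟨(fl.normalize x y).1, (fl.normalize x y).2, e⟩ :=
  fl.normalize_norm hu1 x y

/-- The entry `T₂₁` of the product of three cores may suffer from cancellation, but it is computed
with high relative accuracy for a product in which the entries of the first core are slightly
perturbed, relative to their size. -/
lemma exists_perturbation (hu1 : u ≤ 1 / 1000000000000) {G₁ G₂ M : Core}
    (h₁ : NearUnit (11 * u) G₁) (h₂ : NearUnit (11 * u) G₂) (h₃ : NearUnit (11 * u) M) :
    ∃ g₁ : Core, g₁.IsUnitary ∧ RelClose (74 * u) G₁ g₁ ∧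
      RelErr (80 * u) (fl.cadd (fl.cmul G₁.s M.c)
          ((G₁.ε : ℂ) * fl.cmul (conj G₁.c) (fl.cmul G₂.c M.s)))
        (g₁.s * M.exactUnit.c +
          g₁.ε * (conj g₁.c * (G₂.exactUnit.c * M.exactUnit.s))) := by
  have hu := fl.u_nonneg
  have p₁ := h₁.size_pos (by linarith)
  have p₂ := h₂.size_pos (by linarith)
  have p₃ := h₃.size_pos (by linarith)
  have r₁ := h₁.relErr_size
  have r₂ := h₂.relErr_size
  have r₃ := h₃.relErr_size
  obtain ⟨f₁, b₁, e₁⟩ := (fl.cmul_relErr (by linarith) G₂.c M.s).exists_factor (by positivity)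
  obtain ⟨f₂, b₂, e₂⟩ := (fl.cmul_relErr (by linarith) G₁.s M.c).exists_factor (by positivity)
  obtain ⟨f₃, b₃, e₃⟩ :=
    (fl.cmul_relErr (by linarith) (conj G₁.c) (fl.cmul G₂.c M.s)).exists_factor (by positivity)
  obtain ⟨f₄, b₄, e₄⟩ := (show RelErr (1 * u) _ _ by
    simpa only [one_mul] using fl.cadd_relErr (fl.cmul G₁.s M.c)
      ((G₁.ε : ℂ) * fl.cmul (conj G₁.c) (fl.cmul G₂.c M.s))).exists_factor (by positivity)
  rw [e₄, e₃, e₂, e₁]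
  rw [c_eq p₁.ne', s_eq p₁.ne', c_eq p₂.ne', c_eq p₃.ne', s_eq p₃.ne']
  set N₁ : ℂ := ((G₁.size : ℝ) : ℂ) with hN₁
  set N₂ : ℂ := ((G₂.size : ℝ) : ℂ) with hN₂
  set N₃ : ℂ := ((M.size : ℝ) : ℂ) with hN₃
  have U₁ := h₁.exactUnit_isUnitary (by linarith)
  set a := G₁.exactUnit.c with ha
  set s := G₁.exactUnit.s with hs
  -- the errors of the two terms are moved into the ratio of the entries of the first core; a
  -- factor that both terms share does no harm to the relative accuracy of the sum
  have q₁ := r₂.mul_one_one b₁ (by norm_num) hu (by linarith)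
  have q₂ := q₁.mul_one_one b₃ (by norm_num) hu (by linarith)
  have q₃ := b₂.div_one_one q₂ (by norm_num) (by norm_num) hu (by linarith) (by linarith)
    (by linarith)
  set q : ℂ := f₂ / (N₂ * f₁ * f₃) with hq
  have q₃' : RelErr (30 * u) q 1 := q₃.weaken (by norm_num) hu
  have hsq : RelErr (30 * u) (s * q) s := q₃'.of_eq_mul rfl
  set ν : ℝ := √(‖a‖ ^ 2 + ‖s * q‖ ^ 2) with hν
  have hν1 : RelErr (30 * u) ν 1 := by
    have := (RelErr.refl (by positivity : 0 ≤ 30 * u) a).hypot (by positivity) hsq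
    rwa [show √(‖a‖ ^ 2 + ‖s‖ ^ 2) = 1 by rw [Real.sqrt_eq_one]; exact U₁] at this
  have hν2 : RelErr (30 * u) (ν : ℂ) 1 := by simpa using hν1.ofReal
  have n₂ := r₂.ne_zero (by linarith)
  have f₁0 := b₁.ne_zero (by linarith)
  have f₃0 := b₃.ne_zero (by linarith)
  have q0 := q₃'.ne_zero (by linarith)
  have ν0 := hν2.ne_zero (by linarith)
  have hnot : ¬(a = 0 ∧ s * q = 0) := by
    rintro ⟨h1, h2⟩
    rw [hν, h1, h2] at ν0
    simp at ν0
  refine ⟨⟨a / ν, s * q / ν, G₁.ε⟩, ?_, ⟨rfl, ?_, ?_⟩, ?_⟩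
  · have := sqrt_div_hypot a (s * q) hnot
    rwa [Real.sqrt_eq_one] at this
  · refine ((r₁.mul_one_one hν2 (by norm_num) hu (by linarith)).weaken (by norm_num) hu).of_eq_mul ?_
    simp only
    rw [c_eq p₁.ne']
    field_simp
    rfl
  · have := (r₁.mul_one_one hν2 (by norm_num) hu (by linarith)).div_one_one q₃' (by norm_num)
      (by norm_num) hu (by linarith) (by linarith) (by linarith)
    refine (this.weaken (by norm_num) hu).of_eq_mul ?_
    simp only
    rw [s_eq p₁.ne']
    field_simp
    rfl
  · have t₁ := b₄.mul_one_one r₁ (by norm_num) hu (by linarith)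
    have t₂ := t₁.mul_one_one r₂ (by norm_num) hu (by linarith)
    have t₃ := t₂.mul_one_one r₃ (by norm_num) hu (by linarith)
    have t₄ := t₃.mul_one_one b₁ (by norm_num) hu (by linarith)
    have t₅ := t₄.mul_one_one b₃ (by norm_num) hu (by linarith)
    have t₆ := t₅.mul_one_one hν2 (by norm_num) hu (by linarith)
    refine (t₆.weaken (by norm_num) hu).of_eq_mul ?_
    simp only [map_mul, map_div₀, Complex.conj_ofReal, hq, hN₁]
    field_simp

/-- Stability of the turnover: the input and output cores are close to unitary cores for which the
turnover holds exactly, and the product of the two sines is preserved to high relative accuracy.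
The latter is due to the quotient by which the second sine is computed, and normalization does not
spoil it. -/
theorem turnover_stable (hu1 : u ≤ 1 / 1000000000000) {G₁ G₂ M : Core}
    (h₁ : NearUnit (11 * u) G₁) (h₂ : NearUnit (11 * u) G₂) (h₃ : NearUnit (11 * u) M)
    {t : Core × Core × Core} (ht : t = turnover fl G₁ G₂ M) :
    (NearUnit (11 * u) t.1 ∧ NearUnit (11 * u) t.2.1 ∧ NearUnit (11 * u) t.2.2) ∧
    (t.2.1.ε = G₁.ε ∧ t.2.2.ε = G₂.ε) ∧
    RelErr (20000 * u) (t.2.1.s * t.2.2.s) (G₁.s * G₂.s) ∧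
    ∃ g₁ g₂ μ m h k : Core,
      (g₁.IsUnitary ∧ g₂.IsUnitary ∧ μ.IsUnitary ∧ m.IsUnitary ∧ h.IsUnitary ∧ k.IsUnitary) ∧
      (Close (30000 * u) G₁ g₁ ∧ Close (30000 * u) G₂ g₂ ∧ Close (30000 * u) M μ) ∧
      (Close (30000 * u) t.1 m ∧ Close (30000 * u) t.2.1 h ∧ Close (30000 * u) t.2.2 k) ∧
      toMat 3 0 g₁ * toMat 3 1 g₂ * toMat 3 0 μ = toMat 3 1 m * toMat 3 0 h * toMat 3 1 k := by
  have hu := fl.u_nonneg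
  obtain ⟨g₁, hg₁, c₁, hT₂₁⟩ := fl.exists_perturbation hu1 h₁ h₂ h₃
  have c₂' := h₂.relClose (by linarith)
  have c₃ := h₃.relClose (by linarith)
  have hg₂ := h₂.exactUnit_isUnitary (by linarith)
  have hμ := h₃.exactUnit_isUnitary (by linarith)
  generalize G₂.exactUnit = g₂ at *
  generalize M.exactUnit = μ at *
  obtain ⟨T, hT⟩ : ∃ T, T = tripleMat g₁ g₂ μ := ⟨_, rfl⟩
  have uT : T ∈ Matrix.unitaryGroup (Fin 3) ℂ := by
    rw [hT]
    exact mul_mem (mul_mem (toMat_unitary (by norm_num) hg₁) (toMat_unitary (by norm_num) hg₂))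
      (toMat_unitary (by norm_num) hμ)
  have bT : ∀ i j, ‖T i j‖ ≤ 1 := entry_norm_bound_of_unitary uT
  have e₁₁ : T 0 0 = g₁.c * μ.c - g₁.ε * (conj g₁.s * (g₂.c * μ.s)) := by
    rw [hT, tripleMat_eq]; rfl
  have e₁₂ : T 0 1 =
      -(μ.ε * (g₁.c * conj μ.s) + g₁.ε * (conj g₁.s * (μ.ε * (g₂.c * conj μ.c)))) := by
    rw [hT, tripleMat_eq]; rfl
  have e₂₁ : T 1 0 = g₁.s * μ.c + g₁.ε * (conj g₁.c * (g₂.c * μ.s)) := by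
    rw [hT, tripleMat_eq]; rfl
  have e₂₂ : T 1 1 =
      g₁.ε * (conj g₁.c * (μ.ε * (g₂.c * conj μ.c))) - μ.ε * (g₁.s * conj μ.s) := by
    rw [hT, tripleMat_eq]; rfl
  have e₃₁ : T 2 0 = g₂.s * μ.s := by
    rw [hT, tripleMat_eq]; rfl
  have e₃₂ : T 2 1 = μ.ε * (g₂.s * conj μ.c) := by
    rw [hT, tripleMat_eq]; rfl
  have n₁ := hg₁.norm_c_le
  have n₁' := hg₁.norm_s_le
  have n₂ := hg₂.norm_c_le
  have n₂' := hg₂.norm_s_le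
  have n₃ := hμ.norm_c_le
  have n₃' := hμ.norm_s_le
  have nmul : ∀ {x y : ℂ}, ‖x‖ ≤ 1 → ‖y‖ ≤ 1 → ‖x * y‖ ≤ 1 := fun hx hy => by
    rw [norm_mul]; exact mul_le_one₀ hx (norm_nonneg _) hy
  have nconj : ∀ {x : ℂ}, ‖x‖ ≤ 1 → ‖conj x‖ ≤ 1 := fun hx => by rwa [RCLike.norm_conj]
  have nsign : ∀ (e : ℤˣ) {x : ℂ}, ‖x‖ ≤ 1 → ‖(e : ℂ) * x‖ ≤ 1 := fun e x hx => by
    rwa [norm_mul, norm_sign, one_mul]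
  have le4 : ∀ {x : ℂ}, ‖x‖ ≤ 1 → ‖x‖ ≤ 4 := fun h => h.trans (by norm_num)
  have le2 : ∀ {x : ℂ}, ‖x‖ ≤ 1 → ‖x‖ ≤ 2 := fun h => h.trans (by norm_num)
  -- the entries of the product
  have hp := fl.cmul_rel c₂'.2.1 c₃.2.2 (by norm_num) (by norm_num) (by norm_num) (by norm_num) hu1
  have hq := (fl.cmul_rel c₂'.2.1 c₃.2.1.star (by norm_num) (by norm_num) (by norm_num)
    (by norm_num) hu1).const_mul (μ.ε : ℂ)
  have hT₃₁ := fl.cmul_rel c₂'.2.2 c₃.2.2 (by norm_num) (by norm_num) (by norm_num) (by norm_num)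
    hu1
  have hT₃₂ := (fl.cmul_rel c₂'.2.2 c₃.2.1.star (by norm_num) (by norm_num) (by norm_num)
    (by norm_num) hu1).const_mul (μ.ε : ℂ)
  have hT₁₁ := fl.csub_abs
    ((fl.cmul_rel c₁.2.1 c₃.2.1 (by norm_num) (by norm_num) (by norm_num)
      (by norm_num) hu1).abs_le (by norm_num) hu (nmul n₁ n₃))
    (((fl.cmul_rel c₁.2.2.star hp (by norm_num) (by norm_num) (by norm_num)
      (by norm_num) hu1).const_mul (g₁.ε : ℂ)).abs_le (by norm_num) hu
      (nsign _ (nmul (nconj n₁') (nmul n₂ n₃'))))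
    (le4 (nmul n₁ n₃)) (le4 (nsign _ (nmul (nconj n₁') (nmul n₂ n₃'))))
    (by norm_num) (by norm_num) hu1
  have hT₁₂ := fl.cadd_abs
    (((fl.cmul_rel c₁.2.1 c₃.2.2.star (by norm_num) (by norm_num) (by norm_num)
      (by norm_num) hu1).const_mul (μ.ε : ℂ)).abs_le (by norm_num) hu
      (nsign _ (nmul n₁ (nconj n₃'))))
    (((fl.cmul_rel c₁.2.2.star hq (by norm_num) (by norm_num) (by norm_num)
      (by norm_num) hu1).const_mul (g₁.ε : ℂ)).abs_le (by norm_num) hu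
      (nsign _ (nmul (nconj n₁') (nsign _ (nmul n₂ (nconj n₃))))))
    (le4 (nsign _ (nmul n₁ (nconj n₃'))))
    (le4 (nsign _ (nmul (nconj n₁') (nsign _ (nmul n₂ (nconj n₃))))))
    (by norm_num) (by norm_num) hu1
  have hT₂₂ := fl.csub_abs
    (((fl.cmul_rel c₁.2.1.star hq (by norm_num) (by norm_num) (by norm_num)
      (by norm_num) hu1).const_mul (g₁.ε : ℂ)).abs_le (by norm_num) hu
      (nsign _ (nmul (nconj n₁) (nsign _ (nmul n₂ (nconj n₃))))))
    (((fl.cmul_rel c₁.2.2 c₃.2.2.star (by norm_num) (by norm_num) (by norm_num)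
      (by norm_num) hu1).const_mul (μ.ε : ℂ)).abs_le (by norm_num) hu
      (nsign _ (nmul n₁' (nconj n₃'))))
    (le4 (nsign _ (nmul (nconj n₁) (nsign _ (nmul n₂ (nconj n₃))))))
    (le4 (nsign _ (nmul n₁' (nconj n₃'))))
    (by norm_num) (by norm_num) hu1
  rw [← neg_sub_neg, norm_sub_rev, ← e₁₂, ← c₃.1, ← c₁.1] at hT₁₂
  rw [← e₁₁, ← c₁.1] at hT₁₁
  rw [← e₂₂, ← c₃.1, ← c₁.1] at hT₂₂
  rw [← e₂₁] at hT₂₁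
  rw [← e₃₁] at hT₃₁
  rw [← e₃₂, ← c₃.1] at hT₃₂
  simp only [turnover] at ht
  generalize fl.csub (fl.cmul G₁.c M.c)
    ((G₁.ε : ℂ) * fl.cmul (conj G₁.s) (fl.cmul G₂.c M.s)) = T₁₁ at *
  generalize fl.cadd (fl.cmul G₁.s M.c)
    ((G₁.ε : ℂ) * fl.cmul (conj G₁.c) (fl.cmul G₂.c M.s)) = T₂₁ at *
  generalize hT₃₁' : fl.cmul G₂.s M.s = T₃₁ at *
  generalize -fl.cadd ((M.ε : ℂ) * fl.cmul G₁.c (conj M.s))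
    ((G₁.ε : ℂ) * fl.cmul (conj G₁.s) ((M.ε : ℂ) * fl.cmul G₂.c (conj M.c))) = T₁₂ at *
  generalize fl.csub ((G₁.ε : ℂ) * fl.cmul (conj G₁.c) ((M.ε : ℂ) * fl.cmul G₂.c (conj M.c)))
    ((M.ε : ℂ) * fl.cmul G₁.s (conj M.s)) = T₂₂ at *
  generalize (M.ε : ℂ) * fl.cmul G₂.s (conj M.c) = T₃₂ at *
  -- the first column of the product
  obtain ⟨ρ, hρ⟩ : ∃ ρ, ρ = √(‖T 1 0‖ ^ 2 + ‖T 2 0‖ ^ 2) := ⟨_, rfl⟩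
  have hT₃₁80 := hT₃₁.weaken (show (11 : ℝ) + 11 + 7 ≤ 80 by norm_num) hu
  have hr := (fl.hypot_relErr (by linarith) T₂₁ T₃₁).trans
    (hT₂₁.hypot (by positivity) hT₃₁80) (by norm_num) hu (by linarith)
  rw [← hρ] at hr
  obtain ⟨m₁, m₂, hm, hm10, hm20, hm₁, hm₂, hm0⟩ : ∃ m₁ m₂ : ℂ, IsUnitary ⟨m₁, m₂, M.ε⟩ ∧
      T 1 0 = m₁ * ρ ∧ T 2 0 = m₂ * ρ ∧ ‖(fl.normalize T₂₁ T₃₁).1 - m₁‖ ≤ 174 * u ∧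
      ‖(fl.normalize T₂₁ T₃₁).2 - m₂‖ ≤ 174 * u ∧
      (fl.hypot T₂₁ T₃₁ = 0 → m₁ = 1 ∧ m₂ = 0) := by
    by_cases h0 : T₂₁ = 0 ∧ T₃₁ = 0
    · have z₁ := (hT₂₁.eq_zero_iff (by linarith)).1 h0.1
      have z₂ := (hT₃₁.eq_zero_iff (by linarith)).1 h0.2
      refine ⟨1, 0, by simp [IsUnitary], ?_, ?_, ?_, ?_, fun _ => ⟨rfl, rfl⟩⟩
      · rw [hρ, z₁, z₂]; simp
      · rw [hρ, z₁, z₂]; simp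
      · rw [h0.1, h0.2, fl.normalize_zero (by linarith)]; simpa using hu
      · rw [h0.1, h0.2, fl.normalize_zero (by linarith)]; simpa using hu
    · have h0' : ¬(T 1 0 = 0 ∧ T 2 0 = 0) := by
        rwa [← hT₂₁.eq_zero_iff (by linarith), ← hT₃₁.eq_zero_iff (by linarith)]
      have hr0 : fl.hypot T₂₁ T₃₁ ≠ 0 := fun h => h0 ((fl.hypot_eq_zero_iff (by linarith) _ _).1 h)
      have hρ0 : (ρ : ℂ) ≠ 0 := by
        have : ρ ≠ 0 := fun h => hr0 ((hr.eq_zero_iff (by linarith)).2 h)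
        exact_mod_cast this
      have N := fl.normalize_rel hT₂₁ hT₃₁80 (by norm_num) (by norm_num) hu1 h0
      have hm := sqrt_div_hypot _ _ h0'
      rw [← hρ] at N hm
      rw [Real.sqrt_eq_one] at hm
      have hm' : IsUnitary ⟨T 1 0 / ρ, T 2 0 / ρ, M.ε⟩ := hm
      refine ⟨T 1 0 / ρ, T 2 0 / ρ, hm', by field_simp, by field_simp, ?_, ?_,
        fun h => absurd h hr0⟩
      · exact (N.1.abs_le (by norm_num) hu hm'.norm_c_le).trans (by linarith)
      · exact (N.2.abs_le (by norm_num) hu hm'.norm_s_le).trans (by linarith)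
  obtain ⟨γ, hγ⟩ : ∃ γ, γ = g₁.ε * (T 0 0 * (conj m₁ * T 1 1 + conj m₂ * T 2 1) - ρ * T 0 1) :=
    ⟨_, rfl⟩
  obtain ⟨σ, hσ⟩ : ∃ σ, σ = μ.ε * (m₁ * T 2 1 - m₂ * T 1 1) := ⟨_, rfl⟩
  rw [c₃.1] at hm
  obtain ⟨hh, hk, hfac, hprod⟩ := exact_turnover hg₁ hg₂ hμ hm hT hm10 hm20 hγ hσ
  -- the second core
  have hhn : √(‖T 0 0‖ ^ 2 + ‖(ρ : ℂ)‖ ^ 2) = 1 := by rw [Real.sqrt_eq_one]; exact hh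
  have nρ : ‖(ρ : ℂ)‖ ≤ 1 := hh.norm_s_le
  have hrc := hr.ofReal
  have H := fl.normalize_abs (k := 300) (hT₁₁.trans (by linarith))
    ((hrc.abs_le (by norm_num) hu nρ).trans (by linarith)) (by norm_num) (by norm_num) hu1 hhn
  have H₂ := H.2.2 _ (by norm_num) (by norm_num) hrc
  have Hnear := fl.normalize_nearUnit (by linarith) T₁₁ (fl.hypot T₂₁ T₃₁ : ℂ) G₁.ε
  have Hreal := fl.normalize_snd_ofReal T₁₁ (fl.hypot T₂₁ T₃₁)
  have Hzero : fl.hypot T₂₁ T₃₁ = 0 → (fl.normalize T₁₁ (fl.hypot T₂₁ T₃₁)).2 = 0 := by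
    intro h
    refine (H₂.eq_zero_iff (by linarith)).2 ?_
    rw [(hr.eq_zero_iff (by linarith)).1 h]; simp
  have Mnear := fl.normalize_nearUnit (by linarith) T₂₁ T₃₁ M.ε
  generalize fl.normalize T₁₁ (fl.hypot T₂₁ T₃₁) = h' at *
  generalize fl.normalize T₂₁ T₃₁ = m' at *
  -- the third core
  have N₂₂ := fl.cadd_abs
    (fl.cmul_abs (abs_conj_err hm₁) hT₂₂ (le2 (nconj hm.norm_c_le)) (le2 (bT 1 1)) (by norm_num)
      (by norm_num) (by norm_num) (by norm_num) hu1)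
    (fl.cmul_abs (abs_conj_err hm₂) (hT₃₂.abs_le (by norm_num) hu (bT 2 1))
      (le2 (nconj hm.norm_s_le)) (le2 (bT 2 1)) (by norm_num)
      (by norm_num) (by norm_num) (by norm_num) hu1)
    (le4 (nmul (nconj hm.norm_c_le) (bT 1 1))) (le4 (nmul (nconj hm.norm_s_le) (bT 2 1)))
    (by norm_num) (by norm_num) hu1
  have nN : ‖conj m₁ * T 1 1 + conj m₂ * T 2 1‖ ≤ 2 :=
    (norm_add_le _ _).trans (by
      linarith [nmul (nconj hm.norm_c_le) (bT 1 1), nmul (nconj hm.norm_s_le) (bT 2 1)])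
  have C₂ := fl.csub_abs
    (fl.cmul_abs H.1 N₂₂ (le2 (bT 0 0)) nN (by norm_num)
      (by norm_num) (by norm_num) (by norm_num) hu1)
    (fl.cmul_abs (x := h'.2) (y := ρ) (H₂.abs_le (by norm_num) hu nρ) hT₁₂ (le2 nρ) (le2 (bT 0 1))
      (by norm_num) (by norm_num) (by norm_num) (by norm_num) hu1)
    (by
      rw [norm_mul]
      exact (mul_le_mul (bT 0 0) nN (norm_nonneg _) (by norm_num)).trans (by norm_num))
    (le4 (nmul nρ (bT 0 1))) (by norm_num) (by norm_num) hu1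
  have C₂' := abs_sign_err g₁.ε C₂
  rw [← hγ, ← c₁.1] at C₂'
  rw [Hreal] at ht
  -- the sine of the third core is relatively accurate if the quotient is used
  have S₂ : fl.hypot T₂₁ T₃₁ ≠ 0 →
      RelErr (1000 * u) (fl.cdivR (fl.cmul G₁.s G₂.s) h'.2.re) σ := by
    intro h0
    have hρ0 : (ρ : ℂ) ≠ 0 := by
      have : ρ ≠ 0 := fun h => h0 ((hr.eq_zero_iff (by linarith)).2 h)
      exact_mod_cast this
    have hh0 : h'.2.re ≠ 0 := by
      intro h
      rw [h] at Hreal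
      have := (H₂.eq_zero_iff (by linarith)).1 (by rw [← Hreal]; simp)
      exact hρ0 this
    have s₁ : RelErr (1 * u) (fl.cdivR (fl.cmul G₁.s G₂.s) h'.2.re)
        (fl.cmul G₁.s G₂.s / (h'.2.re : ℂ)) := by
      simpa only [one_mul] using fl.cdivR_relErr (fl.cmul G₁.s G₂.s) hh0
    rw [Hreal] at s₁
    have s₂ := (fl.cmul_rel c₁.2.2 c₂'.2.2 (by norm_num) (by norm_num) (by norm_num)
      (by norm_num) hu1).div H₂ (by norm_num) (by norm_num) hu (by linarith) (by linarith)
      (by linarith)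
    have e : σ = g₁.s * g₂.s / ρ := by rw [← hprod]; field_simp
    rw [← e] at s₂
    exact (s₁.trans s₂ (by norm_num) hu (by linarith)).weaken (by norm_num) hu
  have S₂' : ‖(if fl.hypot T₂₁ T₃₁ = 0 then (M.ε : ℂ) * T₃₂
      else fl.cdivR (fl.cmul G₁.s G₂.s) h'.2.re) - σ‖ ≤ 1000 * u := by
    split_ifs with h0
    · obtain ⟨z₁, z₂⟩ := hm0 h0
      rw [hσ, z₁, z₂, c₃.1, one_mul, zero_mul, sub_zero]
      exact (abs_sign_err _ (hT₃₂.abs_le (by norm_num) hu (bT 2 1))).trans (by linarith)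
    · exact (S₂ h0).abs_le (by norm_num) hu hk.norm_s_le
  have hkn : √(‖γ‖ ^ 2 + ‖σ‖ ^ 2) = 1 := by rw [Real.sqrt_eq_one]; exact hk
  have Kf := fl.normalize_abs (k := 7000) (C₂'.trans (by linarith)) (S₂'.trans (by linarith))
    (by norm_num) (by norm_num) hu1 hkn
  have Knear := fl.normalize_nearUnit (by linarith)
    ((G₁.ε : ℂ) * fl.csub (fl.cmul h'.1 (fl.cadd (fl.cmul (conj m'.1) T₂₂)
      (fl.cmul (conj m'.2) T₃₂))) (fl.cmul h'.2 T₁₂))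
    (if fl.hypot T₂₁ T₃₁ = 0 then (M.ε : ℂ) * T₃₂
      else fl.cdivR (fl.cmul G₁.s G₂.s) h'.2.re) G₂.ε
  have K₂ : fl.hypot T₂₁ T₃₁ ≠ 0 → RelErr (15015 * u) (fl.normalize
      ((G₁.ε : ℂ) * fl.csub (fl.cmul h'.1 (fl.cadd (fl.cmul (conj m'.1) T₂₂)
        (fl.cmul (conj m'.2) T₃₂))) (fl.cmul h'.2 T₁₂))
      (if fl.hypot T₂₁ T₃₁ = 0 then (M.ε : ℂ) * T₃₂
        else fl.cdivR (fl.cmul G₁.s G₂.s) h'.2.re)).2 σ := by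
    intro h0
    refine (Kf.2.2 1000 (by norm_num) (by norm_num) ?_).weaken (by norm_num) hu
    rw [if_neg h0]
    exact S₂ h0
  generalize fl.normalize _ (if fl.hypot T₂₁ T₃₁ = 0 then (M.ε : ℂ) * T₃₂
      else fl.cdivR (fl.cmul G₁.s G₂.s) h'.2.re) = k' at *
  subst ht
  refine ⟨⟨Mnear, Hnear, Knear⟩, ⟨rfl, rfl⟩, ?_, g₁, g₂, μ, _, _, _,
    ⟨hg₁, hg₂, hμ, hm, hh, hk⟩, ⟨?_, ?_, ?_⟩, ⟨?_, ?_, ?_⟩, by rw [← hfac, hT]; rfl⟩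
  · have f₁ := c₁.2.2.mul c₂'.2.2 (by norm_num) hu (by linarith)
    by_cases h0 : fl.hypot T₂₁ T₃₁ = 0
    · have z : g₁.s * g₂.s = 0 := by
        rw [← hprod, (hr.eq_zero_iff (by linarith)).1 h0]; simp
      have z' := (f₁.eq_zero_iff (by linarith)).2 z
      simp only [Hzero h0, z', zero_mul]
      exact RelErr.refl (by positivity) _
    · have f₂ := H₂.mul (K₂ h0) (by norm_num) hu (by linarith)
      rw [hprod] at f₂
      exact (f₂.trans (f₁.symm (by norm_num) hu (by linarith) (by linarith)) (by norm_num) hu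
        (by linarith)).weaken (by norm_num) hu
  · exact (c₁.close hg₁ (by positivity)).mono (by linarith)
  · exact (c₂'.close hg₂ (by positivity)).mono (by linarith)
  · exact (c₃.close hμ (by positivity)).mono (by linarith)
  · exact ⟨c₃.1, hm₁.trans (by linarith), hm₂.trans (by linarith)⟩
  · exact ⟨c₁.1, H.1.trans (by linarith), H.2.1.trans (by linarith)⟩
  · exact ⟨c₂'.1, Kf.1.trans (by linarith), Kf.2.1.trans (by linarith)⟩

end FloatArith

namespace Core

/-- The product of two core transformations in the same position. -/
noncomputable def mul (g h : Core) : Core :=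
  ⟨g.c * h.c - g.ε * (conj g.s * h.s), g.s * h.c + g.ε * (conj g.c * h.s), g.ε * h.ε⟩

lemma block_mul (g h : Core) : (g.mul h).block = g.block * h.block := by
  have e := sign_mul_self g.ε
  ext p q
  fin_cases p <;> fin_cases q <;>
    simp [block, mul, Matrix.mul_apply, Fin.sum_univ_two]
  · ring
  · linear_combination -(h.ε * (g.c * conj h.s)) * e
  · ring
  · linear_combination -(h.ε * (g.s * conj h.s)) * e

lemma toMat_mul {m i : ℕ} (hi : i + 2 ≤ m) (g h : Core) :
    toMat m i (g.mul h) = toMat m i g * toMat m i h := by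
  rw [toMat_eq_emb, toMat_eq_emb, toMat_eq_emb, block_mul, emb_mul (incl_isometry hi)]

lemma IsUnitary.mul {g h : Core} (hg : g.IsUnitary) (hh : h.IsUnitary) : (g.mul h).IsUnitary := by
  have e := sign_mul_self g.ε
  have e' := conj_sign g.ε
  refine isUnitary_of_mul_conj ?_
  simp only [Core.mul, map_add, map_sub, map_mul, Complex.conj_conj, e']
  linear_combination (h.c * conj h.c) * hg.mul_conj + (g.c * conj g.c + g.s * conj g.s) *
    (h.s * conj h.s) * e + (h.s * conj h.s) * hg.mul_conj + hh.mul_conj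

/-- A core whose entries are close to those of a unitary core is close to its normalization. -/
lemma NearUnit.close_of_close {u k : ℝ} {g h : Core} (H : Close (k * u) g h)
    (hg : NearUnit (11 * u) g) (hu : 0 ≤ u) (hu1 : u ≤ 1 / 1000000000000) :
    Close ((k + 11) * u) g.exactUnit h := by
  have c := (hg.relClose (by linarith)).close (hg.exactUnit_isUnitary (by linarith))
    (by positivity)
  exact (c.symm.trans H).mono (by linarith)

/-- Reflection of a `3 × 3` matrix about its antidiagonal. -/
noncomputable def antiTranspose (A : Matrix (Fin 3) (Fin 3) ℂ) : Matrix (Fin 3) (Fin 3) ℂ :=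
  Aᵀ.submatrix Fin.rev Fin.rev

lemma antiTranspose_mul (A B : Matrix (Fin 3) (Fin 3) ℂ) :
    antiTranspose (A * B) = antiTranspose B * antiTranspose A := by
  rw [antiTranspose, Matrix.transpose_mul]
  exact (Matrix.submatrix_mul_equiv _ _ Fin.rev Fin.revPerm Fin.rev).symm

lemma antiTranspose_toMat_zero (g : Core) : antiTranspose (toMat 3 0 g) = toMat 3 1 g.flip := by
  have e := sign_mul_self g.ε
  have e' := conj_sign g.ε
  rw [toMat_three_zero, toMat_three_one]
  ext i j
  fin_cases i <;> fin_cases j <;> simp [antiTranspose, flip, Fin.rev]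
  linear_combination (-g.c) * e

lemma antiTranspose_toMat_one (g : Core) : antiTranspose (toMat 3 1 g) = toMat 3 0 g.flip := by
  have e := sign_mul_self g.ε
  have e' := conj_sign g.ε
  rw [toMat_three_zero, toMat_three_one]
  ext i j
  fin_cases i <;> fin_cases j <;> simp [antiTranspose, flip, Fin.rev]
  linear_combination (-g.c) * e

end Core

lemma norm_mul_sub_mul_le {m : ℕ} {A A' B B' : Matrix (Fin m) (Fin m) ℂ} {α β : ℝ}
    (hA : ‖A - A'‖ ≤ α) (hB : ‖B - B'‖ ≤ β) (nA : ‖A'‖ ≤ 1) (nB : ‖B‖ ≤ 1) :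
    ‖A * B - A' * B'‖ ≤ α + β := by
  have e : A * B - A' * B' = (A - A') * B + A' * (B - B') := by noncomm_ring
  rw [e]
  exact (norm_add_le _ _).trans (add_le_add ((norm_mul_le_of_le_one_right _ nB).trans hA)
    ((norm_mul_le_of_le_one_left nA _).trans hB))

namespace FloatArith

variable {u : ℝ} (fl : FloatArith u)

open CompanionQZ.Core

/-- Stability of the fusion. -/
theorem fuse_stable (hu1 : u ≤ 1 / 1000000000000) {G M g h : Core} (hG : Close (100 * u) G g)
    (hM : Close (100 * u) M h) (hg : g.IsUnitary) (hh : h.IsUnitary) :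
    NearUnit (11 * u) (fuse fl G M) ∧ Close (5000 * u) (fuse fl G M) (g.mul h) := by
  have hu := fl.u_nonneg
  have n₁ := hg.norm_c_le
  have n₁' := hg.norm_s_le
  have n₂ := hh.norm_c_le
  have n₂' := hh.norm_s_le
  have nmul : ∀ {x y : ℂ}, ‖x‖ ≤ 1 → ‖y‖ ≤ 1 → ‖x * y‖ ≤ 1 := fun hx hy => by
    rw [norm_mul]; exact mul_le_one₀ hx (norm_nonneg _) hy
  have nconj : ∀ {x : ℂ}, ‖x‖ ≤ 1 → ‖conj x‖ ≤ 1 := fun hx => by rwa [RCLike.norm_conj]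
  have nsign : ∀ (e : ℤˣ) {x : ℂ}, ‖x‖ ≤ 1 → ‖(e : ℂ) * x‖ ≤ 1 := fun e x hx => by
    rwa [norm_mul, norm_sign, one_mul]
  have le4 : ∀ {x : ℂ}, ‖x‖ ≤ 1 → ‖x‖ ≤ 4 := fun h => h.trans (by norm_num)
  have le2 : ∀ {x : ℂ}, ‖x‖ ≤ 1 → ‖x‖ ≤ 2 := fun h => h.trans (by norm_num)
  have hc := fl.csub_abs
    (fl.cmul_abs hG.2.1 hM.2.1 (le2 n₁) (le2 n₂) (by norm_num) (by norm_num) (by norm_num)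
      (by norm_num) hu1)
    (abs_sign_err g.ε (fl.cmul_abs (abs_conj_err hG.2.2) hM.2.2 (le2 (nconj n₁')) (le2 n₂')
      (by norm_num) (by norm_num) (by norm_num) (by norm_num) hu1))
    (le4 (nmul n₁ n₂)) (le4 (nsign _ (nmul (nconj n₁') n₂'))) (by norm_num) (by norm_num) hu1
  have hs := fl.cadd_abs
    (fl.cmul_abs hG.2.2 hM.2.1 (le2 n₁') (le2 n₂) (by norm_num) (by norm_num) (by norm_num)
      (by norm_num) hu1)
    (abs_sign_err g.ε (fl.cmul_abs (abs_conj_err hG.2.1) hM.2.2 (le2 (nconj n₁)) (le2 n₂')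
      (by norm_num) (by norm_num) (by norm_num) (by norm_num) hu1))
    (le4 (nmul n₁' n₂)) (le4 (nsign _ (nmul (nconj n₁) n₂'))) (by norm_num) (by norm_num) hu1
  have hn : √(‖(g.mul h).c‖ ^ 2 + ‖(g.mul h).s‖ ^ 2) = 1 := by
    rw [Real.sqrt_eq_one]; exact hg.mul hh
  have N := fl.normalize_abs (k := 900) (hc.trans (by linarith)) (hs.trans (by linarith))
    (by norm_num) (by norm_num) hu1 hn
  rw [← hG.1] at N
  refine ⟨fl.normalize_nearUnit (by linarith) _ _ _, ?_, ?_, ?_⟩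
  · simp only [fuse, Core.mul, hG.1, hM.1]
  · simp only [fuse, Core.mul]
    rw [← hG.1]
    exact N.1.trans (by linarith)
  · simp only [fuse, Core.mul]
    rw [← hG.1]
    exact N.2.1.trans (by linarith)

/-- The turnover from left to right is stable, too. -/
theorem turnoverLR_stable (hu1 : u ≤ 1 / 1000000000000) {M G₁ G₂ : Core}
    (h₁ : NearUnit (11 * u) G₁) (h₂ : NearUnit (11 * u) G₂) (h₃ : NearUnit (11 * u) M)
    {t : Core × Core × Core} (ht : t = turnoverLR fl M G₁ G₂) :
    (NearUnit (11 * u) t.1 ∧ NearUnit (11 * u) t.2.1 ∧ NearUnit (11 * u) t.2.2) ∧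
    (t.1.ε = G₁.ε ∧ t.2.1.ε = G₂.ε) ∧
    RelErr (20000 * u) (t.1.s * t.2.1.s) (G₁.s * G₂.s) ∧
    ∃ g₁ g₂ μ m h k : Core,
      (g₁.IsUnitary ∧ g₂.IsUnitary ∧ μ.IsUnitary ∧ m.IsUnitary ∧ h.IsUnitary ∧ k.IsUnitary) ∧
      (Close (30000 * u) G₁ g₁ ∧ Close (30000 * u) G₂ g₂ ∧ Close (30000 * u) M μ) ∧
      (Close (30000 * u) t.1 h ∧ Close (30000 * u) t.2.1 k ∧ Close (30000 * u) t.2.2 m) ∧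
      toMat 3 1 μ * toMat 3 0 g₁ * toMat 3 1 g₂ = toMat 3 0 h * toMat 3 1 k * toMat 3 0 m := by
  obtain ⟨⟨a₁, a₂, a₃⟩, ⟨b₁, b₂⟩, c, g₁, g₂, μ, m, h, k, ⟨d₁, d₂, d₃, d₄, d₅, d₆⟩, ⟨e₁, e₂, e₃⟩,
    ⟨f₁, f₂, f₃⟩, eq⟩ := fl.turnover_stable hu1 h₂.flip h₁.flip h₃.flip rfl
  subst ht
  refine ⟨⟨a₃.flip, a₂.flip, a₁.flip⟩, ⟨b₂, b₁⟩, ?_, g₂.flip, g₁.flip, μ.flip, m.flip, k.flip,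
    h.flip, ⟨d₂.flip, d₁.flip, d₃.flip, d₄.flip, d₆.flip, d₅.flip⟩, ⟨?_, ?_, ?_⟩,
    ⟨f₃.flip, f₂.flip, f₁.flip⟩, ?_⟩
  · rw [mul_comm (turnover fl G₂.flip G₁.flip M.flip).2.1.s, mul_comm G₂.flip.s] at c
    exact c
  · simpa only [Core.flip_flip] using e₂.flip
  · simpa only [Core.flip_flip] using e₁.flip
  · simpa only [Core.flip_flip] using e₃.flip
  · have := congrArg antiTranspose eq
    simpa only [antiTranspose_mul, antiTranspose_toMat_zero, antiTranspose_toMat_one,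
      ← Matrix.mul_assoc] using this

lemma norm_exactUnit_sub_le (hu : 0 ≤ u) (hu1 : u ≤ 1 / 1000000000000) {m i : ℕ} (hi : i + 2 ≤ m) {G g : Core}
    (hG : NearUnit (11 * u) G) (hc : Close (30000 * u) G g) :
    ‖toMat m i G.exactUnit - toMat m i g‖ ≤ 60100 * u :=
  ((hG.close_of_close hc hu hu1).norm_toMat_sub_le hi).trans
    (by linarith)

lemma triple_norm_sub_le (hu : 0 ≤ u) (hu1 : u ≤ 1 / 1000000000000) {m i j k : ℕ}
    (hi : i + 2 ≤ m) (hj : j + 2 ≤ m) (hk : k + 2 ≤ m) {F G H f g h : Core}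
    (hF : NearUnit (11 * u) F) (hG : NearUnit (11 * u) G) (hH : NearUnit (11 * u) H)
    (uf : f.IsUnitary) (ug : g.IsUnitary)
    (cf : Close (30000 * u) F f) (cg : Close (30000 * u) G g) (ch : Close (30000 * u) H h) :
    ‖toMat m i F.exactUnit * toMat m j G.exactUnit * toMat m k H.exactUnit -
      toMat m i f * toMat m j g * toMat m k h‖ ≤ 200000 * u := by
  have := norm_mul_sub_mul_le
    (norm_mul_sub_mul_le (norm_exactUnit_sub_le hu hu1 hi hF cf)
      (norm_exactUnit_sub_le hu hu1 hj hG cg) (norm_unitary_le (toMat_unitary hi uf))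
      (norm_unitary_le (toMat_unitary hj (hG.exactUnit_isUnitary (by linarith)))))
    (norm_exactUnit_sub_le hu hu1 hk hH ch)
    (norm_unitary_le (mul_mem (toMat_unitary hi uf) (toMat_unitary hj ug)))
    (norm_unitary_le (toMat_unitary hk (hH.exactUnit_isUnitary (by linarith))))
  exact this.trans (by linarith)

/-- The effect of a turnover from right to left, on matrices of any size. -/
theorem turnover_matrix (hu1 : u ≤ 1 / 1000000000000) {G₁ G₂ M : Core}
    (h₁ : NearUnit (11 * u) G₁) (h₂ : NearUnit (11 * u) G₂) (h₃ : NearUnit (11 * u) M)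
    {t : Core × Core × Core} (ht : t = turnover fl G₁ G₂ M) {m i : ℕ} (hi : i + 3 ≤ m) :
    ‖toMat m i G₁.exactUnit * toMat m (i + 1) G₂.exactUnit * toMat m i M.exactUnit -
      toMat m (i + 1) t.1.exactUnit * toMat m i t.2.1.exactUnit *
        toMat m (i + 1) t.2.2.exactUnit‖ ≤ 400000 * u := by
  obtain ⟨⟨a₁, a₂, a₃⟩, -, -, g₁, g₂, μ, p, h, k, ⟨d₁, d₂, d₃, d₄, d₅, d₆⟩, ⟨e₁, e₂, e₃⟩,
    ⟨f₁, f₂, f₃⟩, eq⟩ := fl.turnover_stable hu1 h₁ h₂ h₃ ht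
  have J := incl_isometry hi
  have eq' := congrArg (emb (incl m 3 i)) eq
  rw [emb_mul J, emb_mul J, emb_mul J, emb_mul J] at eq'
  simp only [← toMat_add_eq_emb (i := i) (m := m) (show 0 + 2 ≤ 3 by norm_num),
    ← toMat_add_eq_emb (i := i) (m := m) (show 1 + 2 ≤ 3 by norm_num), add_zero] at eq'
  have A := triple_norm_sub_le fl.u_nonneg hu1 (m := m) (i := i) (j := i + 1) (k := i) (by omega) (by omega)
    (by omega) h₁ h₂ h₃ d₁ d₂ e₁ e₂ e₃
  have B := triple_norm_sub_le fl.u_nonneg hu1 (m := m) (i := i + 1) (j := i) (k := i + 1) (by omega)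
    (by omega) (by omega) a₁ a₂ a₃ d₄ d₅ f₁ f₂ f₃
  rw [eq'] at A
  rw [norm_sub_rev] at B
  exact (norm_sub_le_norm_sub_add_norm_sub _ _ _).trans ((add_le_add A B).trans (by linarith [fl.u_nonneg]))

/-- The effect of a turnover from left to right, on matrices of any size. -/
theorem turnoverLR_matrix (hu1 : u ≤ 1 / 1000000000000) {M G₁ G₂ : Core}
    (h₁ : NearUnit (11 * u) G₁) (h₂ : NearUnit (11 * u) G₂) (h₃ : NearUnit (11 * u) M)
    {t : Core × Core × Core} (ht : t = turnoverLR fl M G₁ G₂) {m i : ℕ} (hi : i + 3 ≤ m) :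
    ‖toMat m (i + 1) M.exactUnit * toMat m i G₁.exactUnit * toMat m (i + 1) G₂.exactUnit -
      toMat m i t.1.exactUnit * toMat m (i + 1) t.2.1.exactUnit *
        toMat m i t.2.2.exactUnit‖ ≤ 400000 * u := by
  obtain ⟨⟨a₁, a₂, a₃⟩, -, -, g₁, g₂, μ, p, h, k, ⟨d₁, d₂, d₃, d₄, d₅, d₆⟩, ⟨e₁, e₂, e₃⟩,
    ⟨f₁, f₂, f₃⟩, eq⟩ := fl.turnoverLR_stable hu1 h₁ h₂ h₃ ht
  have J := incl_isometry hi
  have eq' := congrArg (emb (incl m 3 i)) eq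
  rw [emb_mul J, emb_mul J, emb_mul J, emb_mul J] at eq'
  simp only [← toMat_add_eq_emb (i := i) (m := m) (show 0 + 2 ≤ 3 by norm_num),
    ← toMat_add_eq_emb (i := i) (m := m) (show 1 + 2 ≤ 3 by norm_num), add_zero] at eq'
  have A := triple_norm_sub_le fl.u_nonneg hu1 (m := m) (i := i + 1) (j := i) (k := i + 1) (by omega)
    (by omega) (by omega) h₃ h₁ h₂ d₃ d₁ e₃ e₁ e₂
  have B := triple_norm_sub_le fl.u_nonneg hu1 (m := m) (i := i) (j := i + 1) (k := i) (by omega)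
    (by omega) (by omega) a₁ a₂ a₃ d₅ d₆ f₁ f₂ f₃
  rw [eq'] at A
  rw [norm_sub_rev] at B
  exact (norm_sub_le_norm_sub_add_norm_sub _ _ _).trans ((add_le_add A B).trans (by linarith [fl.u_nonneg]))

end FloatArith

/-! ### Sequences of core transformations -/

namespace Core

/-- The product `G i * G (i + 1) * ⋯ * G (i + k - 1)`. -/
noncomputable def segMat (m i k : ℕ) (G : ℕ → Core) : Matrix (Fin m) (Fin m) ℂ :=
  ((List.range k).map fun j => toMat m (i + j) (G (i + j))).prod

variable {m : ℕ} {G G' : ℕ → Core}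

lemma prodMat_eq_segMat (k : ℕ) : prodMat m k G = segMat m 0 k G := by
  simp [prodMat, segMat]

lemma segMat_zero (i : ℕ) : segMat m i 0 G = 1 := by simp [segMat]

lemma segMat_one (i : ℕ) : segMat m i 1 G = toMat m i (G i) := by simp [segMat]

lemma segMat_add (i a b : ℕ) :
    segMat m i (a + b) G = segMat m i a G * segMat m (i + a) b G := by
  simp only [segMat, List.range_add, List.map_append, List.prod_append, List.map_map]
  congr 2
  simp only [List.map_inj_left, Function.comp_apply, add_assoc, implies_true]

lemma segMat_succ (i k : ℕ) :
    segMat m i (k + 1) G = segMat m i k G * toMat m (i + k) (G (i + k)) := by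
  rw [segMat_add, segMat_one]

lemma segMat_succ' (i k : ℕ) :
    segMat m i (k + 1) G = toMat m i (G i) * segMat m (i + 1) k G := by
  rw [add_comm k 1, segMat_add, segMat_one]

lemma segMat_congr {i k : ℕ} (h : ∀ j, i ≤ j → j < i + k → G j = G' j) :
    segMat m i k G = segMat m i k G' := by
  induction k with
  | zero => simp [segMat_zero]
  | succ k ih =>
    rw [segMat_succ, segMat_succ, ih fun j h1 h2 => h j h1 (by omega),
      h (i + k) (by omega) (by omega)]

lemma segMat_unitary {i k : ℕ} (hk : i + k + 1 ≤ m)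
    (h : ∀ j, i ≤ j → j < i + k → (G j).IsUnitary) :
    segMat m i k G ∈ Matrix.unitaryGroup (Fin m) ℂ := by
  induction k with
  | zero => rw [segMat_zero]; exact one_mem _
  | succ k ih =>
    rw [segMat_succ]
    exact mul_mem (ih (by omega) fun j h1 h2 => h j h1 (by omega))
      (toMat_unitary (by omega) (h (i + k) (by omega) (by omega)))

lemma segMat_commute {i k j : ℕ} (h : j + 2 ≤ i ∨ i + k + 1 ≤ j) (g : Core) :
    segMat m i k G * toMat m j g = toMat m j g * segMat m i k G := by
  induction k with
  | zero => simp [segMat_zero]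
  | succ k ih =>
    rw [segMat_succ, Matrix.mul_assoc, toMat_commute (by omega), ← Matrix.mul_assoc,
      ih (by omega), Matrix.mul_assoc]

lemma prodMat_split_one {k i : ℕ} (hi : i + 1 ≤ k) :
    prodMat m k G = segMat m 0 i G * toMat m i (G i) * segMat m (i + 1) (k - (i + 1)) G := by
  rw [prodMat_eq_segMat, show k = i + 1 + (k - (i + 1)) by omega, segMat_add, segMat_succ]
  simp

lemma prodMat_split_two {k i : ℕ} (hi : i + 2 ≤ k) :
    prodMat m k G = segMat m 0 i G * (toMat m i (G i) * toMat m (i + 1) (G (i + 1))) *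
      segMat m (i + 2) (k - (i + 2)) G := by
  rw [prodMat_eq_segMat, show k = i + 2 + (k - (i + 2)) by omega, segMat_add, segMat_succ,
    segMat_succ]
  simp [Matrix.mul_assoc]

lemma norm_conj_segMat_le {A D X : Matrix (Fin m) (Fin m) ℂ}
    (hA : A ∈ Matrix.unitaryGroup (Fin m) ℂ) (hD : D ∈ Matrix.unitaryGroup (Fin m) ℂ) :
    ‖A * X * D‖ ≤ ‖X‖ :=
  (norm_mul_le_of_le_one_right _ (norm_unitary_le hD)).trans
    (norm_mul_le_of_le_one_left (norm_unitary_le hA) _)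

/-- A core transformation is passed through a descending sequence from right to left. -/
lemma prodMat_pass_left {k i : ℕ} (hi : i + 2 ≤ k) (hk : k + 1 ≤ m) (hG : ∀ j, (G j).IsUnitary)
    (hG' : ∀ j, j ≠ i → j ≠ i + 1 → G' j = G j) {M M' : Core} {δ : ℝ}
    (h : ‖toMat m i (G i) * toMat m (i + 1) (G (i + 1)) * toMat m i M -
      toMat m (i + 1) M' * toMat m i (G' i) * toMat m (i + 1) (G' (i + 1))‖ ≤ δ) :
    ‖prodMat m k G * toMat m i M - toMat m (i + 1) M' * prodMat m k G'‖ ≤ δ := by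
  rw [prodMat_split_two (G := G) hi, prodMat_split_two (G := G') hi,
    segMat_congr (G := G') (G' := G) (i := 0) (fun j h1 h2 => hG' j (by omega) (by omega)),
    segMat_congr (G := G') (G' := G) (i := i + 2) (fun j h1 h2 => hG' j (by omega) (by omega))]
  set A := segMat m 0 i G with hA
  set D := segMat m (i + 2) (k - (i + 2)) G with hD
  have cD : D * toMat m i M = toMat m i M * D := segMat_commute (by omega) _
  have cA : A * toMat m (i + 1) M' = toMat m (i + 1) M' * A := segMat_commute (by omega) _
  have uA : A ∈ Matrix.unitaryGroup (Fin m) ℂ := segMat_unitary (by omega) fun j _ _ => hG j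
  have uD : D ∈ Matrix.unitaryGroup (Fin m) ℂ := segMat_unitary (by omega) fun j _ _ => hG j
  refine le_trans (le_of_eq ?_) ((norm_conj_segMat_le uA uD).trans h)
  congr 1
  rw [Matrix.mul_sub, Matrix.sub_mul]
  congr 1
  · simp only [Matrix.mul_assoc, cD]
  · simp only [← Matrix.mul_assoc, cA]

/-- A core transformation is passed through a descending sequence from left to right. -/
lemma prodMat_pass_right {k i : ℕ} (hi : i + 2 ≤ k) (hk : k + 1 ≤ m) (hG : ∀ j, (G j).IsUnitary)
    (hG' : ∀ j, j ≠ i → j ≠ i + 1 → G' j = G j) {M M' : Core} {δ : ℝ}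
    (h : ‖toMat m (i + 1) M * toMat m i (G i) * toMat m (i + 1) (G (i + 1)) -
      toMat m i (G' i) * toMat m (i + 1) (G' (i + 1)) * toMat m i M'‖ ≤ δ) :
    ‖toMat m (i + 1) M * prodMat m k G - prodMat m k G' * toMat m i M'‖ ≤ δ := by
  rw [prodMat_split_two (G := G) hi, prodMat_split_two (G := G') hi,
    segMat_congr (G := G') (G' := G) (i := 0) (fun j h1 h2 => hG' j (by omega) (by omega)),
    segMat_congr (G := G') (G' := G) (i := i + 2) (fun j h1 h2 => hG' j (by omega) (by omega))]
  set A := segMat m 0 i G with hA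
  set D := segMat m (i + 2) (k - (i + 2)) G with hD
  have cD : D * toMat m i M' = toMat m i M' * D := segMat_commute (by omega) _
  have cA : A * toMat m (i + 1) M = toMat m (i + 1) M * A := segMat_commute (by omega) _
  have uA : A ∈ Matrix.unitaryGroup (Fin m) ℂ := segMat_unitary (by omega) fun j _ _ => hG j
  have uD : D ∈ Matrix.unitaryGroup (Fin m) ℂ := segMat_unitary (by omega) fun j _ _ => hG j
  refine le_trans (le_of_eq ?_) ((norm_conj_segMat_le uA uD).trans h)
  congr 1
  rw [Matrix.mul_sub, Matrix.sub_mul]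
  congr 1
  · simp only [← Matrix.mul_assoc, cA]
  · simp only [Matrix.mul_assoc, cD]

/-- One core of a descending sequence is replaced by a nearby one. -/
lemma prodMat_replace {k i : ℕ} (hi : i + 1 ≤ k) (hk : k + 1 ≤ m) (hG : ∀ j, (G j).IsUnitary)
    (hG' : ∀ j, j ≠ i → G' j = G j) {δ : ℝ} (h : ‖toMat m i (G' i) - toMat m i (G i)‖ ≤ δ) :
    ‖prodMat m k G' - prodMat m k G‖ ≤ δ := by
  rw [prodMat_split_one (G := G) hi, prodMat_split_one (G := G') hi,
    segMat_congr (G := G') (G' := G) (i := 0) (fun j h1 h2 => hG' j (by omega)),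
    segMat_congr (G := G') (G' := G) (i := i + 1) (fun j h1 h2 => hG' j (by omega))]
  rw [← Matrix.sub_mul, ← Matrix.mul_sub]
  exact (norm_conj_segMat_le (segMat_unitary (by omega) fun j _ _ => hG j)
    (segMat_unitary (by omega) fun j _ _ => hG j)).trans h

end Core

open CompanionQZ.Core

/-! ### Passing a core through a deflated core -/

namespace Core

/-- A core `q` with zero sine is diagonal; a core in the next position passes through it with its
sine multiplied by a phase. -/
lemma toMat_diag_mul_left {m i : ℕ} (hi : i + 3 ≤ m) {q : Core} (hq : q.IsUnitary) (hs : q.s = 0)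
    (c s : ℂ) (e : ℤˣ) : toMat m (i + 1) ⟨c, s, e⟩ * toMat m i q =
      toMat m i q * toMat m (i + 1) ⟨c, s * (q.ε * conj q.c), e⟩ := by
  have h3 : toMat 3 1 ⟨c, s, e⟩ * toMat 3 0 q =
      toMat 3 0 q * toMat 3 1 ⟨c, s * (q.ε * conj q.c), e⟩ := by
    have h := hq.mul_conj
    have h1 := sign_mul_self q.ε
    have h2 := conj_sign q.ε
    rw [hs, zero_mul, add_zero] at h
    rw [toMat_three_zero, toMat_three_one, toMat_three_one]
    ext a b
    fin_cases a <;> fin_cases b <;> simp [Matrix.mul_apply, Fin.sum_univ_three, hs] <;> try ring1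
    linear_combination (-(e : ℂ) * conj s) * h - (e : ℂ) * conj s * (q.c * conj q.c) * h1
  have J := incl_isometry hi
  have eq' := congrArg (emb (incl m 3 i)) h3
  rw [emb_mul J, emb_mul J] at eq'
  simpa only [← toMat_add_eq_emb (i := i) (m := m) (show 0 + 2 ≤ 3 by norm_num),
    ← toMat_add_eq_emb (i := i) (m := m) (show 1 + 2 ≤ 3 by norm_num), add_zero] using eq'

/-- As `toMat_diag_mul_left`, with the diagonal core in the later position. -/
lemma toMat_diag_mul_right {m i : ℕ} (hi : i + 3 ≤ m) {q : Core} (hq : q.IsUnitary) (hs : q.s = 0)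
    (c s : ℂ) (e : ℤˣ) : toMat m (i + 1) q * toMat m i ⟨c, s, e⟩ =
      toMat m i ⟨c, s * q.c, e⟩ * toMat m (i + 1) q := by
  have h3 : toMat 3 1 q * toMat 3 0 ⟨c, s, e⟩ = toMat 3 0 ⟨c, s * q.c, e⟩ * toMat 3 1 q := by
    have h := hq.mul_conj
    rw [hs, zero_mul, add_zero] at h
    rw [toMat_three_zero, toMat_three_zero, toMat_three_one]
    ext a b
    fin_cases a <;> fin_cases b <;> simp [Matrix.mul_apply, Fin.sum_univ_three, hs] <;> try ring1
    linear_combination (-(e : ℂ) * conj s) * h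
  have J := incl_isometry hi
  have eq' := congrArg (emb (incl m 3 i)) h3
  rw [emb_mul J, emb_mul J] at eq'
  simpa only [← toMat_add_eq_emb (i := i) (m := m) (show 0 + 2 ≤ 3 by norm_num),
    ← toMat_add_eq_emb (i := i) (m := m) (show 1 + 2 ≤ 3 by norm_num), add_zero] using eq'

/-- The product of the exactly unitary cores that a stored descending sequence stands for. -/
noncomputable def unitProd (m k : ℕ) (G : ℕ → Core) : Matrix (Fin m) (Fin m) ℂ :=
  prodMat m k fun j => (G j).exactUnit

/-- All cores of the sequence are unitary up to a fixed multiple of the unit roundoff `u`. -/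
def AllNear (u : ℝ) (G : ℕ → Core) : Prop := ∀ j, NearUnit (11 * u) (G j)

lemma AllNear.update {u : ℝ} {G : ℕ → Core} (h : AllNear u G) {i : ℕ} {g : Core}
    (hg : NearUnit (11 * u) g) : AllNear u (Function.update G i g) := by
  intro j
  by_cases hj : j = i
  · subst hj; simpa using hg
  · simpa [Function.update_of_ne hj] using h j

lemma AllNear.isUnitary {u : ℝ} {G : ℕ → Core} (h : AllNear u G) (hu1 : u ≤ 1 / 1000000000000)
    (j : ℕ) : (G j).exactUnit.IsUnitary :=
  (h j).exactUnit_isUnitary (by linarith)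

end Core

namespace FloatArith

variable {u : ℝ} (fl : FloatArith u)

/-- Multiplication of the sine by a computed phase. -/
lemma close_phase (hu1 : u ≤ 1 / 1000000000000) {g : Core} (hg : NearUnit (11 * u) g) {d δ : ℂ}
    (hd : RelErr (11 * u) d δ) (hδ : ‖δ‖ = 1) :
    Close (100 * u) ⟨g.c, fl.cmul g.s d, g.ε⟩ ⟨g.exactUnit.c, g.exactUnit.s * δ, g.ε⟩ ∧
    IsUnitary ⟨g.exactUnit.c, g.exactUnit.s * δ, g.ε⟩ := by
  have hu := fl.u_nonneg
  have U := hg.exactUnit_isUnitary (by linarith)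
  have R := hg.relClose (by linarith)
  have U' : IsUnitary ⟨g.exactUnit.c, g.exactUnit.s * δ, g.ε⟩ := by
    unfold IsUnitary at *
    simpa only [norm_mul, hδ, mul_one] using U
  refine ⟨⟨rfl, (R.2.1.abs_le (by norm_num) hu U.norm_c_le).trans (by linarith), ?_⟩, U'⟩
  exact ((fl.cmul_rel R.2.2 hd (by norm_num) (by norm_num) (by norm_num) (by norm_num) hu1).abs_le
    (by norm_num) hu U'.norm_s_le).trans (by linarith)

lemma exactUnit_diag (hu1 : u ≤ 1 / 1000000000000) {q : Core} (hq : NearUnit (11 * u) q)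
    (hs : q.s = 0) : q.exactUnit.s = 0 ∧ ‖q.exactUnit.c‖ = 1 := by
  have U := hq.exactUnit_isUnitary (by linarith)
  have R := hq.relClose (by linarith)
  have z := (R.2.2.eq_zero_iff (by linarith)).1 hs
  refine ⟨z, ?_⟩
  unfold IsUnitary at U
  rw [z, norm_zero] at U
  nlinarith [norm_nonneg q.exactUnit.c]

/-- The fusion of `g*` with `Q l` at the start of an iteration, through a deflated core. -/
lemma fuse_start (hu1 : u ≤ 1 / 1000000000000) {n l : ℕ} (hl : l + 1 < n) {Q : ℕ → Core}
    (hQ : AllNear u Q) {g : Core} (hg : NearUnit (11 * u) g) (hε : g.ε = 1)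
    (h0 : l = 0 ∨ (Q (l - 1)).s = 0) {d : ℂ}
    (hd : d = if l = 0 then 1 else ((Q (l - 1)).ε : ℂ) * conj (Q (l - 1)).c) {f : Core}
    (hf : f = fuse fl (adj ⟨g.c, fl.cmul g.s d, 1⟩) (Q l)) :
    NearUnit (11 * u) f ∧
    ‖unitProd n (n - 1) (Function.update Q l f) -
      (toMat n l g.exactUnit)ᴴ * unitProd n (n - 1) Q‖ ≤ 400000 * u := by
  have hu := fl.u_nonneg
  have ug := hg.exactUnit_isUnitary (by linarith)
  have uQ := hQ.isUnitary hu1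
  obtain ⟨δ, hδ, hdδ, hpass⟩ : ∃ δ : ℂ, ‖δ‖ = 1 ∧ RelErr (11 * u) d δ ∧
      toMat n l g.exactUnit * segMat n 0 l (fun j => (Q j).exactUnit) =
      segMat n 0 l (fun j => (Q j).exactUnit) *
        toMat n l ⟨g.exactUnit.c, g.exactUnit.s * δ, g.ε⟩ := by
    rcases Nat.eq_zero_or_pos l with rfl | hpos
    · refine ⟨1, by simp, ?_, ?_⟩
      · rw [hd, if_pos rfl]; exact RelErr.refl (by positivity) _
      · rw [segMat_zero, mul_one, mul_one, one_mul]; rfl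
    · obtain ⟨j, rfl⟩ : ∃ j, l = j + 1 := ⟨l - 1, by omega⟩
      have hs : (Q j).s = 0 := by simpa using h0
      obtain ⟨z, hz⟩ := exactUnit_diag hu1 (hQ j) hs
      refine ⟨(Q j).exactUnit.ε * conj (Q j).exactUnit.c, ?_, ?_, ?_⟩
      · rw [norm_mul, norm_sign, one_mul, RCLike.norm_conj, hz]
      · rw [hd, if_neg (by omega)]
        exact ((hQ j).relClose (by linarith)).2.1.star.const_mul _
      · have c1 := segMat_commute (m := n) (G := fun j => (Q j).exactUnit) (i := 0) (k := j)
          (j := j + 1) (by omega) g.exactUnit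
        have c2 := toMat_diag_mul_left (m := n) (i := j) (by omega) (uQ j) z g.exactUnit.c
          g.exactUnit.s g.ε
        rw [segMat_succ, zero_add, ← Matrix.mul_assoc, ← c1, Matrix.mul_assoc, Matrix.mul_assoc,
          ← c2]
        rfl
  obtain ⟨cl, uĝ⟩ := fl.close_phase hu1 hg hdδ hδ
  set ĝ : Core := ⟨g.exactUnit.c, g.exactUnit.s * δ, g.ε⟩ with hĝ
  rw [← hε] at hf
  obtain ⟨F₁, F₂⟩ := fl.fuse_stable hu1 cl.adj
    ((((hQ l).relClose (by linarith)).close (uQ l) (by positivity)).mono (by linarith)) uĝ.adj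
    (uQ l)
  rw [← hf] at F₁ F₂
  refine ⟨F₁, ?_⟩
  have hpass' : (toMat n l g.exactUnit)ᴴ * segMat n 0 l (fun j => (Q j).exactUnit) =
      segMat n 0 l (fun j => (Q j).exactUnit) * (toMat n l ĝ)ᴴ := by
    have e1 : (toMat n l g.exactUnit)ᴴ * toMat n l g.exactUnit = 1 :=
      Matrix.mem_unitaryGroup_iff'.1 (toMat_unitary (by omega) ug)
    have e2 : toMat n l ĝ * (toMat n l ĝ)ᴴ = 1 :=
      Matrix.mem_unitaryGroup_iff.1 (toMat_unitary (by omega) uĝ)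
    calc _ = (toMat n l g.exactUnit)ᴴ * (segMat n 0 l (fun j => (Q j).exactUnit) *
          toMat n l ĝ) * (toMat n l ĝ)ᴴ := by
            rw [Matrix.mul_assoc, Matrix.mul_assoc, e2, Matrix.mul_one]
      _ = _ := by rw [← hpass, ← Matrix.mul_assoc, e1, Matrix.one_mul]
  set G' : ℕ → Core := Function.update (fun j => (Q j).exactUnit) l (ĝ.adj.mul (Q l).exactUnit)
    with hG'
  have uG' : ∀ j, (G' j).IsUnitary := by
    intro j
    by_cases hj : j = l
    · subst hj
      simpa [hG'] using uĝ.adj.mul (uQ j)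
    · simpa [hG', Function.update_of_ne hj] using uQ j
  have hmid : (toMat n l g.exactUnit)ᴴ * unitProd n (n - 1) Q = prodMat n (n - 1) G' := by
    rw [unitProd, prodMat_split_one (i := l) (by omega), prodMat_split_one (G := G') (i := l)
      (by omega), segMat_congr (G := G') (G' := fun j => (Q j).exactUnit) (i := 0)
      (fun j h1 h2 => by simp [hG', Function.update_of_ne (show j ≠ l by omega)]),
      segMat_congr (G := G') (G' := fun j => (Q j).exactUnit) (i := l + 1)
      (fun j h1 h2 => by simp [hG', Function.update_of_ne (show j ≠ l by omega)]),
      ← Matrix.mul_assoc, ← Matrix.mul_assoc, hpass']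
    simp only [hG', Function.update_self, toMat_mul (show l + 2 ≤ n by omega), toMat_adj,
      Matrix.mul_assoc]
  rw [hmid]
  refine prodMat_replace (i := l) (by omega) (by omega) uG' (fun j hj => ?_) ?_
  · simp [hG', Function.update_of_ne hj]
  · simp only [hG', Function.update_self]
    exact ((F₁.close_of_close F₂ hu hu1).norm_toMat_sub_le (by omega)).trans (by linarith)

/-- The fusion of the misfit with `Q i` at the end of an iteration, through a deflated core. -/
lemma fuse_end (hu1 : u ≤ 1 / 1000000000000) {n i : ℕ} (hi : i + 1 < n) {Q : ℕ → Core}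
    (hQ : AllNear u Q) {x : Core} (hx : NearUnit (11 * u) x) {p : ℂ}
    (hp : (p = 1 ∧ i + 2 = n) ∨ (p = (Q (i + 1)).c ∧ (Q (i + 1)).s = 0 ∧ i + 2 < n)) {f : Core}
    (hf : f = fuse fl (Q i) ⟨x.c, fl.cmul x.s p, x.ε⟩) :
    NearUnit (11 * u) f ∧
    ‖unitProd n (n - 1) (Function.update Q i f) -
      unitProd n (n - 1) Q * toMat n i x.exactUnit‖ ≤ 400000 * u := by
  have hu := fl.u_nonneg
  have ux := hx.exactUnit_isUnitary (by linarith)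
  have uQ := hQ.isUnitary hu1
  obtain ⟨δ, hδ, hdδ, hpass⟩ : ∃ δ : ℂ, ‖δ‖ = 1 ∧ RelErr (11 * u) p δ ∧
      segMat n (i + 1) (n - 1 - (i + 1)) (fun j => (Q j).exactUnit) * toMat n i x.exactUnit =
      toMat n i ⟨x.exactUnit.c, x.exactUnit.s * δ, x.ε⟩ *
        segMat n (i + 1) (n - 1 - (i + 1)) (fun j => (Q j).exactUnit) := by
    rcases hp with ⟨rfl, hn⟩ | ⟨rfl, hs, hn⟩
    · refine ⟨1, by simp, RelErr.refl (by positivity) _, ?_⟩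
      rw [show n - 1 - (i + 1) = 0 by omega, segMat_zero, mul_one, mul_one, one_mul]
      rfl
    · obtain ⟨z, hz⟩ := exactUnit_diag hu1 (hQ (i + 1)) hs
      refine ⟨(Q (i + 1)).exactUnit.c, hz, ((hQ (i + 1)).relClose (by linarith)).2.1, ?_⟩
      have c1 := segMat_commute (m := n) (G := fun j => (Q j).exactUnit) (i := i + 2)
        (k := n - 1 - (i + 2)) (j := i) (by omega) x.exactUnit
      have c2 := toMat_diag_mul_right (m := n) (i := i) (by omega) (uQ (i + 1)) z x.exactUnit.c
          x.exactUnit.s x.ε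
      rw [show n - 1 - (i + 1) = (n - 1 - (i + 2)) + 1 by omega, segMat_succ', Matrix.mul_assoc,
        c1, ← Matrix.mul_assoc, ← Matrix.mul_assoc, ← c2]
      rfl
  obtain ⟨cl, ux'⟩ := fl.close_phase hu1 hx hdδ hδ
  set y : Core := ⟨x.exactUnit.c, x.exactUnit.s * δ, x.ε⟩ with hy
  obtain ⟨F₁, F₂⟩ := fl.fuse_stable hu1
    ((((hQ i).relClose (by linarith)).close (uQ i) (by positivity)).mono (by linarith)) cl
    (uQ i) ux'
  rw [← hf] at F₁ F₂
  refine ⟨F₁, ?_⟩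
  set G' : ℕ → Core := Function.update (fun j => (Q j).exactUnit) i ((Q i).exactUnit.mul y)
    with hG'
  have uG' : ∀ j, (G' j).IsUnitary := by
    intro j
    by_cases hj : j = i
    · subst hj
      simpa [hG'] using (uQ j).mul ux'
    · simpa [hG', Function.update_of_ne hj] using uQ j
  have hmid : unitProd n (n - 1) Q * toMat n i x.exactUnit = prodMat n (n - 1) G' := by
    rw [unitProd, prodMat_split_one (i := i) (by omega), prodMat_split_one (G := G') (i := i)
      (by omega), segMat_congr (G := G') (G' := fun j => (Q j).exactUnit) (i := 0)
      (fun j h1 h2 => by simp [hG', Function.update_of_ne (show j ≠ i by omega)]),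
      segMat_congr (G := G') (G' := fun j => (Q j).exactUnit) (i := i + 1)
      (fun j h1 h2 => by simp [hG', Function.update_of_ne (show j ≠ i by omega)]),
      Matrix.mul_assoc, hpass]
    simp only [hG', Function.update_self, toMat_mul (show i + 2 ≤ n by omega),
      Matrix.mul_assoc]
  rw [hmid]
  refine prodMat_replace (i := i) (by omega) (by omega) uG' (fun j hj => ?_) ?_
  · simp [hG', Function.update_of_ne hj]
  · simp only [hG', Function.update_self]
    exact ((F₁.close_of_close F₂ hu hu1).norm_toMat_sub_le (by omega)).trans (by linarith)

/-- Setting a negligible sine to zero. -/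
lemma deflate_stable (hu1 : u ≤ 1 / 1000000000000) {n i : ℕ} (hi : i + 1 < n) {Q : ℕ → Core}
    (hQ : AllNear u Q) (hs : ‖(Q i).s‖ ≤ u) {f : Core}
    (hf : f = ⟨(fl.normalize (Q i).c 0).1, 0, (Q i).ε⟩) :
    NearUnit (11 * u) f ∧
    ‖unitProd n (n - 1) (Function.update Q i f) - unitProd n (n - 1) Q‖ ≤ 400000 * u := by
  have hu := fl.u_nonneg
  have uQ := hQ.isUnitary hu1
  have R := (hQ i).relClose (by linarith)
  have hc0 : (Q i).c ≠ 0 := by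
    intro h
    have z := (R.2.1.eq_zero_iff (by linarith)).1 h
    have U := uQ i
    unfold IsUnitary at U
    rw [z, norm_zero] at U
    have h1 := R.2.2.le_norm
    have h2 : ‖(Q i).exactUnit.s‖ = 1 := by nlinarith [norm_nonneg (Q i).exactUnit.s]
    rw [h2] at h1
    linarith
  have h0 : ¬((Q i).c = 0 ∧ (0 : ℂ) = 0) := fun h => hc0 h.1
  have N1 := fl.normalize_fst_relErr (by linarith) (Q i).c 0 h0
  have N2 := fl.normalize_snd_relErr (by linarith) (Q i).c 0 h0
  rw [zero_div] at N2
  have N2' := (N2.eq_zero_iff (by linarith)).2 rfl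
  have F₁ : NearUnit (11 * u) f := by
    have := fl.normalize_nearUnit (by linarith) (Q i).c 0 (Q i).ε
    rw [N2'] at this
    rwa [hf]
  refine ⟨F₁, ?_⟩
  -- both `f` and `Q i` are close to the core with entries `c / |c|` and `0`
  have hn : ‖((Q i).c / (√(‖(Q i).c‖ ^ 2 + ‖(0 : ℂ)‖ ^ 2) : ℝ) : ℂ)‖ = 1 := by
    have := sqrt_div_hypot (Q i).c 0 h0
    rw [Real.sqrt_eq_one, zero_div] at this
    set w := ((Q i).c / (√(‖(Q i).c‖ ^ 2 + ‖(0 : ℂ)‖ ^ 2) : ℝ) : ℂ)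
    rw [norm_zero] at this
    nlinarith [norm_nonneg w]
  have hsq : √(‖(Q i).c‖ ^ 2 + ‖(0 : ℂ)‖ ^ 2) = ‖(Q i).c‖ := by
    rw [norm_zero]; simp
  have hcn : |‖(Q i).c‖ - 1| ≤ 20 * u := by
    have h1 := (abs_le.1 (hQ i))
    have h2 : ‖(Q i).c‖ ≤ (Q i).size := by
      apply Real.le_sqrt_of_sq_le
      nlinarith [sq_nonneg ‖(Q i).s‖]
    have h3 : (Q i).size ≤ ‖(Q i).c‖ + ‖(Q i).s‖ := by
      apply Real.sqrt_le_iff.2 ⟨by positivity, ?_⟩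
      nlinarith [norm_nonneg (Q i).c, norm_nonneg (Q i).s]
    rw [abs_le]
    constructor <;> linarith [h1.1, h1.2]
  have C : Close (100 * u) (Q i) f := by
    rw [hf]
    refine ⟨rfl, ?_, ?_⟩
    · have a1 := N1.abs_le (by norm_num) hu hn.le
      have a2 : ‖(Q i).c - (Q i).c / (√(‖(Q i).c‖ ^ 2 + ‖(0 : ℂ)‖ ^ 2) : ℝ)‖ ≤ 20 * u := by
        rw [hsq] at hn ⊢
        have hn0 : (‖(Q i).c‖ : ℂ) ≠ 0 := by
          have : ‖(Q i).c‖ ≠ 0 := by simpa using hc0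
          exact_mod_cast this
        have e : (Q i).c - (Q i).c / (‖(Q i).c‖ : ℂ) =
            (Q i).c / (‖(Q i).c‖ : ℂ) * ((‖(Q i).c‖ - 1 : ℝ) : ℂ) := by
          push_cast
          field_simp
        rw [e, norm_mul, hn, one_mul, Complex.norm_real]
        exact hcn
      rw [norm_sub_rev] at a1
      exact (norm_sub_le_norm_sub_add_norm_sub _ _ _).trans ((add_le_add a2 a1).trans
        (by linarith))
    · simpa using hs.trans (by linarith)
  have cf := (F₁.relClose (by linarith)).close (F₁.exactUnit_isUnitary (by linarith))
    (by positivity)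
  refine prodMat_replace (i := i) (by omega) (by omega) uQ (fun j hj => ?_) ?_
  · simp [Function.update_of_ne hj]
  · simp only [Function.update_self]
    have := ((hQ i).close_of_close (C.trans cf |>.mono (show _ ≤ (200 : ℝ) * u by linarith))
      hu hu1).symm.norm_toMat_sub_le (m := n) (i := i) (by omega)
    exact this.trans (by linarith)

end FloatArith

/-! ### Transformation of the factored triangular matrices -/

/-- An `n × n` matrix extended to size `n + 1` by a last unit row and column. -/
noncomputable def extend {n : ℕ} (A : Matrix (Fin n) (Fin n) ℂ) :
    Matrix (Fin (n + 1)) (Fin (n + 1)) ℂ :=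
  emb (incl (n + 1) n 0) A

/-- The matrix `e₁ eₙ₊₁ᵀ`. -/
noncomputable def corner (n : ℕ) : Matrix (Fin (n + 1)) (Fin (n + 1)) ℂ :=
  Matrix.single 0 (Fin.last n) 1

section Extend

variable {n : ℕ}

lemma incl_succ_isometry : (incl (n + 1) n 0)ᴴ * incl (n + 1) n 0 = 1 :=
  incl_isometry (by omega)

lemma extend_mul (A B : Matrix (Fin n) (Fin n) ℂ) : extend (A * B) = extend A * extend B :=
  emb_mul incl_succ_isometry A B

lemma extend_one : extend (1 : Matrix (Fin n) (Fin n) ℂ) = 1 := emb_one _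

lemma extend_conjTranspose (A : Matrix (Fin n) (Fin n) ℂ) : extend Aᴴ = (extend A)ᴴ :=
  emb_conjTranspose _ _

lemma extend_unitary {A : Matrix (Fin n) (Fin n) ℂ} (hA : A ∈ Matrix.unitaryGroup (Fin n) ℂ) :
    extend A ∈ Matrix.unitaryGroup (Fin (n + 1)) ℂ :=
  emb_unitary incl_succ_isometry hA

lemma extend_toMat {i : ℕ} (hi : i + 2 ≤ n) (g : Core) :
    extend (toMat n i g) = toMat (n + 1) i g := by
  rw [extend, ← toMat_add_eq_emb hi, zero_add]

lemma corner_mul_extend (A : Matrix (Fin n) (Fin n) ℂ) : corner n * extend A = corner n := by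
  have h : corner n * incl (n + 1) n 0 = 0 := by
    ext r k
    simp only [corner, Matrix.mul_apply, incl, Matrix.of_apply, Matrix.zero_apply]
    refine Finset.sum_eq_zero fun x _ => ?_
    by_cases hx : x = Fin.last n
    · rw [if_neg, mul_zero]
      rw [hx, Fin.val_last]
      omega
    · rw [Matrix.single_apply_of_col_ne _ _ (Ne.symm hx), zero_mul]
  rw [extend, emb, Matrix.mul_add, ← Matrix.mul_assoc, ← Matrix.mul_assoc, h]
  simp

lemma toMat_mul_corner {i : ℕ} (hi : 1 ≤ i) (g : Core) :
    toMat (n + 1) i g * corner n = corner n := by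
  have h : (incl (n + 1) 2 i)ᴴ * corner n = 0 := by
    ext r k
    simp only [corner, Matrix.mul_apply, incl, Matrix.of_apply, Matrix.zero_apply,
      Matrix.conjTranspose_apply]
    refine Finset.sum_eq_zero fun x _ => ?_
    by_cases hx : x = 0
    · rw [if_neg, star_zero, zero_mul]
      rw [hx, Fin.val_zero]
      omega
    · rw [Matrix.single_apply_of_row_ne (Ne.symm hx), mul_zero]
  rw [toMat_eq_emb, emb, Matrix.add_mul, Matrix.mul_assoc _ _ (corner n), h]
  simp

end Extend

/-- The sequences `A`, `B` represent, up to errors `δ`, the matrices `Xᴴ A₀ (L ⊕ 1)` and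
`Xᴴ B₀ (R ⊕ 1)` for a unitary matrix `X` that fixes the first unit vector, where `A₀`, `B₀` are
the matrices represented initially. -/
def PairTracks {n : ℕ} (δ : ℝ) (A₀ B₀ A B : ℕ → Core) (L R : Matrix (Fin n) (Fin n) ℂ) : Prop :=
  ∃ X ∈ Matrix.unitaryGroup (Fin (n + 1)) ℂ, X * corner n = corner n ∧
    ‖unitProd (n + 1) n A - Xᴴ * unitProd (n + 1) n A₀ * extend L‖ ≤ δ ∧
    ‖unitProd (n + 1) n B - Xᴴ * unitProd (n + 1) n B₀ * extend R‖ ≤ δ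

/-- The signs of `C` are those of `C₀`, and the product of the sines is that of `C₀` up to `N`
relative errors. -/
def SineTracks (n : ℕ) (u : ℝ) (N : ℕ) (C₀ C : ℕ → Core) : Prop :=
  (∀ j, (C j).ε = (C₀ j).ε) ∧
    RelErr ((1 + 20000 * u) ^ N - 1) (∏ j ∈ Finset.range n, (C j).s)
      (∏ j ∈ Finset.range n, (C₀ j).s)

lemma prod_range_split {k i : ℕ} (hi : i + 2 ≤ k) (f : ℕ → ℂ) :
    ∏ j ∈ Finset.range k, f j = f i * f (i + 1) *
      ∏ j ∈ ((Finset.range k).erase i).erase (i + 1), f j := by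
  rw [mul_assoc, Finset.mul_prod_erase _ _ (by simp; omega),
    Finset.mul_prod_erase _ _ (by simp; omega)]

lemma RelErr.one_add_mul {F : Type*} [NormedField F] {x y z : F} {a b : ℝ}
    (h : RelErr (a - 1) x y) (h' : RelErr (b - 1) y z) (ha : 1 ≤ a) :
    RelErr (a * b - 1) x z := by
  have h1 : ‖x - y‖ ≤ (a - 1) * ‖y‖ := h
  have h2 : ‖y - z‖ ≤ (b - 1) * ‖z‖ := h'
  have h3 := h'.norm_le
  have h4 : ‖x - z‖ ≤ ‖x - y‖ + ‖y - z‖ := norm_sub_le_norm_sub_add_norm_sub x y z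
  have h5 : (a - 1) * ‖y‖ ≤ (a - 1) * ((1 + (b - 1)) * ‖z‖) :=
    mul_le_mul_of_nonneg_left h3 (by linarith)
  unfold RelErr
  nlinarith

/-- A turnover costs one relative error in the product of the sines. -/
lemma SineTracks.step {n : ℕ} {u : ℝ} (hu : 0 ≤ u) {N : ℕ} {C₀ C : ℕ → Core}
    (h : SineTracks n u N C₀ C) {i : ℕ} (hi : i + 2 ≤ n) {g g' : Core} (hg : g.ε = (C i).ε)
    (hg' : g'.ε = (C (i + 1)).ε) (hs : RelErr (20000 * u) (g.s * g'.s) ((C i).s * (C (i + 1)).s)) :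
    SineTracks n u (N + 1) C₀ (Function.update (Function.update C i g) (i + 1) g') := by
  constructor
  · intro j
    rw [← h.1 j]
    by_cases h1 : j = i + 1
    · subst h1; simpa using hg'
    · by_cases h2 : j = i
      · subst h2; simpa [Function.update_of_ne h1] using hg
      · simp [Function.update_of_ne h1, Function.update_of_ne h2]
  · have e : RelErr (1 + 20000 * u - 1)
        (∏ j ∈ Finset.range n, (Function.update (Function.update C i g) (i + 1) g' j).s)
        (∏ j ∈ Finset.range n, (C j).s) := by
      rw [prod_range_split hi, prod_range_split hi fun j => (C j).s,
        Finset.prod_congr (g := fun j => (C j).s) rfl]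
      · have hne : i ≠ i + 1 := by omega
        have := hs.const_mul (∏ j ∈ ((Finset.range n).erase i).erase (i + 1), (C j).s)
        rw [mul_comm (∏ j ∈ ((Finset.range n).erase i).erase (i + 1), (C j).s),
          mul_comm (∏ j ∈ ((Finset.range n).erase i).erase (i + 1), (C j).s)] at this
        simpa [Function.update_of_ne hne] using this
      · intro j hj
        simp only [Finset.mem_erase] at hj
        rw [Function.update_of_ne hj.1, Function.update_of_ne hj.2.1]
    rw [pow_succ']
    exact e.one_add_mul h.2 (by linarith)

namespace FloatArith

variable {u : ℝ} (fl : FloatArith u)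

/-- A core `g` is passed through the sequence `A` by a turnover, and the resulting core through the
sequence `B` by a turnover in the other direction. -/
lemma pairTracks_step (hu1 : u ≤ 1 / 1000000000000) {n : ℕ} {δ : ℝ} {A₀ B₀ A B : ℕ → Core}
    {L R : Matrix (Fin n) (Fin n) ℂ} (h : PairTracks δ A₀ B₀ A B L R) (hA : AllNear u A)
    (hB : AllNear u B) {g : Core} (hg : NearUnit (11 * u) g) {i : ℕ} (hi : i + 1 < n)
    {s t : Core × Core × Core} (hs : s = turnover fl (A i) (A (i + 1)) g)
    (ht : t = turnoverLR fl s.1.adj (B i) (B (i + 1))) :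
    PairTracks (δ + 400000 * u) A₀ B₀
      (Function.update (Function.update A i s.2.1) (i + 1) s.2.2)
      (Function.update (Function.update B i t.1) (i + 1) t.2.1)
      (L * toMat n i g.exactUnit) (R * toMat n i t.2.2.adj.exactUnit) ∧
    AllNear u (Function.update (Function.update A i s.2.1) (i + 1) s.2.2) ∧
    AllNear u (Function.update (Function.update B i t.1) (i + 1) t.2.1) ∧
    NearUnit (11 * u) t.2.2.adj := by
  have hu := fl.u_nonneg
  obtain ⟨X, uX, hX, e₁, e₂⟩ := h
  obtain ⟨⟨a₁, a₂, a₃⟩, -⟩ := fl.turnover_stable hu1 (hA i) (hA (i + 1)) hg hs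
  obtain ⟨⟨b₁, b₂, b₃⟩, -⟩ := fl.turnoverLR_stable hu1 (hB i) (hB (i + 1)) a₁.adj ht
  have mA := fl.turnover_matrix hu1 (hA i) (hA (i + 1)) hg hs (m := n + 1) (i := i) (by omega)
  have mB := fl.turnoverLR_matrix hu1 (hB i) (hB (i + 1)) a₁.adj ht (m := n + 1) (i := i)
    (by omega)
  set A' := Function.update (Function.update A i s.2.1) (i + 1) s.2.2 with hA'
  set B' := Function.update (Function.update B i t.1) (i + 1) t.2.1 with hB'
  have nA' : AllNear u A' := (hA.update a₂).update a₃
  have nB' : AllNear u B' := (hB.update b₁).update b₂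
  have hne : i ≠ i + 1 := by omega
  have pA : ‖unitProd (n + 1) n A * toMat (n + 1) i g.exactUnit -
      toMat (n + 1) (i + 1) s.1.exactUnit * unitProd (n + 1) n A'‖ ≤ 400000 * u := by
    refine prodMat_pass_left (by omega) le_rfl (hA.isUnitary hu1) (fun j h1 h2 => ?_) ?_
    · simp [hA', Function.update_of_ne h1, Function.update_of_ne h2]
    · simpa [hA', Function.update_of_ne hne] using mA
  have pB : ‖toMat (n + 1) (i + 1) s.1.adj.exactUnit * unitProd (n + 1) n B -
      unitProd (n + 1) n B' * toMat (n + 1) i t.2.2.exactUnit‖ ≤ 400000 * u := by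
    refine prodMat_pass_right (by omega) le_rfl (hB.isUnitary hu1) (fun j h1 h2 => ?_) ?_
    · simp [hB', Function.update_of_ne h1, Function.update_of_ne h2]
    · simpa [hB', Function.update_of_ne hne] using mB
  refine ⟨⟨X * toMat (n + 1) (i + 1) s.1.exactUnit, ?_, ?_, ?_, ?_⟩, nA', nB', b₃.adj⟩
  · exact mul_mem uX (toMat_unitary (by omega) (a₁.exactUnit_isUnitary (by linarith)))
  · rw [Matrix.mul_assoc, toMat_mul_corner (by omega), hX]
  · have um : toMat (n + 1) (i + 1) s.1.exactUnit ∈ Matrix.unitaryGroup (Fin (n + 1)) ℂ :=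
      toMat_unitary (by omega) (a₁.exactUnit_isUnitary (by linarith))
    have ug : toMat (n + 1) i g.exactUnit ∈ Matrix.unitaryGroup (Fin (n + 1)) ℂ :=
      toMat_unitary (by omega) (hg.exactUnit_isUnitary (by linarith))
    rw [extend_mul, extend_toMat (by omega)]
    set m := toMat (n + 1) (i + 1) s.1.exactUnit
    set G := toMat (n + 1) i g.exactUnit
    set P := unitProd (n + 1) n A
    set P' := unitProd (n + 1) n A'
    set P₀ := unitProd (n + 1) n A₀
    have em : mᴴ * m = 1 := Matrix.mem_unitaryGroup_iff'.1 um
    have e : P' - (X * m)ᴴ * P₀ * (extend L * G) =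
        mᴴ * (P - Xᴴ * P₀ * extend L) * G - mᴴ * (P * G - m * P') := by
      rw [Matrix.mul_sub mᴴ (P * G), ← Matrix.mul_assoc mᴴ m, em, Matrix.conjTranspose_mul]
      noncomm_ring
    have nm : ‖mᴴ‖ ≤ 1 := by rw [Matrix.l2_opNorm_conjTranspose]; exact norm_unitary_le um
    rw [e]
    refine (norm_sub_le _ _).trans (add_le_add ?_ ?_)
    · exact (norm_mul_le_of_le_one_right _ (norm_unitary_le ug)).trans
        ((norm_mul_le_of_le_one_left nm _).trans e₁)
    · exact (norm_mul_le_of_le_one_left nm _).trans pA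
  · have um : toMat (n + 1) (i + 1) s.1.exactUnit ∈ Matrix.unitaryGroup (Fin (n + 1)) ℂ :=
      toMat_unitary (by omega) (a₁.exactUnit_isUnitary (by linarith))
    have uz : toMat (n + 1) i t.2.2.exactUnit ∈ Matrix.unitaryGroup (Fin (n + 1)) ℂ :=
      toMat_unitary (by omega) (b₃.exactUnit_isUnitary (by linarith))
    rw [exactUnit_adj, toMat_adj] at pB
    rw [extend_mul, extend_toMat (by omega), exactUnit_adj, toMat_adj]
    set m := toMat (n + 1) (i + 1) s.1.exactUnit
    set z := toMat (n + 1) i t.2.2.exactUnit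
    set P := unitProd (n + 1) n B
    set P' := unitProd (n + 1) n B'
    set P₀ := unitProd (n + 1) n B₀
    have ez : z * zᴴ = 1 := Matrix.mem_unitaryGroup_iff.1 uz
    have e : P' - (X * m)ᴴ * P₀ * (extend R * zᴴ) =
        mᴴ * (P - Xᴴ * P₀ * extend R) * zᴴ - (mᴴ * P - P' * z) * zᴴ := by
      rw [Matrix.sub_mul (mᴴ * P), Matrix.mul_assoc P', ez, Matrix.conjTranspose_mul]
      noncomm_ring
    have nm : ‖mᴴ‖ ≤ 1 := by rw [Matrix.l2_opNorm_conjTranspose]; exact norm_unitary_le um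
    have nz : ‖zᴴ‖ ≤ 1 := by rw [Matrix.l2_opNorm_conjTranspose]; exact norm_unitary_le uz
    rw [e]
    refine (norm_sub_le _ _).trans (add_le_add ?_ ?_)
    · exact (norm_mul_le_of_le_one_right _ nz).trans
        ((norm_mul_le_of_le_one_left nm _).trans e₂)
    · exact (norm_mul_le_of_le_one_right _ nz).trans pB

end FloatArith

/-! ### The invariant of the algorithm -/

/-- What is known about the state `S` of the algorithm after `N` operations that started from
`S₀`. Here `M` is the matrix on the left of the triangular factor of `V` (the product of the cores in
`Q`, possibly multiplied by a misfit) and `P` is a similarity transformation that has already been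
applied to `Q` but not yet to the triangular factors. -/
structure Invariant {n : ℕ} (u : ℝ) (S₀ S : QZState n) (N : ℕ) (M P : Matrix (Fin n) (Fin n) ℂ) :
    Prop where
  near_Q : AllNear u S.Q
  near_CV : AllNear u S.CV
  near_BV : AllNear u S.BV
  near_CW : AllNear u S.CW
  near_BW : AllNear u S.BW
  unitary_U : S.U ∈ Matrix.unitaryGroup (Fin n) ℂ
  unitary_Z : S.Z ∈ Matrix.unitaryGroup (Fin n) ℂ
  sine_V : SineTracks n u N S₀.CV S.CV
  sine_W : SineTracks n u N S₀.CW S.CW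
  track_W : PairTracks (N * (400000 * u)) S₀.CW S₀.BW S.CW S.BW S.U S.Z
  track_V : ∃ X ∈ Matrix.unitaryGroup (Fin n) ℂ,
    PairTracks (N * (400000 * u)) S₀.BV S₀.CV S.BV S.CV S.Z X ∧
    ‖M - (S.U * P)ᴴ * unitProd n (n - 1) S₀.Q * X‖ ≤ N * (400000 * u)

lemma PairTracks.mono {n : ℕ} {δ δ' : ℝ} {A₀ B₀ A B : ℕ → Core} {L R : Matrix (Fin n) (Fin n) ℂ}
    (h : PairTracks δ A₀ B₀ A B L R) (hδ : δ ≤ δ') : PairTracks δ' A₀ B₀ A B L R := by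
  obtain ⟨X, h1, h2, h3, h4⟩ := h
  exact ⟨X, h1, h2, h3.trans hδ, h4.trans hδ⟩

lemma SineTracks.mono {n : ℕ} {u : ℝ} (hu : 0 ≤ u) {N N' : ℕ} {C₀ C : ℕ → Core}
    (h : SineTracks n u N C₀ C) (hN : N ≤ N') : SineTracks n u N' C₀ C :=
  ⟨h.1, h.2.mono (sub_le_sub_right (pow_le_pow_right₀ (by linarith) hN) 1)⟩

lemma Invariant.mono {n : ℕ} {u : ℝ} (hu : 0 ≤ u) {S₀ S : QZState n} {N N' : ℕ}
    {M P : Matrix (Fin n) (Fin n) ℂ} (h : Invariant u S₀ S N M P) (hN : N ≤ N') :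
    Invariant u S₀ S N' M P := by
  have hN' : (N : ℝ) * (400000 * u) ≤ N' * (400000 * u) :=
    mul_le_mul_of_nonneg_right (by exact_mod_cast hN) (by positivity)
  obtain ⟨X, h1, h2, h3⟩ := h.track_V
  exact { h with
    sine_V := h.sine_V.mono hu hN
    sine_W := h.sine_W.mono hu hN
    track_W := h.track_W.mono hN'
    track_V := ⟨X, h1, h2.mono hN', h3.trans hN'⟩ }

/-- An operation that only changes `Q`. -/
lemma Invariant.change_Q {n : ℕ} {u : ℝ} (hu : 0 ≤ u) {S₀ S : QZState n} {N : ℕ}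
    {M M' P' : Matrix (Fin n) (Fin n) ℂ} (h : Invariant u S₀ S N M 1) {Q : ℕ → Core}
    (hQ : AllNear u Q) (hP' : P' ∈ Matrix.unitaryGroup (Fin n) ℂ)
    (hM : ‖M' - P'ᴴ * M‖ ≤ 400000 * u) :
    Invariant u S₀ { S with Q := Q } (N + 1) M' P' := by
  have h' := h.mono hu (Nat.le_succ N)
  obtain ⟨X, h1, h2, h3⟩ := h.track_V
  refine { h' with near_Q := hQ, track_V := ⟨X, h1, h2.mono ?_, ?_⟩ }
  · push_cast
    nlinarith
  · have e : M' - (S.U * P')ᴴ * unitProd n (n - 1) S₀.Q * X =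
        (M' - P'ᴴ * M) + P'ᴴ * (M - (S.U * 1)ᴴ * unitProd n (n - 1) S₀.Q * X) := by
      rw [Matrix.conjTranspose_mul, Matrix.mul_one]
      noncomm_ring
    simp only
    rw [e]
    have nP : ‖P'ᴴ‖ ≤ 1 := by rw [Matrix.l2_opNorm_conjTranspose]; exact norm_unitary_le hP'
    refine (norm_add_le _ _).trans ?_
    have := (norm_mul_le_of_le_one_left nP
      (M - (S.U * 1)ᴴ * unitProd n (n - 1) S₀.Q * X)).trans h3
    push_cast
    linarith

namespace FloatArith

variable {u : ℝ} (fl : FloatArith u)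

/-- Passing a core through both triangular factors turns the pending similarity transformation
into a misfit on the right of `Q`. -/
lemma invariant_passThrough (hu1 : u ≤ 1 / 1000000000000) {n : ℕ} {S₀ S : QZState n} {N i : ℕ}
    (hi : i + 1 < n) {M : Matrix (Fin n) (Fin n) ℂ} {g : Core} (hg : NearUnit (11 * u) g)
    (h : Invariant u S₀ S N M (toMat n i g.exactUnit)) {r : QZState n × Core}
    (hr : r = passThrough fl i g S) :
    Invariant u S₀ r.1 (N + 1) (M * toMat n i r.2.exactUnit) 1 ∧ NearUnit (11 * u) r.2 ∧
      r.1.Q = S.Q := by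
  have hu := fl.u_nonneg
  obtain ⟨X, uX, hX, hM⟩ := h.track_V
  obtain ⟨W₁, W₂, W₃, W₄⟩ := fl.pairTracks_step hu1 h.track_W h.near_CW h.near_BW hg hi rfl rfl
  obtain ⟨V₁, V₂, V₃, V₄⟩ := fl.pairTracks_step hu1 hX h.near_BV h.near_CV W₄ hi rfl rfl
  have tW := fl.turnover_stable hu1 (h.near_CW i) (h.near_CW (i + 1)) hg rfl
  have tBV := fl.turnover_stable hu1 (h.near_BV i) (h.near_BV (i + 1)) W₄ rfl
  have tV := fl.turnoverLR_stable hu1 (h.near_CV i) (h.near_CV (i + 1)) tBV.1.1.adj rfl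
  have hN : ((N : ℝ) * (400000 * u) + 400000 * u) = ((N + 1 : ℕ) : ℝ) * (400000 * u) := by
    push_cast; ring
  have ux := V₄.exactUnit_isUnitary (by linarith)
  have uz := W₄.exactUnit_isUnitary (by linarith)
  have ug := hg.exactUnit_isUnitary (by linarith)
  subst hr
  refine ⟨?_, V₄, rfl⟩
  exact
    { near_Q := h.near_Q
      near_CV := V₃
      near_BV := V₂
      near_CW := W₂
      near_BW := W₃
      unitary_U := mul_mem h.unitary_U (toMat_unitary (by omega) ug)
      unitary_Z := mul_mem h.unitary_Z (toMat_unitary (by omega) uz)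
      sine_V := h.sine_V.step hu (by omega) tV.2.1.1 tV.2.1.2 tV.2.2.1
      sine_W := h.sine_W.step hu (by omega) tW.2.1.1 tW.2.1.2 tW.2.2.1
      track_W := W₁.mono hN.le
      track_V := by
        refine ⟨_, mul_mem uX (toMat_unitary (by omega) ux), V₁.mono hN.le, ?_⟩
        rw [Matrix.mul_one, ← Matrix.mul_assoc]
        refine le_trans (le_of_eq (congrArg norm (Matrix.sub_mul M _ _).symm)) ?_
        refine (norm_mul_le_of_le_one_right _
          (norm_unitary_le (toMat_unitary (by omega) ux))).trans (hM.trans ?_)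
        push_cast
        nlinarith }

/-- The invariant is preserved by chasing the misfit to the bottom of the block. -/
lemma invariant_chaseLoop (hu1 : u ≤ 1 / 1000000000000) {n : ℕ} {S₀ : QZState n} {p : ℂ} (k : ℕ) :
    ∀ {S : QZState n} {N i : ℕ} {g : Core}, i + k + 1 < n → NearUnit (11 * u) g →
      Invariant u S₀ S N (unitProd n (n - 1) S.Q) (toMat n i g.exactUnit) →
      ((p = 1 ∧ i + k + 2 = n) ∨
        (p = (S.Q (i + k + 1)).c ∧ (S.Q (i + k + 1)).s = 0 ∧ i + k + 2 < n)) →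
      Invariant u S₀ (chaseLoop fl p k i g S) (N + 2 * (k + 1))
        (unitProd n (n - 1) (chaseLoop fl p k i g S).Q) 1 := by
  have hu := fl.u_nonneg
  induction k with
  | zero =>
    intro S N i g hi hg h hp
    obtain ⟨r₁, r₂, r₃⟩ := fl.invariant_passThrough hu1 (by omega) hg h rfl
    rw [← r₃] at hp r₁
    obtain ⟨f₁, f₂⟩ := fl.fuse_end hu1 (n := n) (i := i) (by omega) r₁.near_Q r₂ hp rfl
    exact r₁.change_Q hu (r₁.near_Q.update f₁) (one_mem _)
      (by rw [Matrix.conjTranspose_one, Matrix.one_mul]; exact f₂)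
  | succ k ih =>
    intro S N i g hi hg h hp
    obtain ⟨r₁, r₂, r₃⟩ := fl.invariant_passThrough hu1 (by omega) hg h rfl
    rw [chaseLoop]
    rw [← r₃] at hp r₁
    set r := passThrough fl i g S with hr
    obtain ⟨t, ht⟩ : ∃ t, t = turnover fl (r.1.Q i) (r.1.Q (i + 1)) r.2 := ⟨_, rfl⟩
    obtain ⟨⟨a₁, a₂, a₃⟩, -⟩ := fl.turnover_stable hu1 (r₁.near_Q i) (r₁.near_Q (i + 1)) r₂ ht
    have mQ := fl.turnover_matrix hu1 (r₁.near_Q i) (r₁.near_Q (i + 1)) r₂ ht (m := n) (i := i)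
      (by omega)
    simp only [← ht]
    set Q' := Function.update (Function.update r.1.Q i t.2.1) (i + 1) t.2.2 with hQ'
    have nQ' : AllNear u Q' := (r₁.near_Q.update a₂).update a₃
    have hne : i ≠ i + 1 := by omega
    have pQ : ‖unitProd n (n - 1) r.1.Q * toMat n i r.2.exactUnit -
        toMat n (i + 1) t.1.exactUnit * unitProd n (n - 1) Q'‖ ≤ 400000 * u := by
      refine prodMat_pass_left (by omega) (by omega) (r₁.near_Q.isUnitary hu1)
        (fun j h1 h2 => ?_) ?_
      · simp [hQ', Function.update_of_ne h1, Function.update_of_ne h2]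
      · simpa [hQ', Function.update_of_ne hne] using mQ
    have um : toMat n (i + 1) t.1.exactUnit ∈ Matrix.unitaryGroup (Fin n) ℂ :=
      toMat_unitary (by omega) (a₁.exactUnit_isUnitary (by linarith))
    have em : (toMat n (i + 1) t.1.exactUnit)ᴴ * toMat n (i + 1) t.1.exactUnit = 1 :=
      Matrix.mem_unitaryGroup_iff'.1 um
    have nm : ‖(toMat n (i + 1) t.1.exactUnit)ᴴ‖ ≤ 1 := by
      rw [Matrix.l2_opNorm_conjTranspose]; exact norm_unitary_le um
    have hI := r₁.change_Q hu (Q := Q') (M' := unitProd n (n - 1) Q') nQ' um (by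
      rw [norm_sub_rev]
      have e : (toMat n (i + 1) t.1.exactUnit)ᴴ *
          (unitProd n (n - 1) r.1.Q * toMat n i r.2.exactUnit) - unitProd n (n - 1) Q' =
          (toMat n (i + 1) t.1.exactUnit)ᴴ *
            (unitProd n (n - 1) r.1.Q * toMat n i r.2.exactUnit -
              toMat n (i + 1) t.1.exactUnit * unitProd n (n - 1) Q') := by
        rw [Matrix.mul_sub, ← Matrix.mul_assoc _ (toMat n (i + 1) t.1.exactUnit), em,
          Matrix.one_mul]
      rw [e]
      exact (norm_mul_le_of_le_one_left nm _).trans pQ)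
    have hfin := ih (S := { r.1 with Q := Q' }) (i := i + 1) (g := t.1) (by omega) a₁ hI (by
      have hj : Q' (i + 1 + k + 1) = r.1.Q (i + (k + 1) + 1) := by
        rw [hQ', show i + 1 + k + 1 = i + (k + 1) + 1 by omega,
          Function.update_of_ne (by omega), Function.update_of_ne (by omega)]
      simp only [hj]
      rcases hp with ⟨hp, hn⟩ | ⟨hp, hq, hn⟩
      · exact Or.inl ⟨hp, by omega⟩
      · exact Or.inr ⟨hp, hq, by omega⟩)
    rwa [show N + 1 + 1 + 2 * (k + 1) = N + 2 * (k + 1 + 1) by ring] at hfin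

lemma invariant_qzIteration (hu1 : u ≤ 1 / 1000000000000) {n : ℕ} {S₀ S : QZState n} {N l m : ℕ}
    (μ : ℂ) (h : Invariant u S₀ S N (unitProd n (n - 1) S.Q) 1) (hlm : l < m) (hm : m < n)
    (h1 : l = 0 ∨ (S.Q (l - 1)).s = 0) (h2 : m + 1 = n ∨ (S.Q m).s = 0) :
    Invariant u S₀ (qzIteration fl l m μ S) (N + 2 * n)
      (unitProd n (n - 1) (qzIteration fl l m μ S).Q) 1 := by
  have hu := fl.u_nonneg
  have key : ∀ (x : ℂ × ℂ) (d p : ℂ), NearUnit (11 * u) ⟨x.1, x.2, 1⟩ →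
      (d = if l = 0 then 1 else ((S.Q (l - 1)).ε : ℂ) * conj (S.Q (l - 1)).c) →
      (p = if m + 1 = n then 1 else (S.Q m).c) →
      ∀ S', S' = chaseLoop fl p (m - l - 1) l ⟨x.1, x.2, 1⟩
        { S with Q := Function.update S.Q l (fuse fl (adj ⟨x.1, fl.cmul x.2 d, 1⟩) (S.Q l)) } →
      Invariant u S₀ S' (N + 2 * n) (unitProd n (n - 1) S'.Q) 1 := by
    intro x d p ng hd hp S' hS'
    subst hS'
    set g : Core := ⟨x.1, x.2, 1⟩ with hg
    obtain ⟨f₁, f₂⟩ := fl.fuse_start hu1 (n := n) (l := l) (by omega) h.near_Q ng rfl h1 hd rfl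
    have ug : toMat n l g.exactUnit ∈ Matrix.unitaryGroup (Fin n) ℂ :=
      toMat_unitary (by omega) (ng.exactUnit_isUnitary (by linarith))
    have hI := h.change_Q hu (h.near_Q.update (i := l) f₁) ug f₂
    refine (fl.invariant_chaseLoop hu1 (m - l - 1) (by omega) ng hI ?_).mono hu (by omega)
    have e : l + (m - l - 1) + 1 = m := by omega
    have e' : l + (m - l - 1) + 2 = m + 1 := by omega
    rw [e, e', hp]
    by_cases hmn : m + 1 = n
    · exact Or.inl ⟨if_pos hmn, hmn⟩
    · refine Or.inr ⟨?_, ?_, by omega⟩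
      · simp only [Function.update_of_ne (show m ≠ l by omega)]
        exact if_neg hmn
      · simp only [Function.update_of_ne (show m ≠ l by omega)]
        exact h2.resolve_left hmn
  exact key _ _ _ (fl.normalize_nearUnit (by linarith) _ _ 1) rfl rfl _ rfl

lemma invariant_deflate (hu1 : u ≤ 1 / 1000000000000) {n : ℕ} {S₀ S : QZState n} {N i : ℕ}
    (h : Invariant u S₀ S N (unitProd n (n - 1) S.Q) 1) (hi : i + 1 < n)
    (hs : ‖(S.Q i).s‖ ≤ u) :
    Invariant u S₀ (deflate fl i S) (N + 1) (unitProd n (n - 1) (deflate fl i S).Q) 1 := by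
  obtain ⟨f₁, f₂⟩ := fl.deflate_stable hu1 hi h.near_Q hs rfl
  exact h.change_Q fl.u_nonneg (h.near_Q.update f₁) (one_mem _)
    (by rw [Matrix.conjTranspose_one, Matrix.one_mul]; exact f₂)

lemma initC_near (hu1 : u ≤ 1 / 1000000000000) (n : ℕ) (t : ℕ → ℂ) :
    AllNear u (initC fl n t) := by
  intro i
  have := fl.normalize_norm (by linarith) (t i) (tailNorm fl n t (n - 1 - i))
  simpa [NearUnit, size, initC] using this

lemma initB_near (hu1 : u ≤ 1 / 1000000000000) (n : ℕ) (t : ℕ → ℂ) :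
    AllNear u (initB fl n t) := by
  intro i
  have := fl.initC_near hu1 n t i
  simp only [initB]
  split_ifs
  · unfold NearUnit size at *
    simp only [norm_neg, RCLike.norm_conj]
    rwa [add_comm]
  · exact this

/-- The invariant holds after every run. -/
theorem invariant_of_run (hu1 : u ≤ 1 / 1000000000000) {n : ℕ} [NeZero n]
    {v w : EuclideanSpace ℂ (Fin n)} {K : ℕ} {S : QZState n} (h : QZRun fl v w K S) :
    Invariant u (initState fl v w) S (2 * n * K) (unitProd n (n - 1) S.Q) 1 := by
  have hu := fl.u_nonneg
  induction h with
  | start =>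
    exact
      { near_Q := fun j => by simp [initState, NearUnit, size, hu]
        near_CV := fl.initC_near hu1 _ _
        near_BV := fl.initB_near hu1 _ _
        near_CW := fl.initC_near hu1 _ _
        near_BW := fl.initB_near hu1 _ _
        unitary_U := one_mem _
        unitary_Z := one_mem _
        sine_V := ⟨fun _ => rfl, RelErr.refl (by simp) _⟩
        sine_W := ⟨fun _ => rfl, RelErr.refl (by simp) _⟩
        track_W := ⟨1, one_mem _, by simp, by simp [initState, extend_one],
          by simp [initState, extend_one]⟩
        track_V := ⟨1, one_mem _, ⟨1, one_mem _, by simp, by simp [initState, extend_one],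
          by simp [initState, extend_one]⟩, by simp [initState]⟩ }
  | iterate l m μ _ hlm hm h1 h2 ih =>
    have := fl.invariant_qzIteration hu1 μ ih hlm hm h1 h2
    rwa [show ∀ K, 2 * n * (K + 1) = 2 * n * K + 2 * n from fun K => by ring]
  | deflation i _ hi hs ih =>
    have := (fl.invariant_deflate hu1 ih hi hs).mono hu (Nat.add_le_add_left
      (show 1 ≤ 2 * n by have := NeZero.pos n; omega) _)
    rwa [show ∀ K, 2 * n * (K + 1) = 2 * n * K + 2 * n from fun K => by ring]

end FloatArith

/-! ### Accumulation of relative errors -/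

lemma RelErr.mul_accumulate {F : Type*} [NormedField F] {x y x' y' : F} {a b : ℝ}
    (h : RelErr (a - 1) x y) (h' : RelErr (b - 1) x' y') (ha : 1 ≤ a) :
    RelErr (a * b - 1) (x * x') (y * y') := by
  have h1 : RelErr (a - 1) (x * x') (y * x') := by
    have := h.const_mul x'
    rwa [mul_comm x', mul_comm x'] at this
  exact h1.one_add_mul (h'.const_mul y) ha

lemma RelErr.prod_range {x y : ℕ → ℂ} {η : ℝ} (hη : 0 ≤ η) (k : ℕ)
    (h : ∀ j < k, RelErr η (x j) (y j)) :
    RelErr ((1 + η) ^ k - 1) (∏ j ∈ Finset.range k, x j) (∏ j ∈ Finset.range k, y j) := by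
  induction k with
  | zero => exact RelErr.refl (by simp) _
  | succ k ih =>
    rw [Finset.prod_range_succ, Finset.prod_range_succ, pow_succ]
    refine (ih fun j hj => h j (by omega)).mul_accumulate ?_ (one_le_pow₀ (by linarith))
    exact (h k (by omega)).mono (by linarith)

lemma one_add_pow_sub_one_le {x : ℝ} (hx : 0 ≤ x) {k : ℕ} (h : k * x ≤ 1) :
    (1 + x) ^ k - 1 ≤ 2 * (k * x) := by
  have h0 : 0 ≤ (k : ℝ) * x := by positivity
  have h1 : (1 + x) ^ k ≤ Real.exp (k * x) := by
    rw [Real.exp_nat_mul]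
    exact pow_le_pow_left₀ (by linarith) (by linarith [Real.add_one_le_exp x]) k
  have h2 := Real.abs_exp_sub_one_le (x := k * x) (by rwa [abs_of_nonneg h0])
  rw [abs_of_nonneg h0] at h2
  linarith [le_abs_self (Real.exp (k * x) - 1)]

lemma RelErr.inv_of_le_half {F : Type*} [NormedField F] {x y : F} {η : ℝ} (h : RelErr η x y)
    (hη : η ≤ 1 / 2) (hη0 : 0 ≤ η) : RelErr (2 * η) x⁻¹ y⁻¹ := by
  by_cases hy : y = 0
  · have hx := (h.eq_zero_iff (by linarith)).2 hy
    subst hx hy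
    exact RelErr.refl (by positivity) _
  have hx : x ≠ 0 := fun hx => hy ((h.eq_zero_iff (by linarith)).1 hx)
  have nx : 0 < ‖x‖ := by simpa using hx
  have ny : 0 < ‖y‖ := by simpa using hy
  have h1 := h.le_norm
  have e : x⁻¹ - y⁻¹ = (y - x) * (x⁻¹ * y⁻¹) := by field_simp
  unfold RelErr at *
  rw [e, norm_mul, norm_mul, norm_inv, norm_inv, norm_sub_rev]
  have h2 : ‖x - y‖ ≤ 2 * η * ‖x‖ := by
    have h3 : η * ‖y‖ ≤ 1 / 2 * ‖y‖ := mul_le_mul_of_nonneg_right hη ny.le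
    have h4 : ‖y‖ ≤ 2 * ‖x‖ := by linarith
    have h5 := mul_le_mul_of_nonneg_left h4 hη0
    linarith
  calc ‖x - y‖ * (‖x‖⁻¹ * ‖y‖⁻¹) ≤ 2 * η * ‖x‖ * (‖x‖⁻¹ * ‖y‖⁻¹) :=
        mul_le_mul_of_nonneg_right h2 (by positivity)
    _ = 2 * η * ‖y‖⁻¹ := by field_simp

/-! ### Entries of products with core transformations -/

namespace Core

lemma mul_toMat_apply {l m i : ℕ} (hi : i + 1 < m) (A : Matrix (Fin l) (Fin m) ℂ) (g : Core)
    (r : Fin l) (c : Fin m) : (A * toMat m i g) r c =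
      if c.1 = i then A r ⟨i, by omega⟩ * g.c + A r ⟨i + 1, hi⟩ * g.s
      else if c.1 = i + 1 then
        A r ⟨i, by omega⟩ * (-g.ε * conj g.s) + A r ⟨i + 1, hi⟩ * (g.ε * conj g.c)
      else A r c := by
  rw [Matrix.mul_apply]
  by_cases h : c.1 = i ∨ c.1 = i + 1
  · rw [Finset.sum_eq_add (⟨i, by omega⟩ : Fin m) ⟨i + 1, hi⟩ (by simp [Fin.ext_iff])
      (fun x _ hx => ?_) (by simp) (by simp)]
    · rcases h with h | h <;> simp [toMat, h]
    · have h1 : x.1 ≠ i := fun h => hx.1 (Fin.ext h)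
      have h2 : x.1 ≠ i + 1 := fun h => hx.2 (Fin.ext h)
      have h3 : x ≠ c := by
        intro h3
        subst h3
        omega
      simp [toMat, h1, h2, h3]
  · push Not at h
    rw [Finset.sum_eq_single c]
    · simp [toMat, h.1, h.2]
    · intro x _ hx
      simp [toMat, h.1, h.2, hx]
    · simp

lemma toMat_mulVec_apply {m i : ℕ} (hi : i + 1 < m) (g : Core) (z : Fin m → ℂ) (r : Fin m) :
    (toMat m i g *ᵥ z) r =
      if r.1 = i then g.c * z ⟨i, by omega⟩ + (-g.ε * conj g.s) * z ⟨i + 1, hi⟩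
      else if r.1 = i + 1 then g.s * z ⟨i, by omega⟩ + (g.ε * conj g.c) * z ⟨i + 1, hi⟩
      else z r := by
  rw [Matrix.mulVec, dotProduct]
  by_cases h : r.1 = i ∨ r.1 = i + 1
  · rw [Finset.sum_eq_add (⟨i, by omega⟩ : Fin m) ⟨i + 1, hi⟩ (by simp [Fin.ext_iff])
      (fun x _ hx => ?_) (by simp) (by simp)]
    · rcases h with h | h <;> simp [toMat, h]
    · have h1 : x.1 ≠ i := fun h => hx.1 (Fin.ext h)
      have h2 : x.1 ≠ i + 1 := fun h => hx.2 (Fin.ext h)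
      have h3 : r ≠ x := by
        intro h3
        subst h3
        omega
      simp [toMat, h1, h2, h3]
  · push Not at h
    rw [Finset.sum_eq_single r]
    · simp [toMat, h.1, h.2]
    · intro x _ hx
      simp [toMat, h.1, h.2, Ne.symm hx]
    · simp

lemma prodMat_succ (m k : ℕ) (G : ℕ → Core) :
    prodMat m (k + 1) G = prodMat m k G * toMat m k (G k) := by
  rw [prodMat_eq_segMat, prodMat_eq_segMat, segMat_succ, zero_add]

lemma prodMat_zero (m : ℕ) (G : ℕ → Core) : prodMat m 0 G = 1 := by
  rw [prodMat_eq_segMat, segMat_zero]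

/-- The last entry of the first row of `C 0 ⋯ C (n-1)`. -/
lemma prodMat_first_row (n : ℕ) (C : ℕ → Core) (k : ℕ) (hk : k ≤ n) (c : Fin (n + 1))
    (hc : k ≤ c.1) : prodMat (n + 1) k C 0 c =
      if c.1 = k then ∏ j ∈ Finset.range k, (-((C j).ε : ℂ) * conj (C j).s) else 0 := by
  induction k generalizing c with
  | zero =>
    rw [prodMat_zero, Matrix.one_apply]
    by_cases h : c.1 = 0
    · have : c = 0 := Fin.ext h
      simp [this]
    · rw [if_neg h, if_neg]
      intro h0
      exact h (by rw [← h0]; rfl)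
  | succ k ih =>
    rw [prodMat_succ, mul_toMat_apply (by omega), if_neg (by omega), ih (by omega) _ (by simp),
      ih (by omega) _ (by simp), ih (by omega) c (by omega), Finset.prod_range_succ]
    by_cases h : c.1 = k + 1
    · simp [h]
    · simp [h, show c.1 ≠ k by omega]

lemma prodMat_conjTranspose_corner (n : ℕ) (C : ℕ → Core) :
    (prodMat (n + 1) n C)ᴴ (Fin.last n) 0 =
      (∏ j ∈ Finset.range n, (-((C j).ε : ℂ))) * ∏ j ∈ Finset.range n, (C j).s := by
  rw [Matrix.conjTranspose_apply, prodMat_first_row n C n le_rfl _ (by simp), if_pos (by simp),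
    ← Finset.prod_mul_distrib, RCLike.star_def, map_prod]
  refine Finset.prod_congr rfl fun j _ => ?_
  simp

/-- The stored cores are unitary only up to roundoff; the effect on their product. -/
lemma norm_prodMat_sub_unitProd_le {u : ℝ} (hu : 0 ≤ u) (hu1 : u ≤ 1 / 1000000000000) {m : ℕ}
    {G : ℕ → Core} (hG : AllNear u G) (k : ℕ) (hk : k + 1 ≤ m) :
    ‖prodMat m k G - unitProd m k G‖ ≤ (1 + 22 * u) ^ k - 1 := by
  induction k with
  | zero => simp [unitProd, prodMat_zero]
  | succ k ih =>
    have uG := hG.isUnitary hu1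
    rw [unitProd, prodMat_succ, prodMat_succ]
    have e : prodMat m k G * toMat m k (G k) - prodMat m k (fun j => (G j).exactUnit) *
        toMat m k (G k).exactUnit =
        (prodMat m k G - unitProd m k G) * toMat m k (G k) +
          unitProd m k G * (toMat m k (G k) - toMat m k (G k).exactUnit) := by
      rw [unitProd]; noncomm_ring
    have c := ((hG k).relClose (by linarith)).close (uG k) (by positivity)
    have h1 := c.norm_toMat_sub_le (m := m) (i := k) (by omega)
    have h2 : ‖toMat m k (G k)‖ ≤ 1 + 22 * u := by
      have := norm_unitary_le (toMat_unitary (m := m) (i := k) (by omega) (uG k))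
      have h3 : ‖toMat m k (G k)‖ ≤
          ‖toMat m k (G k) - toMat m k (G k).exactUnit‖ + ‖toMat m k (G k).exactUnit‖ := by
        simpa using norm_add_le (toMat m k (G k) - toMat m k (G k).exactUnit)
          (toMat m k (G k).exactUnit)
      linarith
    have h4 : ‖unitProd m k G‖ ≤ 1 := by
      rw [unitProd, prodMat_eq_segMat]
      exact norm_unitary_le (segMat_unitary (by omega) fun j _ _ => uG j)
    have ih' := ih (by omega)
    rw [e]
    refine (norm_add_le _ _).trans ?_
    have h5 := (Matrix.l2_opNorm_mul (prodMat m k G - unitProd m k G) (toMat m k (G k))).trans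
      (mul_le_mul ih' h2 (norm_nonneg _) ((norm_nonneg _).trans ih'))
    have h6 := (norm_mul_le_of_le_one_left h4
      (toMat m k (G k) - toMat m k (G k).exactUnit)).trans h1
    rw [pow_succ]
    nlinarith

lemma unitProd_unitary {u : ℝ} (hu1 : u ≤ 1 / 1000000000000) {m k : ℕ} (hk : k + 1 ≤ m)
    {G : ℕ → Core} (hG : AllNear u G) : unitProd m k G ∈ Matrix.unitaryGroup (Fin m) ℂ := by
  rw [unitProd, prodMat_eq_segMat]
  exact segMat_unitary (by omega) fun j _ _ => hG.isUnitary hu1 j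

end Core

/-! ### Matrices with a single nonzero column -/

/-- The `(n + 1) × (n + 1)` matrix with last column `z` and zeros elsewhere. -/
noncomputable def colMat {n : ℕ} (z : Fin (n + 1) → ℂ) : Matrix (Fin (n + 1)) (Fin (n + 1)) ℂ :=
  Matrix.vecMulVec z (Pi.single (Fin.last n) 1)

section ColMat

variable {n : ℕ}

lemma mul_colMat (A : Matrix (Fin (n + 1)) (Fin (n + 1)) ℂ) (z : Fin (n + 1) → ℂ) :
    A * colMat z = colMat (A *ᵥ z) := by
  rw [colMat, Matrix.mul_vecMulVec, colMat]

lemma colMat_sub (y z : Fin (n + 1) → ℂ) : colMat y - colMat z = colMat (y - z) := by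
  rw [colMat, colMat, colMat, Matrix.sub_vecMulVec]

lemma norm_colMat (z : Fin (n + 1) → ℂ) : ‖colMat z‖ = √(∑ i, ‖z i‖ ^ 2) := by
  have h := Matrix.l2_opNorm_conjTranspose_mul_self (colMat z)
  have e : (colMat z)ᴴ * colMat z =
      ((∑ i, ‖z i‖ ^ 2 : ℝ) : ℂ) • Matrix.diagonal (Pi.single (Fin.last n) (1 : ℂ)) := by
    ext a b
    simp only [colMat, Matrix.mul_apply, Matrix.conjTranspose_apply, Matrix.vecMulVec_apply,
      Matrix.smul_apply, Matrix.diagonal_apply, smul_eq_mul, star_mul', RCLike.star_def]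
    by_cases ha : a = Fin.last n
    · by_cases hb : b = Fin.last n
      · subst ha hb
        simp [Complex.conj_mul']
      · simp [ha, hb, Ne.symm hb]
    · by_cases hab : a = b
      · subst hab
        simp [ha]
      · simp [ha, hab]
  rw [e, norm_smul, Complex.norm_real, Matrix.l2_opNorm_diagonal, Pi.norm_single, norm_one,
    mul_one, Real.norm_of_nonneg (by positivity)] at h
  rw [h, Real.sqrt_mul_self (norm_nonneg _)]

lemma norm_entry_le_norm_colMat (z : Fin (n + 1) → ℂ) (i : Fin (n + 1)) : ‖z i‖ ≤ ‖colMat z‖ := by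
  rw [norm_colMat]
  exact Real.le_sqrt_of_sq_le
    (Finset.single_le_sum (f := fun i => ‖z i‖ ^ 2) (fun _ _ => by positivity) (Finset.mem_univ i))

lemma norm_colMat_single (i : Fin (n + 1)) (x : ℂ) : ‖colMat (Pi.single i x)‖ = ‖x‖ := by
  rw [norm_colMat, Finset.sum_eq_single i]
  · simp
  · intro j _ hj
    simp [hj]
  · simp

lemma colMat_single_zero (x : ℂ) : colMat (Pi.single 0 x) = x • corner n := by
  ext a b
  simp only [colMat, Matrix.vecMulVec_apply, corner, Matrix.smul_apply, Matrix.single_apply,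
    smul_eq_mul, Pi.single_apply]
  by_cases ha : a = 0
  · by_cases hb : b = Fin.last n
    · simp [ha, hb]
    · simp [ha, hb, Ne.symm hb]
  · simp [ha, Ne.symm ha]

lemma norm_corner_le : ‖corner n‖ ≤ 1 := by
  have := norm_colMat_single (0 : Fin (n + 1)) 1
  rw [colMat_single_zero, one_smul, norm_one] at this
  exact this.le

end ColMat

/-! ### The initial factorization -/

namespace FloatArith

variable {u : ℝ} (fl : FloatArith u)

lemma tailNorm_ne_zero (hu1 : u ≤ 1 / 1000000000000) (n : ℕ) (t : ℕ → ℂ) (k : ℕ) :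
    tailNorm fl n t k ≠ 0 := by
  induction k with
  | zero => simp [tailNorm]
  | succ k ih =>
    rw [tailNorm, Ne, Complex.ofReal_eq_zero, fl.hypot_eq_zero_iff (by linarith)]
    exact fun h => ih h.2

lemma tailNorm_sub {n i : ℕ} (hi : i < n) (t : ℕ → ℂ) :
    tailNorm fl n t (n - i) = (fl.hypot (t i) (tailNorm fl n t (n - 1 - i)) : ℂ) := by
  rw [show n - i = (n - 1 - i) + 1 by omega, tailNorm, show n - 1 - (n - 1 - i) = i by omega]

/-- In exact arithmetic the sines are quotients of consecutive tail norms, so that their product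
telescopes. -/
lemma initC_sine (hu1 : u ≤ 1 / 1000000000000) {n i : ℕ} (hi : i < n) (t : ℕ → ℂ) :
    RelErr u (initC fl n t i).s
      (-(tailNorm fl n t (n - 1 - i) / tailNorm fl n t (n - 1 - i + 1))) := by
  have h0 := fl.tailNorm_ne_zero hu1 n t (n - i)
  rw [show n - 1 - i + 1 = n - i by omega]
  rw [fl.tailNorm_sub hi] at h0 ⊢
  have h1 : fl.hypot (t i) (tailNorm fl n t (n - 1 - i)) ≠ 0 := by exact_mod_cast h0
  have h2 := (fl.cdivR_relErr (tailNorm fl n t (n - 1 - i)) h1).const_mul (-1)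
  simpa [initC, normalize, h1] using h2

lemma prod_tailNorm (hu1 : u ≤ 1 / 1000000000000) (n : ℕ) (t : ℕ → ℂ) (k : ℕ) :
    ∏ j ∈ Finset.range k, (-(tailNorm fl n t j / tailNorm fl n t (j + 1))) =
      (-1) ^ k * (-(tailNorm fl n t k)⁻¹) := by
  induction k with
  | zero => simp [tailNorm]
  | succ k ih =>
    have h1 := fl.tailNorm_ne_zero hu1 n t k
    have h2 := fl.tailNorm_ne_zero hu1 n t (k + 1)
    rw [Finset.prod_range_succ, ih, pow_succ]
    field_simp

/-- The number `-(eₙ₊₁ᵀ C* e₁)⁻¹`, by which the rank-one part is recovered from the cores, stays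
relatively accurate since it is a product of sines. -/
lemma inv_corner_relErr (hu1 : u ≤ 1 / 1000000000000) {n : ℕ} (t : ℕ → ℂ) {N : ℕ}
    {C : ℕ → Core} (h : SineTracks n u N (initC fl n t) C)
    (hN : 1000000 * ((N + n : ℝ) * u) ≤ 1) :
    RelErr (80000 * ((N + n) * u)) ((prodMat (n + 1) n C)ᴴ (Fin.last n) 0)⁻¹
      (-tailNorm fl n t n) := by
  have hu := fl.u_nonneg
  have h1 : RelErr ((1 + u) ^ n - 1) (∏ j ∈ Finset.range n, (initC fl n t j).s)
      ((-1) ^ n * (-(tailNorm fl n t n)⁻¹)) := by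
    rw [← fl.prod_tailNorm hu1, ← Finset.prod_range_reflect
      (fun j => -(tailNorm fl n t j / tailNorm fl n t (j + 1)))]
    exact RelErr.prod_range hu n fun j hj => fl.initC_sine hu1 hj t
  have h2 := h.2.one_add_mul h1 (one_le_pow₀ (by linarith))
  have h3 : (1 + 20000 * u) ^ N * (1 + u) ^ n - 1 ≤ 40000 * ((N + n) * u) := by
    have e1 : (1 + u) ^ n ≤ (1 + 20000 * u) ^ n := pow_le_pow_left₀ (by linarith) (by linarith) n
    have e2 := mul_le_mul_of_nonneg_left e1 (show 0 ≤ (1 + 20000 * u) ^ N by positivity)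
    rw [← pow_add] at e2
    have e3 := one_add_pow_sub_one_le (x := 20000 * u) (by linarith) (k := N + n)
      (by push_cast; nlinarith)
    push_cast at e3
    nlinarith
  have h4 := (h2.mono h3).const_mul ((-1) ^ n)
  rw [← mul_assoc ((-1) ^ n) ((-1) ^ n), ← mul_pow, neg_mul_neg, one_mul, one_pow, one_mul] at h4
  have h0 : 0 ≤ ((N : ℝ) + n) * u := by positivity
  have h5 := h4.inv_of_le_half (by linarith) (by linarith)
  rw [prodMat_conjTranspose_corner]
  have e : ∏ j ∈ Finset.range n, (-((C j).ε : ℂ)) = (-1) ^ n := by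
    rw [Finset.prod_congr rfl (g := fun _ => (-1 : ℂ))]
    · simp
    · intro j _
      rw [h.1]
      simp [initC]
  rw [e]
  have h6 : (-(tailNorm fl n t n)⁻¹)⁻¹ = -tailNorm fl n t n := by
    rw [inv_neg, inv_inv]
  rw [h6] at h5
  exact h5.mono (by linarith)

/-- The vector that is left after the last `k` of the cores `C 0, …, C (n-1)` have been applied to
`(t 0, …, t (n-1), -1)`; in exact arithmetic. -/
noncomputable def reducedVec (n : ℕ) (t : ℕ → ℂ) (k : ℕ) (r : Fin (n + 1)) : ℂ :=
  if r.1 < n - k then t r else if r.1 = n - k then tailNorm fl n t k else 0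

/-- One computed core eliminates one more entry. -/
lemma initC_mul_reducedVec (hu1 : u ≤ 1 / 1000000000000) {n k : ℕ} (hk : k < n) (t : ℕ → ℂ) :
    ‖toMat (n + 1) (n - (k + 1)) (initC fl n t (n - (k + 1))).exactUnit *
        colMat (fl.reducedVec n t k) - colMat (fl.reducedVec n t (k + 1))‖ ≤
      200 * u * ‖colMat (fl.reducedVec n t k)‖ := by
  have hu := fl.u_nonneg
  obtain ⟨i, hi⟩ : ∃ i, n - (k + 1) = i := ⟨_, rfl⟩
  have hin : i < n := by omega
  have hik : n - 1 - i = k := by omega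
  have hnk : n - k = i + 1 := by omega
  rw [hi]
  have T0 := fl.tailNorm_ne_zero hu1 n t k
  have T1 : tailNorm fl n t (k + 1) = (fl.hypot (t i) (tailNorm fl n t k) : ℂ) := by
    rw [tailNorm, show n - 1 - k = i by omega]
  set τ := tailNorm fl n t k with hτ
  set h : ℝ := √(‖t i‖ ^ 2 + ‖τ‖ ^ 2) with hh
  have nτ : 0 < ‖τ‖ := by simpa using T0
  have h2 : h ^ 2 = ‖t i‖ ^ 2 + ‖τ‖ ^ 2 := Real.sq_sqrt (by positivity)
  have hpos : 0 < h := Real.sqrt_pos.2 (by positivity)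
  have hC : (h : ℂ) ≠ 0 := by exact_mod_cast hpos.ne'
  have h2C : (h : ℂ) ^ 2 = conj (t i) * t i + conj τ * τ := by
    rw [Complex.conj_mul', Complex.conj_mul']
    exact_mod_cast h2
  set g : Core := ⟨conj (t i / h), -(τ / h), 1⟩ with hg
  have ug : g.IsUnitary := by
    simp only [hg, IsUnitary, RCLike.norm_conj, norm_neg, norm_div, Complex.norm_real,
      Real.norm_of_nonneg hpos.le, div_pow]
    rw [← add_div, ← h2, div_self (by positivity)]
  have n1 := fl.normalize_fst_relErr (by linarith) (t i) τ (fun h => T0 h.2)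
  have n2 := fl.normalize_snd_relErr (by linarith) (t i) τ (fun h => T0 h.2)
  have c1 : Close (11 * u) (initC fl n t i) g := by
    refine RelClose.close ⟨rfl, ?_, ?_⟩ ug (by positivity)
    · simpa only [initC, hik] using n1.star
    · have := n2.const_mul (-1)
      simpa only [initC, hik, neg_one_mul] using this
  have c2 : ‖toMat (n + 1) i (initC fl n t i).exactUnit - toMat (n + 1) i g‖ ≤ 100 * u := by
    have hn := fl.initC_near hu1 n t i
    exact ((hn.close_of_close c1 hu hu1).norm_toMat_sub_le (by omega)).trans (by linarith)
  have e1 : toMat (n + 1) i g *ᵥ fl.reducedVec n t k - fl.reducedVec n t (k + 1) =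
      Pi.single ⟨i, by omega⟩ ((h : ℂ) - tailNorm fl n t (k + 1)) := by
    ext r
    rw [Pi.sub_apply, toMat_mulVec_apply (by omega)]
    simp only [reducedVec, hnk, hi, Pi.single_apply, Fin.ext_iff, lt_irrefl, if_false, if_true,
      Nat.lt_succ_self]
    by_cases r1 : r.1 = i
    · simp only [r1, if_true, lt_irrefl, if_false, hg]
      rw [← hτ]
      simp
      field_simp
      linear_combination -h2C
    · by_cases r2 : r.1 = i + 1
      · simp only [r2, if_true, hg]
        rw [← hτ]
        simp
        ring
      · have r3 : r.1 < i + 1 ↔ r.1 < i := by omega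
        simp [r1, r2, r3]
  have b1 := (Matrix.l2_opNorm_mul (toMat (n + 1) i (initC fl n t i).exactUnit -
    toMat (n + 1) i g) (colMat (fl.reducedVec n t k))).trans
      (mul_le_mul_of_nonneg_right c2 (norm_nonneg _))
  have b2 : ‖colMat (toMat (n + 1) i g *ᵥ fl.reducedVec n t k) -
      colMat (fl.reducedVec n t (k + 1))‖ ≤ 7 * u * h := by
    rw [colMat_sub, e1, norm_colMat_single, norm_sub_rev, T1]
    have := (fl.hypot_relErr (by linarith) (t i) τ).ofReal
    unfold RelErr at this
    rwa [Complex.norm_real, Real.norm_of_nonneg (Real.sqrt_nonneg _)] at this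
  have b3 : h ≤ ‖colMat (fl.reducedVec n t k)‖ := by
    have a1 := norm_mul_le_of_le_one_left (norm_unitary_le (toMat_unitary (m := n + 1) (i := i)
      (by omega) ug)) (colMat (fl.reducedVec n t k))
    rw [mul_colMat] at a1
    refine le_trans ?_ ((norm_entry_le_norm_colMat _ ⟨i, by omega⟩).trans a1)
    have := congrFun e1 ⟨i, by omega⟩
    rw [Pi.sub_apply, Pi.single_eq_same, sub_eq_iff_eq_add] at this
    rw [this]
    simp only [reducedVec, hi, lt_irrefl, if_false, if_true, sub_add_cancel, Complex.norm_real]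
    exact le_abs_self _
  have e2 : toMat (n + 1) i (initC fl n t i).exactUnit * colMat (fl.reducedVec n t k) -
      colMat (fl.reducedVec n t (k + 1)) =
      (toMat (n + 1) i (initC fl n t i).exactUnit - toMat (n + 1) i g) *
        colMat (fl.reducedVec n t k) + (colMat (toMat (n + 1) i g *ᵥ fl.reducedVec n t k) -
      colMat (fl.reducedVec n t (k + 1))) := by
    rw [Matrix.sub_mul, mul_colMat (toMat (n + 1) i g)]
    abel
  rw [e2]
  have b4 := mul_le_mul_of_nonneg_left b3 (show 0 ≤ 7 * u by positivity)
  refine (norm_add_le _ _).trans ?_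
  nlinarith

/-- The computed cores `C 0, …, C (n-1)` map `(t 0, …, t (n-1), -1)` to a multiple of `e₁`. -/
lemma initC_mul_colMat (hu1 : u ≤ 1 / 1000000000000) {n : ℕ} (t : ℕ → ℂ)
    (hn : 1000000 * (n * u) ≤ 1) (k : ℕ) (hk : k ≤ n) :
    ‖segMat (n + 1) (n - k) k (fun j => (initC fl n t j).exactUnit) *
        colMat (fl.reducedVec n t 0) - colMat (fl.reducedVec n t k)‖ ≤
      400 * (k * u) * ‖colMat (fl.reducedVec n t 0)‖ := by
  have hu := fl.u_nonneg
  induction k with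
  | zero => simp [segMat_zero]
  | succ k ih =>
    have ih' := ih (by omega)
    have s := fl.initC_mul_reducedVec hu1 (show k < n by omega) t
    set Z := colMat (fl.reducedVec n t 0)
    set Zk := colMat (fl.reducedVec n t k)
    set G : ℕ → Core := fun j => (initC fl n t j).exactUnit
    have uG : ∀ j, (G j).IsUnitary := (fl.initC_near hu1 n t).isUnitary hu1
    have hkn : (k : ℝ) * u ≤ n * u :=
      mul_le_mul_of_nonneg_right (by exact_mod_cast (by omega : k ≤ n)) hu
    have b1 : ‖Zk‖ ≤ 2 * ‖Z‖ := by
      have a1 := norm_mul_le_of_le_one_left (norm_unitary_le (segMat_unitary (m := n + 1)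
        (i := n - k) (k := k) (by omega) fun j _ _ => uG j)) Z
      have a2 : ‖Zk‖ ≤ ‖segMat (n + 1) (n - k) k G * Z‖ +
          ‖segMat (n + 1) (n - k) k G * Z - Zk‖ := by
        have := norm_sub_le (segMat (n + 1) (n - k) k G * Z)
          (segMat (n + 1) (n - k) k G * Z - Zk)
        rwa [sub_sub_cancel] at this
      have a3 := mul_le_mul_of_nonneg_right (show 400 * (k * u) ≤ 1 by linarith) (norm_nonneg Z)
      linarith
    rw [segMat_succ', show n - (k + 1) + 1 = n - k by omega]
    have e : toMat (n + 1) (n - (k + 1)) (G (n - (k + 1))) * segMat (n + 1) (n - k) k G * Z -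
        colMat (fl.reducedVec n t (k + 1)) =
        toMat (n + 1) (n - (k + 1)) (G (n - (k + 1))) * (segMat (n + 1) (n - k) k G * Z - Zk) +
        (toMat (n + 1) (n - (k + 1)) (G (n - (k + 1))) * Zk -
          colMat (fl.reducedVec n t (k + 1))) := by
      noncomm_ring
    rw [e]
    have a4 := norm_mul_le_of_le_one_left (norm_unitary_le (toMat_unitary (m := n + 1)
      (i := n - (k + 1)) (by omega) (uG (n - (k + 1)))))
        (segMat (n + 1) (n - k) k G * Z - Zk)
    have a5 := mul_le_mul_of_nonneg_left b1 (show 0 ≤ 200 * u by positivity)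
    refine (norm_add_le _ _).trans ?_
    push_cast
    nlinarith

/-- `z ≈ α C* e₁`, written with matrices. -/
lemma norm_colMat_sub_corner_le (hu1 : u ≤ 1 / 1000000000000) {n : ℕ} (t : ℕ → ℂ)
    (hn : 1000000 * (n * u) ≤ 1) :
    ‖colMat (fl.reducedVec n t 0) - tailNorm fl n t n •
        ((unitProd (n + 1) n (initC fl n t))ᴴ * corner n)‖ ≤
      400 * (n * u) * ‖colMat (fl.reducedVec n t 0)‖ := by
  have h := fl.initC_mul_colMat hu1 t hn n le_rfl
  have uG := unitProd_unitary hu1 (m := n + 1) le_rfl (fl.initC_near hu1 n t)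
  have e : fl.reducedVec n t n = Pi.single 0 (tailNorm fl n t n) := by
    ext r
    simp only [reducedVec, Pi.single_apply, Fin.ext_iff]
    simp
  rw [e, colMat_single_zero, Nat.sub_self, ← prodMat_eq_segMat] at h
  change ‖unitProd (n + 1) n (initC fl n t) * _ - _‖ ≤ _ at h
  refine le_trans ?_ h
  have uH := norm_unitary_le (Unitary.star_mem uG)
  have := norm_mul_le_of_le_one_left uH
    (unitProd (n + 1) n (initC fl n t) * colMat (fl.reducedVec n t 0) -
      tailNorm fl n t n • corner n)
  rwa [Matrix.mul_sub, ← Matrix.mul_assoc, Matrix.mem_unitaryGroup_iff'.1 uG, Matrix.one_mul,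
    Matrix.mul_smul, Matrix.star_eq_conjTranspose] at this

end FloatArith

/-! ### Backward error of the factored triangular matrices -/

lemma conjTranspose_incl_mul_mul_incl {n : ℕ} (A : Matrix (Fin (n + 1)) (Fin (n + 1)) ℂ) :
    (incl (n + 1) n 0)ᴴ * A * incl (n + 1) n 0 = A.submatrix Fin.castSucc Fin.castSucc := by
  ext i j
  simp only [Matrix.mul_apply, Matrix.conjTranspose_apply, incl, Matrix.of_apply, zero_add,
    Matrix.submatrix_apply]
  rw [Finset.sum_eq_single j.castSucc, Finset.sum_eq_single i.castSucc]
  · simp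
  · intro b _ hb
    rw [if_neg, star_zero, zero_mul]
    exact fun h => hb (Fin.ext h)
  · simp
  · intro b _ hb
    rw [if_neg, mul_zero]
    exact fun h => hb (Fin.ext h)
  · simp

lemma triMat_eq (n : ℕ) (C B : ℕ → Core) :
    triMat n C B = (incl (n + 1) n 0)ᴴ *
      ((1 + (-((prodMat (n + 1) n C)ᴴ (Fin.last n) 0)⁻¹) •
        ((prodMat (n + 1) n C)ᴴ * corner n)) *
          ((prodMat (n + 1) n C)ᴴ * prodMat (n + 1) n B)) * incl (n + 1) n 0 := by
  rw [conjTranspose_incl_mul_mul_incl, triMat]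
  set Cs := (prodMat (n + 1) n C)ᴴ
  set Bm := prodMat (n + 1) n B
  have e : Matrix.vecMulVec (Pi.single 0 1)
      (fun j => -(Cs (Fin.last n) 0)⁻¹ * (Cs * Bm) (Fin.last n) j) =
      (-(Cs (Fin.last n) 0)⁻¹) • (corner n * (Cs * Bm)) := by
    ext i j
    rw [Matrix.vecMulVec_apply, Matrix.smul_apply, corner]
    by_cases h : i = 0
    · subst h
      simp
    · simp [h]
  simp only [e]
  congr 1
  rw [Matrix.mul_add, Matrix.add_mul, Matrix.one_mul, Matrix.mul_smul, Matrix.smul_mul,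
    ← Matrix.mul_assoc Cs (corner n)]

/-- Perturbation of the product `(1 + β P K) (P B)`. -/
lemma norm_one_add_smul_mul_sub_le {m : ℕ} {P P₁ B B₁ K : Matrix (Fin m) (Fin m) ℂ} {β β' : ℂ}
    {δ η ζ : ℝ} (hP : ‖P - P₁‖ ≤ δ) (hB : ‖B - B₁‖ ≤ δ) (nP₁ : ‖P₁‖ ≤ 1) (nB₁ : ‖B₁‖ ≤ 1)
    (nK : ‖K‖ ≤ 1) (hβ : RelErr η β' β) (hβζ : ‖β‖ ≤ 2 * ζ) (hζ : 1 ≤ ζ) (hδ1 : δ ≤ 1)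
    (hη : 0 ≤ η) :
    ‖(1 + β' • (P * K)) * (P * B) - (1 + β • (P₁ * K)) * (P₁ * B₁)‖ ≤ (17 * δ + 16 * η) * ζ := by
  have hδ : 0 ≤ δ := (norm_nonneg _).trans hP
  have nP : ‖P‖ ≤ 2 := by
    have := norm_add_le (P - P₁) P₁
    rw [sub_add_cancel] at this
    linarith
  have nB : ‖B‖ ≤ 2 := by
    have := norm_add_le (B - B₁) B₁
    rw [sub_add_cancel] at this
    linarith
  have hPB : ‖P * B - P₁ * B₁‖ ≤ 3 * δ := by
    have e : P * B - P₁ * B₁ = (P - P₁) * B + P₁ * (B - B₁) := by noncomm_ring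
    rw [e]
    have h1 := (Matrix.l2_opNorm_mul (P - P₁) B).trans (mul_le_mul hP nB (norm_nonneg _) hδ)
    have h2 := (norm_mul_le_of_le_one_left nP₁ (B - B₁)).trans hB
    exact (norm_add_le _ _).trans (by linarith)
  have nPB : ‖P * B‖ ≤ 4 := (Matrix.l2_opNorm_mul _ _).trans
    ((mul_le_mul nP nB (norm_nonneg _) (by norm_num)).trans (by norm_num))
  have hF : ‖β' • (P * K) - β • (P₁ * K)‖ ≤ (4 * η + 2 * δ) * ζ := by
    have e : β' • (P * K) - β • (P₁ * K) = (β' - β) • (P * K) + β • ((P - P₁) * K) := by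
      rw [sub_smul, Matrix.sub_mul, smul_sub]
      abel
    rw [e]
    have h1 : ‖(β' - β) • (P * K)‖ ≤ η * (2 * ζ) * 2 := by
      rw [norm_smul]
      exact mul_le_mul (le_trans hβ (mul_le_mul_of_nonneg_left hβζ hη))
        ((norm_mul_le_of_le_one_right _ nK).trans nP) (norm_nonneg _) (by positivity)
    have h2 : ‖β • ((P - P₁) * K)‖ ≤ 2 * ζ * δ := by
      rw [norm_smul]
      exact mul_le_mul hβζ ((norm_mul_le_of_le_one_right _ nK).trans hP) (norm_nonneg _)
        (by linarith)
    exact (norm_add_le _ _).trans (by linarith)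
  have n1 : ‖1 + β • (P₁ * K)‖ ≤ 1 + 2 * ζ := by
    refine (norm_add_le _ _).trans (add_le_add norm_one_le ?_)
    rw [norm_smul]
    refine (mul_le_of_le_one_right (norm_nonneg _) ?_).trans hβζ
    exact (norm_mul_le_of_le_one_right _ nK).trans nP₁
  have e : (1 + β' • (P * K)) * (P * B) - (1 + β • (P₁ * K)) * (P₁ * B₁) =
      (1 + β • (P₁ * K)) * (P * B - P₁ * B₁) +
        (β' • (P * K) - β • (P₁ * K)) * (P * B) := by
    simp only [Matrix.add_mul, Matrix.mul_sub, Matrix.sub_mul, Matrix.one_mul]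
    abel
  rw [e]
  have h1 := (Matrix.l2_opNorm_mul (1 + β • (P₁ * K)) (P * B - P₁ * B₁)).trans
    (mul_le_mul n1 hPB (norm_nonneg _) (by linarith))
  have h2 := (Matrix.l2_opNorm_mul (β' • (P * K) - β • (P₁ * K)) (P * B)).trans
    (mul_le_mul hF nPB (norm_nonneg _) (by positivity))
  refine (norm_add_le _ _).trans ?_
  have : δ ≤ δ * ζ := le_mul_of_one_le_right hδ hζ
  linarith

/-- Transformations of `C` and `B` from the left cancel in the factored form if they fix `e₁`. -/
lemma one_add_smul_mul_eq {n : ℕ} {C₀ X Y : Matrix (Fin (n + 1)) (Fin (n + 1)) ℂ}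
    {L R : Matrix (Fin n) (Fin n) ℂ} (β : ℂ) (hC₀ : C₀ᴴ * C₀ = 1) (hX : X * Xᴴ = 1)
    (hXc : X * corner n = corner n) :
    (1 + β • ((Xᴴ * C₀ * extend L)ᴴ * corner n)) *
        ((Xᴴ * C₀ * extend L)ᴴ * (Xᴴ * (C₀ * Y) * extend R)) =
      (extend L)ᴴ * ((1 + β • (C₀ᴴ * corner n)) * Y) * extend R := by
  have e0 : (Xᴴ * C₀ * extend L)ᴴ = (extend L)ᴴ * (C₀ᴴ * X) := by
    rw [Matrix.conjTranspose_mul, Matrix.conjTranspose_mul, Matrix.conjTranspose_conjTranspose]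
  have e1 : (extend L)ᴴ * (C₀ᴴ * X) * (Xᴴ * (C₀ * Y) * extend R) =
      (extend L)ᴴ * (Y * extend R) := by
    calc (extend L)ᴴ * (C₀ᴴ * X) * (Xᴴ * (C₀ * Y) * extend R)
        = (extend L)ᴴ * (C₀ᴴ * ((X * Xᴴ) * C₀)) * (Y * extend R) := by
          simp only [Matrix.mul_assoc]
      _ = _ := by rw [hX, Matrix.one_mul, hC₀, Matrix.mul_one]
  have e2 : (extend L)ᴴ * (C₀ᴴ * X) * corner n = (extend L)ᴴ * (C₀ᴴ * corner n) := by
    rw [Matrix.mul_assoc, Matrix.mul_assoc, hXc]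
  have e3 : corner n * (extend L)ᴴ = corner n := by
    rw [← extend_conjTranspose, corner_mul_extend]
  have e4 : (extend L)ᴴ * (C₀ᴴ * corner n) * ((extend L)ᴴ * (Y * extend R)) =
      (extend L)ᴴ * (C₀ᴴ * corner n * Y) * extend R := by
    calc (extend L)ᴴ * (C₀ᴴ * corner n) * ((extend L)ᴴ * (Y * extend R))
        = (extend L)ᴴ * (C₀ᴴ * ((corner n * (extend L)ᴴ) * (Y * extend R))) := by
          simp only [Matrix.mul_assoc]
      _ = _ := by rw [e3]; simp only [Matrix.mul_assoc]
  rw [e0, e1, e2, Matrix.add_mul, Matrix.smul_mul, e4, Matrix.one_mul, Matrix.add_mul,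
    Matrix.one_mul, Matrix.mul_add, Matrix.add_mul, Matrix.smul_mul, Matrix.mul_smul,
    Matrix.smul_mul, ← Matrix.mul_assoc]

/-- Perturbation of the factored form: if the stored cores represent `C ≈ Xᴴ C₀ (L ⊕ 1)` and
`B ≈ Xᴴ C₀ Y (R ⊕ 1)`, and `D = z eₙ₊₁ᵀ` where `C₀ᴴ e₁` is almost proportional to `z`, then the
stored matrix is close to `Lᴴ Pᵀ (1 + D) Y P R`. -/
lemma norm_triMat_sub_le {n : ℕ} {C B : ℕ → Core} {C₀ X Y D : Matrix (Fin (n + 1)) (Fin (n + 1)) ℂ}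
    {L R : Matrix (Fin n) (Fin n) ℂ} {β : ℂ} {δ η θ ζ : ℝ}
    (hC₀ : C₀ ∈ Matrix.unitaryGroup (Fin (n + 1)) ℂ) (hX : X ∈ Matrix.unitaryGroup (Fin (n + 1)) ℂ)
    (hY : Y ∈ Matrix.unitaryGroup (Fin (n + 1)) ℂ) (hL : L ∈ Matrix.unitaryGroup (Fin n) ℂ)
    (hR : R ∈ Matrix.unitaryGroup (Fin n) ℂ) (hXc : X * corner n = corner n)
    (hC : ‖prodMat (n + 1) n C - Xᴴ * C₀ * extend L‖ ≤ δ)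
    (hB : ‖prodMat (n + 1) n B - Xᴴ * (C₀ * Y) * extend R‖ ≤ δ)
    (hβ : RelErr η (-((prodMat (n + 1) n C)ᴴ (Fin.last n) 0)⁻¹) β)
    (hD : ‖D - β • (C₀ᴴ * corner n)‖ ≤ θ * ζ) (hβζ : ‖β‖ ≤ 2 * ζ) (hζ : 1 ≤ ζ) (hδ1 : δ ≤ 1)
    (hη : 0 ≤ η) :
    ‖triMat n C B - Lᴴ * ((incl (n + 1) n 0)ᴴ * ((1 + D) * Y) * incl (n + 1) n 0) * R‖ ≤
      (17 * δ + 16 * η + θ) * ζ := by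
  have hJ : (incl (n + 1) n 0)ᴴ * incl (n + 1) n 0 = 1 := incl_succ_isometry
  have uL := extend_unitary hL
  have uR := extend_unitary hR
  have uA : Xᴴ * C₀ * extend L ∈ Matrix.unitaryGroup (Fin (n + 1)) ℂ :=
    mul_mem (mul_mem (Unitary.star_mem hX) hC₀) uL
  have uB : Xᴴ * (C₀ * Y) * extend R ∈ Matrix.unitaryGroup (Fin (n + 1)) ℂ :=
    mul_mem (mul_mem (Unitary.star_mem hX) (mul_mem hC₀ hY)) uR
  have nL : ‖(extend L)ᴴ‖ ≤ 1 := norm_unitary_le (Unitary.star_mem uL)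
  have dC : ‖(prodMat (n + 1) n C)ᴴ - (Xᴴ * C₀ * extend L)ᴴ‖ ≤ δ := by
    rw [← Matrix.conjTranspose_sub, Matrix.l2_opNorm_conjTranspose]
    exact hC
  have hM := norm_one_add_smul_mul_sub_le dC hB (norm_unitary_le (Unitary.star_mem uA))
    (norm_unitary_le uB) norm_corner_le hβ hβζ hζ hδ1 hη
  rw [one_add_smul_mul_eq β (Matrix.mem_unitaryGroup_iff'.1 hC₀) (Matrix.mem_unitaryGroup_iff.1 hX)
    hXc] at hM
  have e1 : Lᴴ * ((incl (n + 1) n 0)ᴴ * ((1 + D) * Y) * incl (n + 1) n 0) * R =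
      (incl (n + 1) n 0)ᴴ * ((extend L)ᴴ * ((1 + D) * Y) * extend R) * incl (n + 1) n 0 := by
    have h1 : (incl (n + 1) n 0)ᴴ * (extend L)ᴴ = Lᴴ * (incl (n + 1) n 0)ᴴ := by
      rw [← extend_conjTranspose]
      exact conjTranspose_mul_emb hJ _
    have h2 : extend R * incl (n + 1) n 0 = incl (n + 1) n 0 * R := emb_mul_self hJ R
    calc Lᴴ * ((incl (n + 1) n 0)ᴴ * ((1 + D) * Y) * incl (n + 1) n 0) * R
        = (Lᴴ * (incl (n + 1) n 0)ᴴ) * ((1 + D) * Y) * (incl (n + 1) n 0 * R) := by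
          simp only [Matrix.mul_assoc]
      _ = _ := by rw [← h1, ← h2]; simp only [Matrix.mul_assoc]
  have h3 : ‖(extend L)ᴴ * ((D - β • (C₀ᴴ * corner n)) * Y) * extend R‖ ≤ θ * ζ :=
    (norm_mul_le_of_le_one_right _ (norm_unitary_le uR)).trans
      ((norm_mul_le_of_le_one_left nL _).trans
        ((norm_mul_le_of_le_one_right _ (norm_unitary_le hY)).trans hD))
  have e2 : (extend L)ᴴ * ((1 + D) * Y) * extend R =
      (extend L)ᴴ * ((1 + β • (C₀ᴴ * corner n)) * Y) * extend R +
        (extend L)ᴴ * ((D - β • (C₀ᴴ * corner n)) * Y) * extend R := by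
    rw [← Matrix.add_mul, ← Matrix.mul_add, ← Matrix.add_mul, add_assoc, add_sub_cancel]
  have nJ := norm_le_one_of_isometry hJ
  rw [triMat_eq, e1, ← Matrix.sub_mul, ← Matrix.mul_sub]
  refine (norm_mul_le_of_le_one_right _ nJ).trans ((norm_mul_le_of_le_one_left
    (by rwa [Matrix.l2_opNorm_conjTranspose]) _).trans ?_)
  rw [e2, ← sub_sub]
  exact (norm_sub_le _ _).trans (by linarith)

/-- The identity matrix with its last column replaced by `(t 0, …, t (n-1))`. -/
noncomputable def lastCol (n : ℕ) (t : ℕ → ℂ) : Matrix (Fin n) (Fin n) ℂ :=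
  Matrix.of fun i j => if j.1 + 1 = n then t i else if i = j then 1 else 0

/-- Exchange of two neighbouring coordinates. -/
def swapCore : Core := ⟨0, 1, -1⟩

lemma swapCore_isUnitary : swapCore.IsUnitary := by simp [swapCore, IsUnitary]

namespace FloatArith

variable {u : ℝ} (fl : FloatArith u)

lemma unitProd_initB {n : ℕ} (hn : 0 < n) (t : ℕ → ℂ) :
    unitProd (n + 1) n (initB fl n t) =
      unitProd (n + 1) n (initC fl n t) * toMat (n + 1) (n - 1) swapCore := by
  obtain ⟨m, rfl⟩ : ∃ m, n = m + 1 := ⟨n - 1, by omega⟩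
  rw [unitProd, unitProd, prodMat_succ, prodMat_succ, prodMat_eq_segMat, prodMat_eq_segMat,
    Nat.add_sub_cancel, Matrix.mul_assoc, ← toMat_mul (by omega)]
  congr 1
  · refine segMat_congr fun j _ hj => ?_
    simp only [initB]
    rw [if_neg (by omega)]
  · congr 1
    simp only [initB, if_true, exactUnit, Core.mul, swapCore, initC]
    simp [add_comm, neg_div]

/-- In exact arithmetic the factored form starts from the given triangular matrix: here
`z eₙ₊₁ᵀ` is the rank-one part, and the exchange of the last two coordinates brings the column `z`
to its place. -/
lemma submatrix_reducedVec {n : ℕ} (t : ℕ → ℂ) :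
    (incl (n + 1) n 0)ᴴ * ((1 + colMat (fl.reducedVec n t 0)) * toMat (n + 1) (n - 1) swapCore) *
      incl (n + 1) n 0 = lastCol n t := by
  rw [conjTranspose_incl_mul_mul_incl]
  ext i j
  have hi := i.2
  have hj := j.2
  rw [Matrix.submatrix_apply, mul_toMat_apply (by omega), lastCol, Matrix.of_apply]
  by_cases h : j.1 + 1 = n
  · rw [if_pos (by simp; omega), if_pos h]
    have h1 : (⟨n - 1 + 1, by omega⟩ : Fin (n + 1)) = Fin.last n := by
      ext; simp; omega
    rw [h1]
    have h2 : i.castSucc ≠ Fin.last n := (Fin.castSucc_lt_last i).ne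
    simp [swapCore, colMat, Matrix.vecMulVec_apply, reducedVec, h2, Matrix.one_apply]
  · rw [if_neg (by simp; omega), if_neg (by simp; omega), if_neg h]
    have h2 : j.castSucc ≠ Fin.last n := (Fin.castSucc_lt_last j).ne
    simp [colMat, Matrix.vecMulVec_apply, h2, Matrix.one_apply]

lemma norm_reducedVec_le {n : ℕ} (t : ℕ → ℂ) :
    ‖colMat (fl.reducedVec n t 0)‖ ≤ √(∑ i : Fin n, ‖t i‖ ^ 2) + 1 := by
  rw [norm_colMat, Fin.sum_univ_castSucc]
  refine Real.sqrt_le_iff.2 ⟨by positivity, ?_⟩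
  have h := Real.sq_sqrt (show 0 ≤ ∑ i : Fin n, ‖t i‖ ^ 2 by positivity)
  have h0 := Real.sqrt_nonneg (∑ i : Fin n, ‖t i‖ ^ 2)
  have e : ∑ i : Fin n, ‖fl.reducedVec n t 0 i.castSucc‖ ^ 2 = ∑ i : Fin n, ‖t i‖ ^ 2 :=
    Finset.sum_congr rfl fun i _ => by simp [reducedVec]
  rw [e]
  simp only [reducedVec, tailNorm, Fin.val_last]
  simp
  nlinarith

lemma one_le_norm_reducedVec {n : ℕ} (t : ℕ → ℂ) :
    1 ≤ ‖colMat (fl.reducedVec n t 0)‖ := by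
  have := norm_entry_le_norm_colMat (fl.reducedVec n t 0) (Fin.last n)
  simpa [reducedVec, tailNorm] using this

lemma norm_lastCol_le {n : ℕ} (hn : 0 < n) (t : ℕ → ℂ) :
    ‖lastCol n t‖ ≤ 2 * ‖colMat (fl.reducedVec n t 0)‖ := by
  rw [← fl.submatrix_reducedVec]
  have nJ : ‖incl (n + 1) n 0‖ ≤ 1 := norm_le_one_of_isometry incl_succ_isometry
  refine (norm_mul_le_of_le_one_right _ nJ).trans ((norm_mul_le_of_le_one_left
    (by rwa [Matrix.l2_opNorm_conjTranspose]) _).trans ((norm_mul_le_of_le_one_right _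
      (norm_unitary_le (toMat_unitary (by omega) swapCore_isUnitary))).trans ?_))
  have h1 := norm_add_le (1 : Matrix (Fin (n + 1)) (Fin (n + 1)) ℂ) (colMat (fl.reducedVec n t 0))
  have h2 := norm_one_le (m := n + 1)
  have h3 := fl.one_le_norm_reducedVec (n := n) t
  linarith

/-- The matrix represented by the stored cores, compared with the exact transformation of the
exact initial matrix. -/
theorem triMat_backward_error (hu1 : u ≤ 1 / 1000000000000) {n : ℕ} (hn : 0 < n) (t : ℕ → ℂ)
    {N : ℕ} {C B : ℕ → Core} {L R : Matrix (Fin n) (Fin n) ℂ} (nC : AllNear u C)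
    (nB : AllNear u B) (hL : L ∈ Matrix.unitaryGroup (Fin n) ℂ)
    (hR : R ∈ Matrix.unitaryGroup (Fin n) ℂ) (hs : SineTracks n u N (initC fl n t) C)
    (ht : PairTracks (N * (400000 * u)) (initC fl n t) (initB fl n t) C B L R)
    (hN : 1000000 * ((N + n : ℝ) * u) ≤ 1) :
    ‖triMat n C B - Lᴴ * lastCol n t * R‖ ≤
      10000000 * ((N + n) * u) * (√(∑ i : Fin n, ‖t i‖ ^ 2) + 1) := by
  have hu := fl.u_nonneg
  obtain ⟨X, uX, hX, tC, tB⟩ := ht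
  have hNu : 0 ≤ (N : ℝ) * u := by positivity
  have hnu : 0 ≤ (n : ℝ) * u := by positivity
  have hn1 : 1000000 * (n * u) ≤ 1 := by linarith
  have hpow : (1 + 22 * u) ^ n - 1 ≤ 44 * (n * u) := by
    have := one_add_pow_sub_one_le (x := 22 * u) (by linarith) (k := n) (by linarith)
    linarith
  have hC : ‖prodMat (n + 1) n C - Xᴴ * unitProd (n + 1) n (initC fl n t) * extend L‖ ≤
      400000 * ((N + n) * u) := by
    have := norm_sub_le_norm_sub_add_norm_sub (prodMat (n + 1) n C) (unitProd (n + 1) n C)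
      (Xᴴ * unitProd (n + 1) n (initC fl n t) * extend L)
    linarith [norm_prodMat_sub_unitProd_le hu hu1 nC n (m := n + 1) le_rfl]
  have hB : ‖prodMat (n + 1) n B - Xᴴ * (unitProd (n + 1) n (initC fl n t) *
      toMat (n + 1) (n - 1) swapCore) * extend R‖ ≤ 400000 * ((N + n) * u) := by
    rw [← fl.unitProd_initB hn]
    have := norm_sub_le_norm_sub_add_norm_sub (prodMat (n + 1) n B) (unitProd (n + 1) n B)
      (Xᴴ * unitProd (n + 1) n (initB fl n t) * extend R)
    linarith [norm_prodMat_sub_unitProd_le hu hu1 nB n (m := n + 1) le_rfl]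
  have hβ : RelErr (80000 * ((N + n) * u)) (-((prodMat (n + 1) n C)ᴴ (Fin.last n) 0)⁻¹)
      (tailNorm fl n t n) := by
    have := (fl.inv_corner_relErr hu1 t hs hN).const_mul (-1)
    simpa using this
  have hD := fl.norm_colMat_sub_corner_le hu1 t hn1
  have uC := unitProd_unitary hu1 (m := n + 1) le_rfl (fl.initC_near hu1 n t)
  set ζ := ‖colMat (fl.reducedVec n t 0)‖ with hζ
  have hζ1 : 1 ≤ ζ := fl.one_le_norm_reducedVec t
  have hβζ : ‖tailNorm fl n t n‖ ≤ 2 * ζ := by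
    have h := fl.initC_mul_colMat hu1 t hn1 n le_rfl
    have h1 := norm_entry_le_norm_colMat (fl.reducedVec n t n) 0
    rw [show fl.reducedVec n t n 0 = tailNorm fl n t n by simp [reducedVec]] at h1
    rw [Nat.sub_self, ← prodMat_eq_segMat] at h
    change ‖unitProd (n + 1) n (initC fl n t) * _ - _‖ ≤ _ at h
    have h2 := norm_mul_le_of_le_one_left (norm_unitary_le uC) (colMat (fl.reducedVec n t 0))
    have h3 := norm_sub_le (unitProd (n + 1) n (initC fl n t) * colMat (fl.reducedVec n t 0))
      (unitProd (n + 1) n (initC fl n t) * colMat (fl.reducedVec n t 0) -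
        colMat (fl.reducedVec n t n))
    rw [sub_sub_cancel] at h3
    have h4 : 400 * (n * u) * ζ ≤ ζ := mul_le_of_le_one_left (by linarith) (by linarith)
    linarith
  have key := norm_triMat_sub_le uC uX
    (toMat_unitary (m := n + 1) (i := n - 1) (by omega) swapCore_isUnitary) hL hR hX hC hB hβ hD
    hβζ hζ1 (by linarith) (by linarith)
  rw [fl.submatrix_reducedVec] at key
  refine key.trans ?_
  have h5 : 17 * (400000 * ((N + n) * u)) + 16 * (80000 * ((N + n) * u)) + 400 * (n * u) ≤
      10000000 * ((N + n) * u) := by linarith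
  exact mul_le_mul h5 (fl.norm_reducedVec_le t) (norm_nonneg _) (by linarith)

end FloatArith

/-! ### Backward error of the pencil -/

lemma PairTracks.swap {n : ℕ} {δ : ℝ} {A₀ B₀ A B : ℕ → Core} {L R : Matrix (Fin n) (Fin n) ℂ}
    (h : PairTracks δ A₀ B₀ A B L R) : PairTracks δ B₀ A₀ B A R L := by
  obtain ⟨X, h1, h2, h3, h4⟩ := h
  exact ⟨X, h1, h2, h4, h3⟩

/-- A product of exchanges of neighbouring coordinates is a cyclic shift. -/
lemma prodMat_swapCore {n k : ℕ} (hk : k + 1 ≤ n) (r c : Fin n) :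
    prodMat n k (fun _ => swapCore) r c =
      if r.1 = (if c.1 < k then c.1 + 1 else if c.1 = k then 0 else c.1) then 1 else 0 := by
  induction k generalizing r c with
  | zero =>
    rw [prodMat_zero, Matrix.one_apply]
    by_cases h : c.1 = 0 <;> simp [Fin.ext_iff, h]
  | succ k ih =>
    rw [prodMat_succ, mul_toMat_apply (by omega), ih (by omega), ih (by omega), ih (by omega)]
    have h1 : ¬ k + 1 < k := by omega
    by_cases h : c.1 = k
    · simp [h, swapCore]
    · by_cases h' : c.1 = k + 1
      · simp [h', swapCore]
      · have h2 : c.1 < k + 1 ↔ c.1 < k := by omega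
        simp [h, h', h2]

/-- The initial factorization `V = Q R`. -/
lemma shift_mul_lastCol {n : ℕ} [NeZero n] (v : EuclideanSpace ℂ (Fin n)) :
    unitProd n (n - 1) (fun _ => swapCore) * lastCol n (fun i => -v (Fin.ofNat n (i + 1))) =
      pencilV v := by
  have hn := NeZero.pos n
  have e : unitProd n (n - 1) (fun _ => swapCore) = prodMat n (n - 1) (fun _ => swapCore) := by
    rw [unitProd, exactUnit_eq_self swapCore_isUnitary]
  rw [e]
  ext i j
  have hi := i.2
  have hj := j.2
  rw [Matrix.mul_apply, pencilV, Matrix.of_apply]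
  -- the only column `c` of the shift with a nonzero entry in row `i`
  obtain ⟨c, hc⟩ : ∃ c : Fin n, i.1 = if c.1 < n - 1 then c.1 + 1 else 0 := by
    by_cases h : i.1 = 0
    · exact ⟨⟨n - 1, by omega⟩, by simp [h]⟩
    · refine ⟨⟨i.1 - 1, by omega⟩, ?_⟩
      dsimp only
      rw [if_pos (by omega)]
      omega
  have hc' := c.2
  rw [Finset.sum_eq_single c]
  · have h1 : prodMat n (n - 1) (fun _ => swapCore) i c = 1 := by
      rw [prodMat_swapCore (by omega), if_pos]
      split_ifs at hc ⊢ <;> omega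
    rw [h1, one_mul, lastCol, Matrix.of_apply]
    by_cases h : j.1 + 1 = n
    · rw [if_pos h, if_pos h]
      suffices hs : Fin.ofNat n (c.1 + 1) = i by rw [hs]
      ext
      rw [Fin.val_ofNat]
      split_ifs at hc with h2
      · rw [Nat.mod_eq_of_lt (by omega), hc]
      · rw [show c.1 + 1 = n by omega, Nat.mod_self, hc]
    · rw [if_neg h, if_neg h]
      by_cases h3 : c = j
      · subst h3
        rw [if_pos rfl, if_pos]
        rw [hc, if_pos (by omega)]
      · rw [if_neg h3, if_neg]
        intro h4
        apply h3
        ext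
        split_ifs at hc <;> omega
  · intro b _ hb
    have hb' := b.2
    rw [prodMat_swapCore (by omega), if_neg, zero_mul]
    intro h
    apply hb
    ext
    split_ifs at hc h <;> omega
  · simp

lemma lastCol_eq_pencilW {n : ℕ} [NeZero n] (w : EuclideanSpace ℂ (Fin n)) :
    lastCol n (fun i => w (Fin.ofNat n i)) = pencilW w := by
  ext i j
  simp [lastCol, pencilW]

lemma sqrt_sum_entries_W {n : ℕ} [NeZero n] (w : EuclideanSpace ℂ (Fin n)) :
    √(∑ i : Fin n, ‖w (Fin.ofNat n i)‖ ^ 2) = ‖w‖ := by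
  rw [EuclideanSpace.norm_eq]
  simp

lemma sqrt_sum_entries_V {n : ℕ} [NeZero n] (v : EuclideanSpace ℂ (Fin n)) :
    √(∑ i : Fin n, ‖-v (Fin.ofNat n (i + 1))‖ ^ 2) = ‖v‖ := by
  rw [EuclideanSpace.norm_eq,
    ← Equiv.sum_comp (Equiv.addRight (1 : Fin n)) (fun i => ‖v i‖ ^ 2)]
  congr 1
  refine Finset.sum_congr rfl fun i _ => ?_
  have e : Fin.ofNat n (i + 1) = i + 1 := by
    ext
    rw [Fin.val_ofNat, Fin.val_add, Fin.val_one']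
    simp
  rw [norm_neg, Equiv.coe_addRight, e]

/-- An error of the transformed matrix is a backward error of the same size. -/
lemma exists_backward_error {n : ℕ} {A A₀ U Z : Matrix (Fin n) (Fin n) ℂ} {b : ℝ}
    (hU : U ∈ Matrix.unitaryGroup (Fin n) ℂ) (hZ : Z ∈ Matrix.unitaryGroup (Fin n) ℂ)
    (h : ‖A - Uᴴ * A₀ * Z‖ ≤ b) : ∃ D, A = Uᴴ * (A₀ + D) * Z ∧ ‖D‖ ≤ b := by
  refine ⟨U * (A - Uᴴ * A₀ * Z) * Zᴴ, ?_, ?_⟩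
  · have h1 : Uᴴ * U = 1 := Matrix.mem_unitaryGroup_iff'.1 hU
    have h2 : Zᴴ * Z = 1 := Matrix.mem_unitaryGroup_iff'.1 hZ
    calc A = Uᴴ * A₀ * Z + (Uᴴ * U) * (A - Uᴴ * A₀ * Z) * (Zᴴ * Z) := by
          rw [h1, h2, Matrix.one_mul, Matrix.mul_one, add_sub_cancel]
      _ = _ := by simp only [Matrix.mul_add, Matrix.add_mul, Matrix.mul_assoc]
  · exact (norm_mul_le_of_le_one_right _ (norm_unitary_le (Unitary.star_mem hZ))).trans
      ((norm_mul_le_of_le_one_left (norm_unitary_le hU) _).trans h)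

namespace FloatArith

variable {u : ℝ} (fl : FloatArith u)

/-- The error of the computed `W`, relative to the exact transformation of the initial `W`. -/
theorem matW_backward_error (hu1 : u ≤ 1 / 1000000000000) {n : ℕ} [NeZero n]
    {v w : EuclideanSpace ℂ (Fin n)} {S : QZState n} {N : ℕ} {M P : Matrix (Fin n) (Fin n) ℂ}
    (h : Invariant u (initState fl v w) S N M P) (hN : 10000000 * ((N + n : ℝ) * u) ≤ 1) :
    ‖S.matW - S.Uᴴ * pencilW w * S.Z‖ ≤ 10000000 * ((N + n) * u) * (‖w‖ + 1) := by
  have key := fl.triMat_backward_error hu1 (NeZero.pos n) _ h.near_CW h.near_BW h.unitary_U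
    h.unitary_Z h.sine_W h.track_W (by linarith)
  rwa [lastCol_eq_pencilW, sqrt_sum_entries_W] at key

/-- The error of the computed `V`: as for `W`; the transformation between the two factors `Q`
and `R` cancels. -/
theorem matV_backward_error (hu1 : u ≤ 1 / 1000000000000) {n : ℕ} [NeZero n]
    {v w : EuclideanSpace ℂ (Fin n)} {S : QZState n} {N : ℕ}
    (h : Invariant u (initState fl v w) S N (unitProd n (n - 1) S.Q) 1)
    (hN : 10000000 * ((N + n : ℝ) * u) ≤ 1) :
    ‖S.matV - S.Uᴴ * pencilV v * S.Z‖ ≤ 20000000 * ((N + n) * u) * (‖v‖ + 1) := by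
  have hu := fl.u_nonneg
  have hn := NeZero.pos n
  obtain ⟨X, uX, tX, hQ⟩ := h.track_V
  have key := fl.triMat_backward_error hu1 hn _ h.near_CV h.near_BV uX h.unitary_Z h.sine_V tX.swap
    (by linarith)
  have hT := (fl.norm_lastCol_le hn (fun i => -v (Fin.ofNat n (i + 1)))).trans
    (mul_le_mul_of_nonneg_left (fl.norm_reducedVec_le _) (by norm_num))
  rw [sqrt_sum_entries_V] at key hT
  have e0 := shift_mul_lastCol v
  set T := lastCol n (fun i => -v (Fin.ofNat n (i + 1)))
  set T' := triMat n S.CV S.BV with hT'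
  set Q' := prodMat n (n - 1) S.Q with hQ'
  have hQ0 : unitProd n (n - 1) (initState fl v w).Q =
      unitProd n (n - 1) (fun _ => swapCore) := rfl
  rw [hQ0, Matrix.mul_one] at hQ
  set Q₀ := unitProd n (n - 1) (fun _ => swapCore)
  have hNu : 0 ≤ (N : ℝ) * u := by positivity
  have hnu : 0 ≤ (n : ℝ) * u := by positivity
  have hv := norm_nonneg v
  have hQ1 : ‖Q' - S.Uᴴ * Q₀ * X‖ ≤ 400000 * ((N + n) * u) := by
    have h1 := norm_sub_le_norm_sub_add_norm_sub Q' (unitProd n (n - 1) S.Q) (S.Uᴴ * Q₀ * X)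
    have h2 := norm_prodMat_sub_unitProd_le hu hu1 h.near_Q (n - 1) (m := n) (by omega)
    have h3 : (1 + 22 * u) ^ (n - 1) ≤ (1 + 22 * u) ^ n :=
      pow_le_pow_right₀ (by linarith) (by omega)
    have h4 := one_add_pow_sub_one_le (x := 22 * u) (by linarith) (k := n) (by linarith)
    linarith
  have uQ : S.Uᴴ * Q₀ * X ∈ Matrix.unitaryGroup (Fin n) ℂ := by
    refine mul_mem (mul_mem (Unitary.star_mem h.unitary_U) ?_) uX
    refine unitProd_unitary hu1 (by omega) fun j => ?_
    simp [swapCore, NearUnit, size, hu]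
  have nT' : ‖T'‖ ≤ 3 * (‖v‖ + 1) := by
    have h1 := norm_add_le (T' - Xᴴ * T * S.Z) (Xᴴ * T * S.Z)
    rw [sub_add_cancel] at h1
    have h2 : ‖Xᴴ * T * S.Z‖ ≤ ‖T‖ :=
      (norm_mul_le_of_le_one_right _ (norm_unitary_le h.unitary_Z)).trans
        (norm_mul_le_of_le_one_left (norm_unitary_le (Unitary.star_mem uX)) _)
    have h3 := mul_le_mul_of_nonneg_right hN (show 0 ≤ ‖v‖ + 1 by positivity)
    linarith
  have e : S.matV - S.Uᴴ * pencilV v * S.Z =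
      (Q' - S.Uᴴ * Q₀ * X) * T' + S.Uᴴ * Q₀ * X * (T' - Xᴴ * T * S.Z) := by
    have h1 : X * Xᴴ = 1 := Matrix.mem_unitaryGroup_iff.1 uX
    have h2 : S.Uᴴ * Q₀ * X * (Xᴴ * T * S.Z) = S.Uᴴ * pencilV v * S.Z := by
      calc S.Uᴴ * Q₀ * X * (Xᴴ * T * S.Z)
          = S.Uᴴ * (Q₀ * ((X * Xᴴ) * T)) * S.Z := by simp only [Matrix.mul_assoc]
        _ = _ := by rw [h1, Matrix.one_mul, e0]
    rw [Matrix.sub_mul, Matrix.mul_sub, h2]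
    rw [QZState.matV]
    abel
  rw [e]
  have b1 := (Matrix.l2_opNorm_mul (Q' - S.Uᴴ * Q₀ * X) T').trans
    (mul_le_mul hQ1 nT' (norm_nonneg _) (by linarith))
  have b2 := (norm_mul_le_of_le_one_left (norm_unitary_le uQ) (T' - Xᴴ * T * S.Z)).trans key
  have b3 : 0 ≤ ((N : ℝ) + n) * u * (‖v‖ + 1) := by positivity
  exact (norm_add_le _ _).trans (by linarith)

end FloatArith

end CompanionQZ

theorem theorem5p10 :
    ∃ C : ℝ, 0 < C ∧
      ∀ (n : ℕ) [NeZero n] (a : EuclideanSpace ℂ (Fin (n + 1)))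
        (v w : EuclideanSpace ℂ (Fin n)) (κ : ℝ)
        (u : ℝ) (fl : CompanionQZ.FloatArith u) (K : ℕ) (S : CompanionQZ.QZState n),
        a 0 ≠ 0 → a (Fin.last n) ≠ 0 →
        CompanionQZ.IsSplitting a v w →
        ‖v‖ ≤ κ * ‖a‖ → ‖w‖ ≤ κ * ‖a‖ → 1 ≤ κ * ‖a‖ →
        C * n * (K + 1) * u ≤ 1 →
        CompanionQZ.QZRun fl v w K S →
        S.U ∈ Matrix.unitaryGroup (Fin n) ℂ ∧ S.Z ∈ Matrix.unitaryGroup (Fin n) ℂ ∧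
        ∃ δV δW : Matrix (Fin n) (Fin n) ℂ,
          S.matV = S.Uᴴ * (CompanionQZ.pencilV v + δV) * S.Z ∧
          ‖δV‖ ≤ C * κ * n * (K + 1) * u * ‖a‖ ∧
          S.matW = S.Uᴴ * (CompanionQZ.pencilW w + δW) * S.Z ∧
          ‖δW‖ ≤ C * κ * n * (K + 1) * u * ‖a‖ := by
  -- a constant that also forces `u ≤ 10⁻¹²`
  refine ⟨1000000000000, by norm_num, ?_⟩
  intro n _ a v w κ u fl K S _ _ _ hv hw hκ hC run
  have hu := fl.u_nonneg
  have hn : (1 : ℝ) ≤ n := by exact_mod_cast NeZero.pos n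
  have hnK : (1 : ℝ) ≤ n * (K + 1) := by nlinarith [K.cast_nonneg (α := ℝ)]
  have hnKu : u ≤ n * (K + 1) * u := le_mul_of_one_le_left hu hnK
  have hu1 : u ≤ 1 / 1000000000000 := by linarith
  have inv := fl.invariant_of_run hu1 run
  -- the run consists of at most `2 n K` operations, and `N + n ≤ 2 n (K + 1)`
  have hN : (((2 * n * K : ℕ) : ℝ) + n) * u ≤ 2 * (n * (K + 1) * u) := by
    push_cast
    have := mul_nonneg (zero_le_one.trans hn) hu
    linarith
  have hN1 : 10000000 * ((((2 * n * K : ℕ) : ℝ) + n) * u) ≤ 1 := by linarith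
  have hbound {x : ℝ} (hx : x ≤ κ * ‖a‖) : 20000000 * ((((2 * n * K : ℕ) : ℝ) + n) * u) * (x + 1) ≤
      1000000000000 * κ * n * (K + 1) * u * ‖a‖ := by
    have h0 : 0 ≤ (((2 * n * K : ℕ) : ℝ) + n) * u := by positivity
    have h1 : 20000000 * ((((2 * n * K : ℕ) : ℝ) + n) * u) * (x + 1) ≤
        20000000 * (2 * (n * (K + 1) * u)) * (2 * (κ * ‖a‖)) :=
      mul_le_mul_of_nonneg (by linarith) (by linarith) (by positivity) (by linarith)
    have h2 : 0 ≤ n * (K + 1) * u * (κ * ‖a‖) := mul_nonneg (by linarith) (by linarith)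
    linarith
  have bV := (fl.matV_backward_error hu1 inv hN1).trans (hbound hv)
  have bW : ‖S.matW - S.Uᴴ * CompanionQZ.pencilW w * S.Z‖ ≤
      1000000000000 * κ * n * (K + 1) * u * ‖a‖ := by
    refine (fl.matW_backward_error hu1 inv hN1).trans (le_trans ?_ (hbound hw))
    have : 0 ≤ (((2 * n * K : ℕ) : ℝ) + n) * u * (‖w‖ + 1) := by positivity
    linarith
  obtain ⟨δV, hV, nV⟩ := CompanionQZ.exists_backward_error inv.unitary_U inv.unitary_Z bV
  obtain ⟨δW, hW, nW⟩ := CompanionQZ.exists_backward_error inv.unitary_U inv.unitary_Z bW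
  exact ⟨inv.unitary_U, inv.unitary_Z, δV, δW, hV, nV, hW, nW⟩
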